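/- Let $\wp$, $\zeta$, $\sigma$ be the Weierstrass functions with periods $2\omega_1,2\omega_3$ (linearly independent over $\mathbb R$), let $\Gamma=2\omega_1\mathbb Z+2\omega_3\mathbb Z$, $\omega_0=0$, $\omega_2=-\omega_1-\omega_3$, $e_i=\wp(\omega_i)$ for $i=1,2,3$, $g_2=-4(e_1e_2+e_2e_3+e_3e_1)$, $g_3=4e_1e_2e_3$, and let $l_0,l_1,l_2,l_3\in\mathbb Z_{\ge 0}$. For $\delta_1\in\mathbb C$ with $2\delta_1\notin\Gamma$, $b_1=\wp(\delta_1)$ and $\mu_1\in\mathbb C$ put $$\tilde s_1=(4b_1^3-g_2b_1-g_3)\Big\{-\mu_1+\sum_{i=1}^3\frac{l_i}{2(b_1-e_i)}\Big\},\qquad s_1=\tilde s_1+\tfrac18(12b_1^2-g_2),$$ let $p$ satisfy the apparency condition $$p=(4b_1^3-g_2b_1-g_3)\Big\{-\mu_1^2+\sum_{i=1}^3\frac{l_i+\frac12}{b_1-e_i}\mu_1\Big\}-b_1(l_1+l_2+l_3-l_0)(l_1+l_2+l_3+l_0+1),$$ and define $E$ by $p=E+\tfrac32b_1-2(l_1l_2e_3+l_2l_3e_1+l_3l_1e_2)+\sum_{i=1}^3l_i(l_ie_i+2(e_i+b_1))$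 and $$v(x)=\sum_{i=0}^3l_i(l_i+1)\wp(x+\omega_i)+\tfrac34\big(\wp(x-\delta_1)+\wp(x+\delta_1)\big)+\frac{s_1}{\wp(x)-b_1}.$$ Let $$\Xi(x)=c_0+\frac{d_0}{\wp(x)-b_1}+\sum_{i=0}^3\sum_{j=0}^{l_i-1}b^{(i)}_j\wp(x+\omega_i)^{l_i-j}$$ be a nonzero solution of $\Xi'''-4(v-E)\Xi'-2v'\Xi=0$, let $Q=\Xi^2(E-v)+\frac12\Xi\,\Xi''-\frac14(\Xi')^2$ (a constant), fix a square root $\sqrt{-Q}$, and let $$\Lambda_g(x)=\sqrt{\wp(x)-b_1}\,\sqrt{\Xi(x)}\,\exp\int\frac{\sqrt{-Q}\,dx}{\Xi(x)} .$$ Suppose that $\Lambda_g$ is given by the Hermite–Krichever Ansatz: for some $\kappa\in\mathbb C$, some $\alpha\in\mathbb C\setminus\Gamma$ and some constants $\tilde b^{(i)}_j$, $$\Lambda_g(x)=e^{\kappa x}\sum_{i=0}^3\sum_{j=0}^{\tilde l_i-1}\tilde b^{(i)}_j\Big(\frac{d}{dx}\Big)^j\Phi_i(x,\alpha),\qquad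 \Phi_i(x,\alpha)=\frac{\sigma(x+\omega_i-\alpha)}{\sigma(x+\omega_i)}e^{\zeta(\alpha)x},$$ where $\tilde l_0=l_0+1$ and $\tilde l_i=l_i$ for $i=1,2,3$. Then there are rational functions $R_k=N_k/D_k$ ($k=1,2,3$) of two variables, in lowest terms, with complex coefficients that depend only on $\omega_1,\omega_3$ and $l_0,\dots,l_3$, such that for all such data $$\wp(\alpha)=R_1(b_1,\mu_1),\qquad \wp'(\alpha)=\frac{\sqrt{-Q}}{d_0}\,R_2(b_1,\mu_1),\qquad \kappa=\frac{\sqrt{-Q}}{d_0}\,R_3(b_1,\mu_1),$$ in the sense that $D_1\,\wp(\alpha)=N_1$, $D_2\,d_0\,\wp'(\alpha)=\sqrt{-Q}\,N_2$ and $D_3\,d_0\,\kappa=\sqrt{-Q}\,N_3$ hold at $(b_1,\mu_1)$. In particular, with the normalization $d_0=1$ of $\Xi$, $\wp'(\alpha)$ and $\kappa$ are $\sqrt{-Q}$ times rational functions of $(b_1,\mu_1)$. The case $Q=0$ is included. -/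

import Mathlib

namespace HKAnsatz

noncomputable section

open Complex

/-- The half periods `ω_0 = 0`, `ω_1`, `ω_2 = -ω_1 - ω_3`, `ω_3`; the two members of the period
pair `L` are the full periods `2 ω_1` and `2 ω_3`. -/
def halfPeriod (L : PeriodPair) : Fin 4 → ℂ :=
  ![0, L.ω₁ / 2, -(L.ω₁ / 2) - L.ω₂ / 2, L.ω₂ / 2]

/-- `e_i = ℘(ω_i)` for `i = 1, 2, 3` (the value at `i = 0` is never used). -/
def e (L : PeriodPair) (i : Fin 4) : ℂ := L.weierstrassP (halfPeriod L i)

/-- `g_2 = -4 (e_1 e_2 + e_2 e_3 + e_3 e_1)`. -/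
def gTwo (L : PeriodPair) : ℂ := -4 * (e L 1 * e L 2 + e L 2 * e L 3 + e L 3 * e L 1)

/-- `g_3 = 4 e_1 e_2 e_3`. -/
def gThree (L : PeriodPair) : ℂ := 4 * e L 1 * e L 2 * e L 3

/-- The Weierstrass sigma function of the period lattice. -/
def sigma (L : PeriodPair) (z : ℂ) : ℂ :=
  z * ∏' w : {w : L.lattice // w ≠ 0},
    (1 - z / (w.1 : ℂ)) * exp (z / (w.1 : ℂ) + z ^ 2 / (2 * (w.1 : ℂ) ^ 2))

/-- The Weierstrass zeta function `ζ = σ' / σ`. -/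
def zeta (L : PeriodPair) (z : ℂ) : ℂ := deriv (sigma L) z / sigma L z

/-- `Φ_i(x, α) = σ(x + ω_i - α) / σ(x + ω_i) · exp(ζ(α) x)`. -/
def Phi (L : PeriodPair) (i : Fin 4) (α x : ℂ) : ℂ :=
  sigma L (x + halfPeriod L i - α) / sigma L (x + halfPeriod L i) * exp (zeta L α * x)

/-- The cubic `4 b³ - g_2 b - g_3`. -/
def cubic (L : PeriodPair) (b : ℂ) : ℂ := 4 * b ^ 3 - gTwo L * b - gThree L

/-- The condition on `p` that the singular points `x = ± δ_1`, `℘(δ_1) = b`, are apparent. -/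
def Apparency (L : PeriodPair) (l : Fin 4 → ℕ) (b μ p : ℂ) : Prop :=
  p = cubic L b * (-μ ^ 2 +
        (((l 1 : ℂ) + 1 / 2) / (b - e L 1) + ((l 2 : ℂ) + 1 / 2) / (b - e L 2)
          + ((l 3 : ℂ) + 1 / 2) / (b - e L 3)) * μ)
      - b * ((l 1 : ℂ) + l 2 + l 3 - l 0) * ((l 1 : ℂ) + l 2 + l 3 + l 0 + 1)

/-- `s̃_1`, solved from
`μ_1 = -s̃_1 / (4 b_1³ - g_2 b_1 - g_3) + ∑_{i=1}^3 l_i / (2 (b_1 - e_i))`. -/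
def sTilde (L : PeriodPair) (l : Fin 4 → ℕ) (b μ : ℂ) : ℂ :=
  cubic L b * (-μ + ((l 1 : ℂ) / (2 * (b - e L 1)) + (l 2 : ℂ) / (2 * (b - e L 2))
    + (l 3 : ℂ) / (2 * (b - e L 3))))

/-- `s_1 = s̃_1 + (12 b_1² - g_2) / 8`. -/
def sOne (L : PeriodPair) (l : Fin 4 → ℕ) (b μ : ℂ) : ℂ :=
  sTilde L l b μ + (12 * b ^ 2 - gTwo L) / 8

/-- `Ẽ`, solved from
`p = Ẽ - 2 (l_1 l_2 e_3 + l_2 l_3 e_1 + l_3 l_1 e_2) + ∑_{i=1}^3 l_i (l_i e_i + 2 (e_i + b_1))`. -/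
def ETilde (L : PeriodPair) (l : Fin 4 → ℕ) (b p : ℂ) : ℂ :=
  p + 2 * ((l 1 : ℂ) * l 2 * e L 3 + (l 2 : ℂ) * l 3 * e L 1 + (l 3 : ℂ) * l 1 * e L 2)
    - ((l 1 : ℂ) * (l 1 * e L 1 + 2 * (e L 1 + b)) + (l 2 : ℂ) * (l 2 * e L 2 + 2 * (e L 2 + b))
      + (l 3 : ℂ) * (l 3 * e L 3 + 2 * (e L 3 + b)))

/-- The eigenvalue `E = Ẽ - C_g` of `H`, where `C_g = - b_1 / 2 + 2 b_1`. -/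
def energy (L : PeriodPair) (l : Fin 4 → ℕ) (b p : ℂ) : ℂ :=
  ETilde L l b p - (-(1 / 2) * b + 2 * b)

/-- The potential `v` of `H = -d²/dx² + v(x)`, for one apparent singularity with `r_1 = 1`. -/
def potential (L : PeriodPair) (l : Fin 4 → ℕ) (δ μ x : ℂ) : ℂ :=
  (∑ i : Fin 4, (l i : ℂ) * ((l i : ℂ) + 1) * L.weierstrassP (x + halfPeriod L i))
    + (1 / 2 : ℂ) * (1 / 2 + 1) * (L.weierstrassP (x - δ) + L.weierstrassP (x + δ))
    + sOne L l (L.weierstrassP δ) μ / (L.weierstrassP x - L.weierstrassP δ)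

/-- `x` is an ordinary point of `(H - E) f = 0`: it lies neither on `ℤ ω_1 + ℤ ω_3` nor over
`± δ_1`. -/
def IsOrdinary (L : PeriodPair) (δ x : ℂ) : Prop :=
  2 * x ∉ L.lattice ∧ L.weierstrassP x ≠ L.weierstrassP δ

/-- `Ξ(x) = c_0 + d_0 / (℘(x) - ℘(δ_1)) + ∑_{i=0}^3 ∑_{j=0}^{l_i - 1} b^{(i)}_j ℘(x + ω_i)^{l_i - j}`,
where `β i j` stands for `b^{(i)}_j`. -/
def Xi (L : PeriodPair) (l : Fin 4 → ℕ) (δ c₀ d₀ : ℂ) (β : Fin 4 → ℕ → ℂ) (x : ℂ) : ℂ :=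
  c₀ + d₀ / (L.weierstrassP x - L.weierstrassP δ)
    + ∑ i : Fin 4, ∑ j ∈ Finset.range (l i),
        β i j * L.weierstrassP (x + halfPeriod L i) ^ (l i - j)

/-- `Ξ` is a nonzero solution of `Ξ''' - 4 (v - E) Ξ' - 2 v' Ξ = 0`. -/
def IsProductSolution (L : PeriodPair) (l : Fin 4 → ℕ) (δ μ p : ℂ) (Ξ : ℂ → ℂ) : Prop :=
  (∃ x, IsOrdinary L δ x ∧ Ξ x ≠ 0) ∧
  ∀ x, IsOrdinary L δ x →
    iteratedDeriv 3 Ξ x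
      - 4 * (potential L l δ μ x - energy L l (L.weierstrassP δ) p) * deriv Ξ x
      - 2 * deriv (potential L l δ μ) x * Ξ x = 0

/-- `Ξ² (E - v) + Ξ Ξ'' / 2 - (Ξ')² / 4` at the point `x`. -/
def QAt (L : PeriodPair) (l : Fin 4 → ℕ) (δ μ p : ℂ) (Ξ : ℂ → ℂ) (x : ℂ) : ℂ :=
  Ξ x ^ 2 * (energy L l (L.weierstrassP δ) p - potential L l δ μ x)
    + 1 / 2 * Ξ x * iteratedDeriv 2 Ξ x - 1 / 4 * deriv Ξ x ^ 2

/-- `F` is the function `Λ_g = Ψ_g √Ξ exp ∫ q dx / Ξ` with `Ψ_g² = ℘ - ℘(δ_1)`: near every ordinary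
point where `Ξ` does not vanish, `F = s exp h` with a local branch `s` of `Ψ_g √Ξ` and a local
primitive `h` of `q / Ξ`. -/
def IsLambdaG (L : PeriodPair) (δ : ℂ) (Ξ : ℂ → ℂ) (q : ℂ) (F : ℂ → ℂ) : Prop :=
  ∀ x, IsOrdinary L δ x → Ξ x ≠ 0 →
    ∃ s h : ℂ → ℂ, AnalyticAt ℂ s x ∧ AnalyticAt ℂ h x ∧
      ∀ᶠ y in nhds x, s y ^ 2 = Ξ y * (L.weierstrassP y - L.weierstrassP δ) ∧
        deriv h y = q / Ξ y ∧ F y = s y * exp (h y)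

/-- `l̃_0 = l_0 + 1` and `l̃_i = l_i` for `i = 1, 2, 3`. -/
def lTilde (l : Fin 4 → ℕ) (i : Fin 4) : ℕ := if i = 0 then l 0 + 1 else l i

/-- The Hermite–Krichever Ansatz
`F(x) = exp(κ x) ∑_{i=0}^3 ∑_{j=0}^{l̃_i - 1} b̃^{(i)}_j (d/dx)^j Φ_i(x, α)`, off `ℤ ω_1 + ℤ ω_3`,
with `α` not a period. -/
def IsHermiteKrichever (L : PeriodPair) (l : Fin 4 → ℕ) (α κ : ℂ) (F : ℂ → ℂ) : Prop :=
  α ∉ L.lattice ∧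
  ∃ β : Fin 4 → ℕ → ℂ, ∀ x, 2 * x ∉ L.lattice →
    F x = exp (κ * x) * ∑ i : Fin 4, ∑ j ∈ Finset.range (lTilde l i),
      β i j * iteratedDeriv j (Phi L i α) x

/-- `N / D` is a fraction of polynomials in two variables, in lowest terms. -/
def IsReducedFraction (N D : MvPolynomial (Fin 2) ℂ) : Prop := D ≠ 0 ∧ IsRelPrime N D

/-- The value of a polynomial in the two variables at `(b, μ)`. -/
def evalAt (P : MvPolynomial (Fin 2) ℂ) (b μ : ℂ) : ℂ := MvPolynomial.eval ![b, μ] P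

end

end HKAnsatz

/-!
With `z = ℘(x)` the function `Ξ` becomes `U / M`, where `U` is a polynomial and
`M = (z - b) ∏ (z - e_i) ^ l_i`; the equation for `Ξ` becomes a linear equation for `U` (`Params.symOp`), and `Q`
becomes the constant in a quadratic first integral (`Params.quad`). Both make sense over any
commutative ring of coefficients, so `b` and `μ` may be taken as indeterminates.

**The universal solution.** Over a field, the equation with an apparent singularity has a
polynomial solution of the expected degree (`Regular.exists_solution`). The form
`(F, G) ↦ res (F * symOp G)`, a sum of residues, is alternating; local solutions at the singular points lie in its
radical, and the polynomials of small degree form an isotropic space which is too large to avoid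
the radical. The solution is unique up to a factor (`Regular.proportional`), because the gaps
between the exponents force two solutions to have vanishing Wronskian. Over the field of rational
functions in `b` and `μ` the leading coefficients in `μ` show that neither `Q` nor `U(b)` vanishes
(`generic_solution`).

**The point `α`.** Where `Q` is nonzero, the zeros of `U`, with signs of `℘'` prescribed by the
first integral, form a divisor on the elliptic curve, and the point `α` is its sum, up to a half
period that depends on the parities of the `l_i`. Instead of adding points, one finds by linear
algebra a function with this divisor up to one more point; its norm is `U` times a linear factor
`ν₁ z + ν₀`, and its logarithmic derivative is that of `Λ_g` up to another linear polynomial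
`x₁ z + x₀` divided by `ν₁ z + ν₀` (`exists_line_data`). Clearing denominators one obtains polynomials
`ν₁, ν₀, x₁, x₀` in `b` and `μ` (`universal_line_data`), and the fractions in question are, up to
the factor that normalises `d₀`, the quotients `-ν₀ / ν₁` for `℘(α)`, `2 (x₀ ν₁ - x₁ ν₀) / ν₁ ^ 2`
for `℘'(α) / √(-Q)` and `x₁ / ν₁` for `κ / √(-Q)`.

**Specialisation.** At a given point `(b, μ)` the universal data may degenerate, and `Q` may
vanish. But along a line through the point they can be divided by suitable powers of the line
parameter, and by uniqueness the limit of `U` is the given solution. The identities of the line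
data persist in the limit, in a form that does not divide by `Q`, and so do the values of the
fractions in lowest terms (`exists_line_data_at`).

**Comparison of multipliers.** At the given point, `Λ_g` times a function
`exp (t x) σ(x + γ) / σ(x)` and times an elliptic square root has the same logarithmic derivative as the elliptic
function of the line data, by the addition theorem of `ζ`. So the product is elliptic
(`multiplier_eq_one`), while the Hermite–Krichever form gives the multipliers of `Λ_g` in terms of
`α` and `κ`. Since `exp (s x) σ(x + β) / σ(x)` is elliptic only in the trivial case
(`mem_lattice_of_periodic`), this yields `α = γ` modulo periods, and `κ`
(`parameters_of_line_data`).
-/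

set_option linter.unusedSimpArgs false
set_option linter.unusedSectionVars false

namespace HKAnsatz
open Polynomial

/-! ### The product equation in algebraic form -/

/-- The data of the product equation after the substitution `z = ℘(x)`: the values `e i` of `℘` at
the half-periods, the apparent singularity `b`, the accessory parameter `μ`, and the exponents
`l i` at the half-periods and `l₀` at the lattice points. The ring is arbitrary, so that `b` and `μ`
may be indeterminates as well as numbers; the indices of `e` and `l` are read modulo 3. -/
structure Params (A : Type*) where
  e : Fin 3 → A
  b : A
  μ : A
  l : Fin 3 → ℕ
  l₀ : ℕ

namespace Params

section Ring

variable {A : Type*} [CommRing A] (d : Params A)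

lemma sum_cyc {N : Type*} [AddCommMonoid N] (f : Fin 3 → N) (i : Fin 3) :
    ∑ j, f j = f i + f (i + 1) + f (i + 2) := by
  rw [Fin.sum_univ_three]
  fin_cases i
  · rfl
  · change f 0 + f 1 + f 2 = f 1 + f 2 + f 0; abel
  · change f 0 + f 1 + f 2 = f 2 + f 0 + f 1; abel

lemma prod_cyc {N : Type*} [CommMonoid N] (f : Fin 3 → N) (i : Fin 3) :
    ∏ j, f j = f i * f (i + 1) * f (i + 2) := by
  rw [Fin.prod_univ_three]
  fin_cases i
  · rfl
  · change f 0 * f 1 * f 2 = f 1 * f 2 * f 0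
    rw [mul_comm (f 1 * f 2), mul_assoc]
  · change f 0 * f 1 * f 2 = f 2 * f 0 * f 1
    rw [mul_comm (f 0 * f 1), mul_assoc]

noncomputable section

/-- `∏ (z - e_i)`, a quarter of the Weierstrass cubic. -/
def chat : A[X] := ∏ i, (X - C (d.e i))

/-- The product of `z - p` over the finite singular points `p` of the equation. -/
def base : A[X] := (X - C d.b) * d.chat

/-- The poles of a solution at the `e_i`, which have order at most `l_i`. -/
def gauge : A[X] := ∏ i, (X - C (d.e i)) ^ d.l i

/-- The denominator of the solutions: they are sought in the form `F / den` with `F` a polynomial.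
-/
def den : A[X] := (X - C d.b) * d.gauge

/-- `base` times the logarithmic derivative of `den`. -/
def logDen : A[X] :=
  d.chat + (X - C d.b) * ∑ i, (d.l i : A[X]) * ((X - C (d.e (i + 1))) * (X - C (d.e (i + 2))))

/-- The coefficient `s̃₁` of the potential, with the denominators `b - e_i` cleared. -/
def sTl : A := -4 * (∏ i, (d.b - d.e i)) * d.μ
  + ∑ i, 2 * (d.l i : A) * ((d.b - d.e (i + 1)) * (d.b - d.e (i + 2)))

/-- The residue of `v - E` at `z = b`: the coefficient `s₁` together with the residue of
`3/4 (℘(x - δ) + ℘(x + δ))`. -/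
def wRes : A := 2 * ∑ i, ((d.b - d.e (i + 1)) * (d.b - d.e (i + 2))) + d.sTl

/-- The value which the apparency condition prescribes for the accessory parameter `p`. -/
def pApp : A := -4 * (∏ i, (d.b - d.e i)) * d.μ ^ 2
  + (∑ i, (4 * (d.l i : A) + 2) * ((d.b - d.e (i + 1)) * (d.b - d.e (i + 2)))) * d.μ
  - d.b * (∑ i, (d.l i : A) - d.l₀) * (∑ i, (d.l i : A) + d.l₀ + 1)

/-- The energy `E` up to the multiple of `b` that `wConst` accounts for, expressed by `μ` through
the apparency condition. -/
def eTl : A := d.pApp + 2 * ∑ i, (d.l (i + 1) : A) * d.l (i + 2) * d.e i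
  - ∑ i, (d.l i : A) * (d.l i * d.e i + 2 * (d.e i + d.b))

/-- The constant term of `v - E` in its partial fraction expansion in `z`. -/
def wConst : A := ∑ i, (d.l i : A) * (d.l i + 1) * d.e i + 3 * d.b - d.eTl

/-- The residue of `℘(x + ω_i)`, as a function of `z`, at `z = e_i`. -/
def resH (i : Fin 3) : A := (d.e i - d.e (i + 1)) * (d.e i - d.e (i + 2))

/-- The potential `v - E` as a function of `z`, multiplied by `base ^ 2`. -/
def pot : A[X] :=
  (X - C d.b) ^ 2 * d.chat ^ 2 * (C ((d.l₀ : A) * (d.l₀ + 1)) * X + C d.wConst)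
  + (X - C d.b) ^ 2 * d.chat * (∑ i, C ((d.l i : A) * (d.l i + 1) * d.resH i) *
      ((X - C (d.e (i + 1))) * (X - C (d.e (i + 2)))))
  + d.chat ^ 2 * (C (3 * ∏ i, (d.b - d.e i)) + C d.wRes * (X - C d.b))

/-- Differentiation of `F / (den * base ^ j)`: the derivative is `theta j F / (den * base ^ (j +
1))`. -/
def theta (j : ℕ) : A[X] →ₗ[A] A[X] where
  toFun F := d.base * derivative F - (d.logDen + j * derivative d.base) * F
  map_add' F G := by simp only [derivative_add]; ring
  map_smul' r F := by
    simp only [smul_eq_C_mul, derivative_mul, derivative_C, RingHom.id_apply]; ring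

lemma theta_apply (j : ℕ) (F : A[X]) :
    d.theta j F = d.base * derivative F - (d.logDen + j * derivative d.base) * F := rfl

/-- The product equation: its left side at `F / den`, divided by `℘'` and multiplied by
`den * base ^ 3`. So `F / den` is a solution if and only if `symOp F = 0`. -/
def symOp : A[X] →ₗ[A] A[X] where
  toFun F := 4 * d.chat * d.theta 2 (d.theta 1 (d.theta 0 F))
    + 6 * derivative d.chat * d.base * d.theta 1 (d.theta 0 F)
    + 2 * derivative (derivative d.chat) * d.base ^ 2 * d.theta 0 F
    - 4 * d.pot * d.theta 0 F
    - 2 * (d.base * derivative d.pot - 2 * derivative d.base * d.pot) * F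
  map_add' F G := by simp only [map_add]; ring
  map_smul' r F := by
    simp only [map_smul, RingHom.id_apply]; simp only [smul_eq_C_mul]; ring

lemma symOp_apply (F : A[X]) : d.symOp F = 4 * d.chat * d.theta 2 (d.theta 1 (d.theta 0 F))
    + 6 * derivative d.chat * d.base * d.theta 1 (d.theta 0 F)
    + 2 * derivative (derivative d.chat) * d.base ^ 2 * d.theta 0 F
    - 4 * d.pot * d.theta 0 F
    - 2 * (d.base * derivative d.pot - 2 * derivative d.base * d.pot) * F := rfl

/-- The first integral `Ξ² (E - v) + Ξ Ξ'' / 2 - Ξ'² / 4` at `Ξ = F / den`, multiplied by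
`den ^ 2 * base ^ 2`. -/
def quad (F : A[X]) : A[X] := -d.pot * F ^ 2 + 2 * d.chat * F * d.theta 1 (d.theta 0 F)
  + derivative d.chat * d.base * F * d.theta 0 F - d.chat * d.theta 0 F ^ 2

/-- Twice the polarisation of `quad`. -/
def bracket (F G : A[X]) : A[X] :=
  4 * d.chat * (F * d.theta 1 (d.theta 0 G) - d.theta 0 F * d.theta 0 G
    + G * d.theta 1 (d.theta 0 F))
  + 2 * derivative d.chat * d.base * (F * d.theta 0 G + G * d.theta 0 F)
  - 4 * d.pot * F * G

/-- The operator is skew: the symmetric part of `F * symOp G` is an exact derivative. -/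
lemma mul_symOp_add (F G : A[X]) : F * d.symOp G + G * d.symOp F =
    d.base * derivative (d.bracket F G)
      - 2 * (d.logDen + derivative d.base) * d.bracket F G := by
  simp only [symOp_apply, bracket, theta_apply, derivative_mul, derivative_sub, derivative_add,
    Nat.cast_zero, Nat.cast_one, Nat.cast_ofNat, derivative_ofNat, derivative_zero,
    derivative_one]
  ring

/-- The first integral of a solution is constant. -/
lemma quad_derivative (F : A[X]) : 2 * (d.base * derivative (d.quad F)
      - 2 * (d.logDen + derivative d.base) * d.quad F) = F * d.symOp F := by
  simp only [symOp_apply, quad, theta_apply, pow_two, derivative_mul, derivative_sub,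
    derivative_add, Nat.cast_zero, Nat.cast_one, Nat.cast_ofNat, derivative_ofNat,
    derivative_zero, derivative_one, derivative_neg]
  ring

lemma derivative_gauge : d.chat * derivative d.gauge =
    (∑ i, (d.l i : A[X]) * ((X - C (d.e (i + 1))) * (X - C (d.e (i + 2))))) * d.gauge := by
  have key : ∀ i, (X - C (d.e i)) * derivative ((X - C (d.e i)) ^ d.l i)
      = (d.l i : A[X]) * (X - C (d.e i)) ^ d.l i := by
    intro i
    cases h : d.l i with
    | zero => simp
    | succ n => rw [derivative_X_sub_C_pow]; simp [pow_succ]; ring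
  have h0 := key 0
  have h1 := key 1
  have h2 := key 2
  simp only [gauge, chat, Fin.prod_univ_three, Fin.sum_univ_three, derivative_mul,
    show (0 : Fin 3) + 1 = 1 from rfl, show (0 : Fin 3) + 2 = 2 from rfl,
    show (1 : Fin 3) + 1 = 2 from rfl, show (1 : Fin 3) + 2 = 0 from rfl,
    show (2 : Fin 3) + 1 = 0 from rfl, show (2 : Fin 3) + 2 = 1 from rfl]
  linear_combination
    (X - C (d.e 1)) * (X - C (d.e 2)) * (X - C (d.e 1)) ^ d.l 1 * (X - C (d.e 2)) ^ d.l 2 * h0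
    + (X - C (d.e 0)) * (X - C (d.e 2)) * (X - C (d.e 0)) ^ d.l 0 * (X - C (d.e 2)) ^ d.l 2 * h1
    + (X - C (d.e 0)) * (X - C (d.e 1)) * (X - C (d.e 0)) ^ d.l 0 * (X - C (d.e 1)) ^ d.l 1 * h2

lemma base_mul_derivative_den : d.base * derivative d.den = d.logDen * d.den := by
  have := d.derivative_gauge
  simp only [den, base, logDen, derivative_mul, derivative_X_sub_C]
  linear_combination (X - C d.b) ^ 2 * this

/-! ### Behaviour at `e_i` -/

/-- The cofactor of `z - e_i` in `chat`. -/
def chatAt (i : Fin 3) : A[X] := (X - C (d.e (i + 1))) * (X - C (d.e (i + 2)))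

lemma chat_eq (i : Fin 3) : d.chat = (X - C (d.e i)) * d.chatAt i := by
  rw [chat, prod_cyc _ i, chatAt, mul_assoc]

lemma logDen_eq (i : Fin 3) : ∃ g, d.logDen =
    (X - C d.b) * d.chatAt i * (d.l i : A[X]) + (X - C (d.e i)) * g := by
  refine ⟨d.chatAt i + (X - C d.b) * ((d.l (i + 1) : A[X]) * (X - C (d.e (i + 2)))
    + (d.l (i + 2) : A[X]) * (X - C (d.e (i + 1)))), ?_⟩
  rw [logDen, d.chat_eq i, sum_cyc _ i]
  have e1 : i + 1 + 1 = i + 2 := by fin_cases i <;> rfl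
  have e2 : i + 1 + 2 = i := by fin_cases i <;> rfl
  have e3 : i + 2 + 1 = i := by fin_cases i <;> rfl
  have e4 : i + 2 + 2 = i + 1 := by fin_cases i <;> rfl
  rw [e1, e2, e3, e4, chatAt]
  ring

lemma pot_eq (i : Fin 3) : ∃ W, d.pot = (X - C (d.e i)) * W ∧
    W.eval (d.e i) = (d.l i : A) * (d.l i + 1) * (d.chatAt i).eval (d.e i) *
      ((d.e i - d.b) * (d.chatAt i).eval (d.e i)) ^ 2 := by
  refine ⟨(X - C (d.e i)) * (X - C d.b) ^ 2 * d.chatAt i ^ 2 *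
      (C ((d.l₀ : A) * (d.l₀ + 1)) * X + C d.wConst)
    + (X - C d.b) ^ 2 * d.chatAt i * (∑ i, C ((d.l i : A) * (d.l i + 1) * d.resH i) *
      ((X - C (d.e (i + 1))) * (X - C (d.e (i + 2)))))
    + (X - C (d.e i)) * d.chatAt i ^ 2 *
      (C (3 * ∏ i, (d.b - d.e i)) + C d.wRes * (X - C d.b)), ?_, ?_⟩
  · rw [pot, d.chat_eq i]; ring
  · rw [sum_cyc _ i]
    have e2 : i + 1 + 2 = i := by fin_cases i <;> rfl
    have e3 : i + 2 + 1 = i := by fin_cases i <;> rfl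
    rw [e2, e3, chatAt]
    simp [resH]
    ring

end

end Ring
end Params
end HKAnsatz

namespace HKAnsatz
open Polynomial
namespace Params

section Ring

variable {A : Type*} [CommRing A] (d : Params A)

noncomputable section

/-- `theta` after the substitution `F = (z - p)^a g`, where `base = (z - p) B₁`. -/
def thetaLoc (B₁ : A[X]) (a j : ℕ) (g : A[X]) : A[X] :=
  d.base * derivative g + ((a : A[X]) * B₁ - d.logDen - j * derivative d.base) * g

lemma mul_derivative_X_sub_C_pow (p : A) (a : ℕ) :
    (X - C p) * derivative ((X - C p) ^ a) = (a : A[X]) * (X - C p) ^ a := by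
  cases a with
  | zero => simp
  | succ n => rw [derivative_X_sub_C_pow]; simp [pow_succ]; ring

lemma theta_pow_mul {p : A} {B₁ : A[X]} (hB : d.base = (X - C p) * B₁) (a j : ℕ) (g : A[X]) :
    d.theta j ((X - C p) ^ a * g) = (X - C p) ^ a * d.thetaLoc B₁ a j g := by
  have h := mul_derivative_X_sub_C_pow p a
  rw [theta_apply, thetaLoc, derivative_mul]
  have : d.base * derivative ((X - C p) ^ a) = (a : A[X]) * B₁ * (X - C p) ^ a := by
    rw [hB]; linear_combination B₁ * h
  linear_combination g * this

lemma thetaLoc_eval {p : A} {B₁ : A[X]} (hB : d.base = (X - C p) * B₁) (a j : ℕ) (g : A[X]) :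
    (d.thetaLoc B₁ a j g).eval p =
      ((a - j : A) * B₁.eval p - d.logDen.eval p) * g.eval p := by
  have h1 : d.base.eval p = 0 := by rw [hB]; simp
  have h2 : (derivative d.base).eval p = B₁.eval p := by rw [hB, derivative_mul]; simp
  simp only [thetaLoc, eval_add, eval_mul, eval_sub, eval_natCast, h1, h2]
  ring

lemma base_eq (i : Fin 3) : d.base = (X - C (d.e i)) * ((X - C d.b) * d.chatAt i) := by
  rw [base, d.chat_eq i]; ring

/-- The exponents of the product equation at `e_i` are `0`, `l_i + 1/2` and `2 l_i + 1`, relative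
to the denominator. -/
lemma symOp_pow_mul (i : Fin 3) (a : ℕ) (g : A[X]) :
    ∃ K, d.symOp ((X - C (d.e i)) ^ a * g) = (X - C (d.e i)) ^ (a + 1) * K ∧
      K.eval (d.e i) = 2 * (d.e i - d.b) ^ 3 * (d.chatAt i).eval (d.e i) ^ 4 *
        (2 * (a - d.l i) - 1) * (a : A) * (a - d.l i - d.l i - 1) * g.eval (d.e i) := by
  obtain ⟨W, hW, hW'⟩ := d.pot_eq i
  obtain ⟨n, hn⟩ := d.logDen_eq i
  have hB := d.base_eq i
  have hc := d.chat_eq i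
  set p := d.e i
  set B₁ := (X - C d.b) * d.chatAt i with hB₁
  set g1 := d.thetaLoc B₁ a 0 g with hg1
  set g2 := d.thetaLoc B₁ a 1 g1 with hg2
  set g3 := d.thetaLoc B₁ a 2 g2 with hg3
  refine ⟨4 * d.chatAt i * g3 + 6 * derivative d.chat * B₁ * g2
    + 2 * derivative (derivative d.chat) * (X - C p) * B₁ ^ 2 * g1 - 4 * W * g1
    - 2 * (B₁ * derivative d.pot - 2 * derivative d.base * W) * g, ?_, ?_⟩
  · -- one factor `z - e_i` is left over: it comes from `chat` or from `pot` in every term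
    rw [symOp_apply, theta_pow_mul d hB, theta_pow_mul d hB, theta_pow_mul d hB, ← hg1, ← hg2,
      ← hg3, pow_succ]
    nth_rewrite 1 [hc]
    nth_rewrite 1 [hW]
    nth_rewrite 2 [hW]
    simp only [hB]
    ring
  · have e1 : (derivative d.chat).eval p = (d.chatAt i).eval p := by
      rw [hc, derivative_mul]; simp
    have e2 : (derivative d.base).eval p = B₁.eval p := by rw [hB, derivative_mul]; simp
    have e3 : (derivative d.pot).eval p = W.eval p := by rw [hW, derivative_mul]; simp
    have e4 : d.logDen.eval p = B₁.eval p * d.l i := by rw [hn, hB₁]; simp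
    have e5 : B₁.eval p = (p - d.b) * (d.chatAt i).eval p := by rw [hB₁]; simp
    simp only [eval_add, eval_sub, eval_mul, eval_pow, eval_ofNat, eval_X, eval_C, e1, e2, e3,
      hg3, hg2, hg1, thetaLoc_eval d hB, e4, e5, hW']
    push_cast
    ring

lemma quad_pow_mul (i : Fin 3) (a : ℕ) (g : A[X]) :
    ∃ K, d.quad ((X - C (d.e i)) ^ a * g) = (X - C (d.e i)) ^ (2 * a + 1) * K ∧
      K.eval (d.e i) = (d.e i - d.b) ^ 2 * (d.chatAt i).eval (d.e i) ^ 3 *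
        (a : A) * (a - d.l i - d.l i - 1) * g.eval (d.e i) ^ 2 := by
  obtain ⟨W, hW, hW'⟩ := d.pot_eq i
  obtain ⟨n, hn⟩ := d.logDen_eq i
  have hB := d.base_eq i
  have hc := d.chat_eq i
  set p := d.e i
  set B₁ := (X - C d.b) * d.chatAt i with hB₁
  set g1 := d.thetaLoc B₁ a 0 g with hg1
  set g2 := d.thetaLoc B₁ a 1 g1 with hg2
  refine ⟨-W * g ^ 2 + 2 * d.chatAt i * g * g2 + derivative d.chat * B₁ * g * g1
    - d.chatAt i * g1 ^ 2, ?_, ?_⟩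
  · rw [quad, theta_pow_mul d hB, theta_pow_mul d hB, ← hg1, ← hg2, hW, hB]
    have hp : (X - C p) ^ (2 * a + 1) = ((X - C p) ^ a) ^ 2 * (X - C p) := by ring
    rw [hp]
    nth_rewrite 1 3 [hc]
    ring
  · have e1 : (derivative d.chat).eval p = (d.chatAt i).eval p := by
      rw [hc, derivative_mul]; simp
    have e4 : d.logDen.eval p = B₁.eval p * d.l i := by rw [hn, hB₁]; simp
    have e5 : B₁.eval p = (p - d.b) * (d.chatAt i).eval p := by rw [hB₁]; simp
    simp only [eval_add, eval_sub, eval_mul, eval_pow, eval_ofNat, eval_neg, e1,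
      hg2, hg1, thetaLoc_eval d hB, e4, e5, hW']
    push_cast
    ring

/-! ### Behaviour at the apparent singularity -/

lemma prod_sub_e_eq : ∏ i, (d.b - d.e i) = d.chat.eval d.b := by
  simp [chat, eval_prod]

lemma pot_eval_b : d.pot.eval d.b = 3 * d.chat.eval d.b ^ 3 := by
  simp [pot, prod_sub_e_eq]; ring

/-- The exponents of the product equation at `b` are `0`, `2` and `4`, relative to the denominator.
-/
lemma symOp_pow_mul_b (a : ℕ) (g : A[X]) :
    ∃ K, d.symOp ((X - C d.b) ^ a * g) = (X - C d.b) ^ a * K ∧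
      K.eval d.b = 4 * d.chat.eval d.b ^ 4 * (a : A) * (a - 2) * (a - 4) * g.eval d.b := by
  have hB : d.base = (X - C d.b) * d.chat := rfl
  set p := d.b
  set g1 := d.thetaLoc d.chat a 0 g with hg1
  set g2 := d.thetaLoc d.chat a 1 g1 with hg2
  set g3 := d.thetaLoc d.chat a 2 g2 with hg3
  refine ⟨4 * d.chat * g3 + 6 * derivative d.chat * d.base * g2
    + 2 * derivative (derivative d.chat) * d.base ^ 2 * g1 - 4 * d.pot * g1
    - 2 * (d.base * derivative d.pot - 2 * derivative d.base * d.pot) * g, ?_, ?_⟩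
  · rw [symOp_apply, theta_pow_mul d hB, theta_pow_mul d hB, theta_pow_mul d hB, ← hg1, ← hg2,
      ← hg3]
    ring
  · have e1 : d.base.eval p = 0 := by rw [hB]; simp
    have e2 : (derivative d.base).eval p = d.chat.eval p := by rw [hB, derivative_mul]; simp
    have e4 : d.logDen.eval p = d.chat.eval p := by rw [logDen]; simp [p]
    simp only [eval_add, eval_sub, eval_mul, eval_pow, eval_ofNat, e1, e2,
      hg3, hg2, hg1, thetaLoc_eval d hB, e4, p, pot_eval_b]
    push_cast
    ring

/-! ### Behaviour at infinity -/

/-- `F` has degree at most `n`, and `x` is its coefficient in degree `n`. -/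
def Leads (F : A[X]) (n : ℕ) (x : A) : Prop := F.natDegree ≤ n ∧ F.coeff n = x

lemma Leads.mul {F G : A[X]} {m n : ℕ} {x y : A} (hF : Leads F m x) (hG : Leads G n y) :
    Leads (F * G) (m + n) (x * y) :=
  ⟨natDegree_mul_le_of_le hF.1 hG.1, by
    rw [coeff_mul_add_eq_of_natDegree_le hF.1 hG.1, hF.2, hG.2]⟩

lemma Leads.add {F G : A[X]} {n : ℕ} {x y : A} (hF : Leads F n x) (hG : Leads G n y) :
    Leads (F + G) n (x + y) :=
  ⟨natDegree_add_le_of_degree_le hF.1 hG.1, by rw [coeff_add, hF.2, hG.2]⟩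

lemma Leads.sub {F G : A[X]} {n : ℕ} {x y : A} (hF : Leads F n x) (hG : Leads G n y) :
    Leads (F - G) n (x - y) :=
  ⟨natDegree_sub_le_of_le hF.1 hG.1 |>.trans (by simp), by rw [coeff_sub, hF.2, hG.2]⟩

lemma Leads.pow {F : A[X]} {n : ℕ} {x : A} (hF : Leads F n x) (k : ℕ) :
    Leads (F ^ k) (k * n) (x ^ k) :=
  ⟨natDegree_pow_le_of_le k hF.1, by rw [coeff_pow_of_natDegree_le hF.1, hF.2]⟩

lemma Leads.of_lt {F : A[X]} {n : ℕ} (h : F.natDegree < n) : Leads F n 0 :=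
  ⟨h.le, coeff_eq_zero_of_natDegree_lt h⟩

lemma Leads.derivative {F : A[X]} {n : ℕ} {x : A} (hF : Leads F (n + 1) x) :
    Leads (derivative F) n (x * (n + 1)) :=
  ⟨(natDegree_derivative_le F).trans (by have := hF.1; omega), by rw [coeff_derivative, hF.2]⟩

lemma Leads.C (x : A) : Leads (C x) 0 x := ⟨by simp, by simp⟩

lemma Leads.X_sub (p : A) : Leads (X - Polynomial.C p) 1 1 :=
  ⟨by simpa using natDegree_sub_le_of_le natDegree_X_le (natDegree_C p).le, by
    simp⟩

lemma Leads.congr {F : A[X]} {n m : ℕ} {x y : A} (hF : Leads F n x) (h : n = m) (h' : x = y) :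
    Leads F m y := h ▸ h' ▸ hF

lemma Leads.natCast_mul {F : A[X]} {n : ℕ} {x : A} (hF : Leads F n x) (k : ℕ) :
    Leads ((k : A[X]) * F) n (k * x) := by
  have := (Leads.C (k : A)).mul hF
  simpa using this

lemma Leads.ofNat_mul {F : A[X]} {n : ℕ} {x : A} (hF : Leads F n x) (k : ℕ) [k.AtLeastTwo] :
    Leads ((OfNat.ofNat k : A[X]) * F) n (OfNat.ofNat k * x) := by
  have := hF.natCast_mul (OfNat.ofNat k)
  simpa only [Nat.cast_ofNat] using this

lemma leads_chat : Leads d.chat 3 1 := by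
  rw [chat, Fin.prod_univ_three]
  exact (((Leads.X_sub _).mul (Leads.X_sub _)).mul (Leads.X_sub _)).congr rfl (by ring)

lemma leads_base : Leads d.base 4 1 :=
  ((Leads.X_sub _).mul d.leads_chat).congr rfl (by ring)

/-- The degree of `den`. -/
def degDen : ℕ := d.l 0 + d.l 1 + d.l 2 + 1

lemma leads_logDen : Leads d.logDen 3 d.degDen := by
  have h : ∀ i, Leads ((X - C (d.e (i + 1))) * (X - C (d.e (i + 2)))) 2 1 := fun i =>
    ((Leads.X_sub _).mul (Leads.X_sub _)).congr rfl (by ring)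
  rw [logDen, Fin.sum_univ_three]
  refine (d.leads_chat.add ((Leads.X_sub _).mul ((((h 0).natCast_mul (d.l 0)).add
    ((h 1).natCast_mul (d.l 1))).add ((h 2).natCast_mul (d.l 2))))).congr rfl ?_
  simp [degDen]; ring

lemma leads_pot : Leads d.pot 9 ((d.l₀ : A) * (d.l₀ + 1)) := by
  have h : ∀ i, Leads ((X - C (d.e (i + 1))) * (X - C (d.e (i + 2)))) 2 1 := fun i =>
    ((Leads.X_sub _).mul (Leads.X_sub _)).congr rfl (by ring)
  have hq : ∀ x : A, Leads ((X - C d.b) ^ 2 * d.chat ^ 2 * (C x * X + C d.wConst)) 9 x := by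
    intro x
    refine ((((Leads.X_sub _).pow 2).mul (d.leads_chat.pow 2)).mul (n := 1) (y := x)
      ⟨?_, by simp⟩).congr rfl (by ring)
    exact natDegree_linear_le
  have h2 : Leads ((X - C d.b) ^ 2 * d.chat * (∑ i, C ((d.l i : A) * (d.l i + 1) * d.resH i) *
      ((X - C (d.e (i + 1))) * (X - C (d.e (i + 2)))))) 9 0 := by
    apply Leads.of_lt
    rw [Fin.sum_univ_three]
    have := ((((Leads.X_sub d.b).pow 2).mul (d.leads_chat)).mul
      ((((Leads.C ((d.l 0 : A) * (d.l 0 + 1) * d.resH 0)).mul (h 0)).add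
      ((Leads.C ((d.l 1 : A) * (d.l 1 + 1) * d.resH 1)).mul (h 1))).add
      ((Leads.C ((d.l 2 : A) * (d.l 2 + 1) * d.resH 2)).mul (h 2)))).1
    omega
  have h3 : Leads (d.chat ^ 2 * (C (3 * ∏ i, (d.b - d.e i)) + C d.wRes * (X - C d.b))) 9 0 := by
    apply Leads.of_lt
    have := ((d.leads_chat).pow 2).mul ((Leads.of_lt (n := 1)
      (F := C (3 * ∏ i, (d.b - d.e i))) (by rw [natDegree_C]; omega)).add
        ((Leads.C d.wRes).mul (Leads.X_sub d.b)))
    have := this.1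
    omega
  rw [pot]
  exact (((hq _).add h2).add h3).congr rfl (by ring)

lemma leads_theta {F : A[X]} {n : ℕ} {x : A} (hF : Leads F n x) (j : ℕ) :
    Leads (d.theta j F) (n + 3) ((n - d.degDen - 4 * j) * x) := by
  rw [theta_apply]
  have h1 : Leads (d.base * derivative F) (n + 3) (n * x) := by
    cases n with
    | zero =>
      have : derivative F = 0 := by
        rw [natDegree_eq_zero.mp (Nat.le_zero.mp hF.1) |>.choose_spec.symm]; simp
      rw [this, mul_zero]; exact ⟨by simp, by simp⟩
    | succ n => exact (d.leads_base.mul hF.derivative).congr (by ring) (by push_cast; ring)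
  have h2 := (d.leads_logDen.add ((d.leads_base.derivative).natCast_mul j)).mul hF
  exact (h1.sub (h2.congr (by ring) rfl)).congr rfl (by push_cast; ring)

/-- Relative to the denominator, a solution grows at infinity like `z ^ s` with `s` one of `l₀`,
`-1/2` and `-l₀ - 1`. -/
lemma leads_symOp {F : A[X]} {n : ℕ} {x : A} (hF : Leads F n x) :
    Leads (d.symOp F) (n + 12) (2 * (2 * (n - d.degDen) + 1) * (n - d.degDen - d.l₀) *
      (n - d.degDen + d.l₀ + 1) * x) := by
  have t0 := d.leads_theta hF 0
  have t1 := d.leads_theta t0 1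
  have t2 := d.leads_theta t1 2
  have c1 := d.leads_chat.derivative
  have c2 := c1.derivative
  have hp := d.leads_pot
  have hb := d.leads_base
  rw [symOp_apply]
  have k1 := ((d.leads_chat.ofNat_mul 4).mul t2).congr (m := n + 12) (by ring) rfl
  have k2 := (((c1.ofNat_mul 6).mul hb).mul t1).congr (m := n + 12) (by ring) rfl
  have k3 := (((c2.ofNat_mul 2).mul (hb.pow 2)).mul t0).congr (m := n + 12) (by ring) rfl
  have k4 := ((hp.ofNat_mul 4).mul t0).congr (m := n + 12) (by ring) rfl
  have k5 := ((((hb.mul hp.derivative).sub ((hb.derivative.ofNat_mul 2).mul hp)).ofNat_mul 2).mul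
    hF).congr (m := n + 12) (by ring) rfl
  refine ((((k1.add k2).add k3).sub k4).sub k5).congr rfl ?_
  push_cast
  ring

lemma leads_quad {F : A[X]} {n : ℕ} {x : A} (hF : Leads F n x) :
    Leads (d.quad F) (2 * n + 9) ((n - d.degDen - d.l₀) * (n - d.degDen + d.l₀ + 1) * x ^ 2) := by
  have t0 := d.leads_theta hF 0
  have t1 := d.leads_theta t0 1
  have c1 := d.leads_chat.derivative
  have hp := d.leads_pot
  have hb := d.leads_base
  have hq : d.quad F = 2 * d.chat * F * d.theta 1 (d.theta 0 F)
    + derivative d.chat * d.base * F * d.theta 0 F - d.chat * d.theta 0 F ^ 2 - d.pot * F ^ 2 := by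
    rw [quad]; ring
  rw [hq]
  have k1 := (((d.leads_chat.ofNat_mul 2).mul hF).mul t1).congr (m := 2 * n + 9) (by ring) rfl
  have k2 := (((c1.mul hb).mul hF).mul t0).congr (m := 2 * n + 9) (by ring) rfl
  have k3 := (d.leads_chat.mul (t0.pow 2)).congr (m := 2 * n + 9) (by ring) rfl
  have k4 := (hp.mul (hF.pow 2)).congr (m := 2 * n + 9) (by ring) rfl
  refine (((k1.add k2).sub k3).sub k4).congr rfl ?_
  push_cast
  ring

end

end Ring
end Params
end HKAnsatz

namespace HKAnsatz
open Polynomial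
namespace Params

section Ring

variable {A : Type*} [CommRing A] (d : Params A)

noncomputable section

/-! ### Absence of logarithms -/

/-- The value at `b` of the part of `chat * (v - E)` that is regular there. -/
def regAt : A := d.chat.eval d.b * (d.l₀ * (d.l₀ + 1) * d.b + d.wConst)
  + ∑ i, ((d.l i : A) * (d.l i + 1) * d.resH i) * ((d.b - d.e (i + 1)) * (d.b - d.e (i + 2)))

/-- The choice of `E` makes `z = b` an apparent singularity: this is the condition that the
local solutions there have no logarithm. -/
lemma apparency_identity (he : ∑ i, d.e i = 0) :
    2 * d.chat.eval d.b * (derivative (derivative d.chat)).eval d.b - 4 * d.regAt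
      - 2 * (derivative d.chat).eval d.b * d.wRes + d.wRes ^ 2 = 0 := by
  have h2 : d.e 2 = -d.e 0 - d.e 1 := by
    rw [Fin.sum_univ_three] at he; linear_combination he
  simp only [regAt, wRes, wConst, eTl, pApp, sTl, resH, chat, Fin.prod_univ_three,
    Fin.sum_univ_three,
    show (0 : Fin 3) + 1 = 1 from rfl, show (0 : Fin 3) + 2 = 2 from rfl,
    show (1 : Fin 3) + 1 = 2 from rfl, show (1 : Fin 3) + 2 = 0 from rfl,
    show (2 : Fin 3) + 1 = 0 from rfl, show (2 : Fin 3) + 2 = 1 from rfl, h2,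
    derivative_mul, derivative_X_sub_C, derivative_add, derivative_one, eval_mul, eval_add,
    eval_sub, eval_X, eval_C, eval_one, eval_zero, one_mul, mul_one, zero_mul, mul_zero,
    map_sub, map_neg, derivative_sub, derivative_X, derivative_neg, derivative_C, eval_neg,
    derivative_zero]
  ring

/-- Because the singularity is apparent, the first two Taylor coefficients of `symOp G` at `b` obey
a linear relation that does not depend on `G`. Hence one condition less is needed to
make `symOp G` vanish to third order. -/
lemma symOp_jet (he : ∑ i, d.e i = 0) (G : A[X]) :
    3 * d.chat.eval d.b * (derivative (derivative (d.symOp G))).eval d.b =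
      (d.wRes + 6 * (∑ i, (d.l i : A) * ((d.b - d.e (i + 1)) * (d.b - d.e (i + 2))))
        + 18 * (derivative d.chat).eval d.b) * (derivative (d.symOp G)).eval d.b := by
  have app := d.apparency_identity he
  set n : A[X] := ∑ i, (d.l i : A[X]) * ((X - C (d.e (i + 1))) * (X - C (d.e (i + 2)))) with hn
  have hn0 : ∑ i, (d.l i : A) * ((d.b - d.e (i + 1)) * (d.b - d.e (i + 2))) = n.eval d.b := by
    simp [hn, eval_finsetSum]
  set R : A[X] := d.chat * (C ((d.l₀ : A) * (d.l₀ + 1)) * X + C d.wConst)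
    + (∑ i, C ((d.l i : A) * (d.l i + 1) * d.resH i) *
      ((X - C (d.e (i + 1))) * (X - C (d.e (i + 2))))) with hR
  have hR0 : R.eval d.b = d.regAt := by simp [hR, regAt, eval_finsetSum]
  have hpot : d.pot = (X - C d.b) * ((X - C d.b) * (d.chat * R)) + d.chat * (d.chat *
      (C (3 * d.chat.eval d.b) + C d.wRes * (X - C d.b))) := by
    rw [pot, hR, prod_sub_e_eq]; ring
  have hlog : d.logDen = d.chat + (X - C d.b) * n := rfl
  have hbase : d.base = (X - C d.b) * d.chat := rfl
  rw [hn0]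
  rw [← hR0] at app
  set c0 := d.chat.eval d.b
  set c1 := (derivative d.chat).eval d.b with hc1
  set c2 := (derivative (derivative d.chat)).eval d.b with hc2
  set c3 := (derivative (derivative (derivative d.chat))).eval d.b with hc3
  set n0 := n.eval d.b
  set n1 := (derivative n).eval d.b with hn1
  have b0 : d.base.eval d.b = 0 := by simp [hbase]
  have b1 : (derivative d.base).eval d.b = c0 := by simp [hbase, c0]
  have b2 : (derivative (derivative d.base)).eval d.b = 2 * c1 := by
    simp [hbase, ← hc1]; ring
  have b3 : (derivative (derivative (derivative d.base))).eval d.b = 3 * c2 := by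
    simp [hbase, ← hc2]; ring
  have g0 : d.logDen.eval d.b = c0 := by simp [hlog, c0]
  have g1 : (derivative d.logDen).eval d.b = c1 + n0 := by simp [hlog, ← hc1, n0]
  have g2 : (derivative (derivative d.logDen)).eval d.b = c2 + 2 * n1 := by
    simp [hlog, ← hc2, ← hn1]; ring
  have w0 : d.pot.eval d.b = 3 * c0 ^ 3 := by simp [hpot, c0]; ring
  have w1 : (derivative d.pot).eval d.b = 6 * c0 ^ 2 * c1 + c0 ^ 2 * d.wRes := by
    simp [hpot, ← hc1, c0]; ring
  have w2 : (derivative (derivative d.pot)).eval d.b = 2 * c0 * R.eval d.b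
      + 6 * c0 * (c1 ^ 2 + c0 * c2) + 4 * c0 * c1 * d.wRes := by
    simp [hpot, ← hc1, ← hc2, c0]; ring
  have w3 : ∃ x, (derivative (derivative (derivative d.pot))).eval d.b = x := ⟨_, rfl⟩
  obtain ⟨w3', w3⟩ := w3
  have t0 : ∀ j F, (d.theta j F).eval d.b = -(1 + j) * c0 * F.eval d.b := by
    intro j F
    simp only [theta_apply, eval_add, eval_sub, eval_mul, b0, b1, g0, eval_natCast]; ring
  have t1 : ∀ j F, (derivative (d.theta j F)).eval d.b =
      -j * c0 * (derivative F).eval d.b - (c1 + n0 + 2 * j * c1) * F.eval d.b := by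
    intro j F
    simp only [theta_apply, derivative_sub, derivative_add, derivative_mul, derivative_natCast,
      eval_add, eval_sub, eval_mul, b0, b1, b2, g0, g1, eval_natCast, zero_mul, eval_zero]; ring
  have t2 : ∀ j F, (derivative (derivative (d.theta j F))).eval d.b =
      (1 - j) * c0 * (derivative (derivative F)).eval d.b
      + (2 * c1 - 2 * (c1 + n0 + 2 * j * c1)) * (derivative F).eval d.b
      - (c2 + 2 * n1 + 3 * j * c2) * F.eval d.b := by
    intro j F
    simp only [theta_apply, derivative_sub, derivative_add, derivative_mul, derivative_natCast,
      derivative_zero, eval_add, eval_sub, eval_mul, b0, b1, b2, b3, g0, g1, g2, eval_natCast,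
      zero_mul, eval_zero]; ring
  have s1 : (derivative (d.symOp G)).eval d.b = c0 ^ 3 *
      (12 * c0 * (derivative G).eval d.b + (6 * d.wRes - 12 * c1 - 12 * n0) * G.eval d.b) := by
    simp only [symOp_apply, pow_two, derivative_sub, derivative_add, derivative_mul,
      derivative_ofNat, derivative_zero, eval_add, eval_sub, eval_mul, eval_ofNat,
      zero_mul, eval_zero, b0, b1, b2, w0, w1, t0, t1, w2]
    simp only [← hc1, ← hc2]
    push_cast
    ring
  rw [s1]
  simp only [symOp_apply, pow_two, derivative_sub, derivative_add, derivative_mul,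
    derivative_ofNat, derivative_zero, eval_add, eval_sub, eval_mul, eval_ofNat,
    zero_mul, eval_zero, b0, b1, b2, b3, w0, w1, t0, t1, t2, w2, w3]
  simp only [← hc1, ← hc2, ← hc3]
  push_cast
  linear_combination (-6 * c0 ^ 3 * G.eval d.b) * app

end

end Ring
end Params
end HKAnsatz

namespace HKAnsatz
open Polynomial

/-! ### Radicals of alternating forms -/

section LinAlg
variable {k : Type*} [Field k] [CharZero k]

/-- An alternating form on a space of odd dimension is degenerate. -/
lemma exists_radical_of_odd {V : Type*} [AddCommGroup V] [Module k V] [FiniteDimensional k V]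
    (B : V →ₗ[k] V →ₗ[k] k) (hB : ∀ v w, B v w = -B w v) (hodd : Odd (Module.finrank k V)) :
    ∃ v ≠ 0, ∀ w, B w v = 0 := by
  classical
  let bs := Module.finBasis k V
  let M := LinearMap.toMatrix₂ bs bs B
  have hM : M.transpose = -M := by
    ext i j
    simp only [M, Matrix.transpose_apply, LinearMap.toMatrix₂_apply, Matrix.neg_apply]
    exact hB _ _
  have hdet : M.det = 0 := by
    have h1 := congrArg Matrix.det hM
    rw [Matrix.det_transpose, Matrix.det_neg, Fintype.card_fin, hodd.neg_one_pow] at h1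
    have : 2 * M.det = 0 := by linear_combination h1
    simpa using this
  have hsep : ¬ B.SeparatingLeft := fun h =>
    (LinearMap.separatingLeft_iff_det_ne_zero bs).mp h hdet
  simp only [LinearMap.SeparatingLeft, not_forall] at hsep
  obtain ⟨v, hv, hne⟩ := hsep
  exact ⟨v, hne, fun w => by rw [hB, hv, neg_zero]⟩

/-- The radical of an alternating form on a space of even dimension is not a line. -/
lemma exists_radical_notMem_span {V : Type*} [AddCommGroup V] [Module k V]
    [FiniteDimensional k V] (B : V →ₗ[k] V →ₗ[k] k) (hB : ∀ v w, B v w = -B w v)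
    (heven : Even (Module.finrank k V)) {v : V} (hv : v ≠ 0) (hr : ∀ w, B w v = 0) :
    ∃ u, u ∉ Submodule.span k {v} ∧ ∀ w, B w u = 0 := by
  obtain ⟨P, hP⟩ := Submodule.exists_isCompl (Submodule.span k {v})
  have h1 := Submodule.finrank_add_eq_of_isCompl hP
  rw [finrank_span_singleton hv] at h1
  obtain ⟨u, hu, hu'⟩ := exists_radical_of_odd (B.domRestrict₁₂ P P) (fun x y => hB x y)
    (by rw [← h1] at heven; exact (Nat.even_add'.mp heven).mp odd_one)
  refine ⟨u, fun hmem => hu ?_, fun w => ?_⟩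
  · exact Subtype.ext ((Submodule.disjoint_def.mp hP.disjoint) _ hmem u.2)
  · have : w ∈ Submodule.span k {v} ⊔ P := by rw [hP.sup_eq_top]; trivial
    obtain ⟨a, ha, b, hb, rfl⟩ := Submodule.mem_sup.mp this
    obtain ⟨c, rfl⟩ := Submodule.mem_span_singleton.mp ha
    have := hu' ⟨b, hb⟩
    simp only [LinearMap.domRestrict₁₂_apply] at this
    rw [map_add, LinearMap.add_apply, this, map_smul, LinearMap.smul_apply, hB v, hr]
    simp

/-- An isotropic subspace and a subspace of the radical meet if their dimensions are large. -/
lemma exists_mem_radical {V : Type*} [AddCommGroup V] [Module k V]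
    [FiniteDimensional k V] (B : V →ₗ[k] V →ₗ[k] k) (hB : ∀ v w, B v w = -B w v)
    (W R : Submodule k V) (hW : ∀ v ∈ W, ∀ w ∈ W, B v w = 0) (hR : ∀ v ∈ R, ∀ w, B w v = 0)
    (hdim : Module.finrank k V < 2 * Module.finrank k W + Module.finrank k R) :
    ∃ v ∈ W, v ≠ 0 ∧ ∀ w, B w v = 0 := by
  by_contra! hcon
  -- Otherwise `W` embeds into the dual of `V`, and the annihilator of its image contains `W + R`,
  -- a direct sum; this is too large.
  have hdis : Disjoint W R := by
    rw [Submodule.disjoint_def]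
    intro v hv hv'
    by_contra hne
    obtain ⟨w, hw⟩ := hcon v hv hne
    exact hw (hR v hv' w)
  let S : W →ₗ[k] (V →ₗ[k] k) := B.flip.domRestrict W
  have hS : Function.Injective S := by
    rw [← LinearMap.ker_eq_bot, LinearMap.ker_eq_bot']
    intro v hv
    by_contra hne
    obtain ⟨w, hw⟩ := hcon v v.2 (by simpa using hne)
    exact hw (by simpa [S] using LinearMap.congr_fun hv w)
  let A := (LinearMap.range S).dualCoannihilator
  have h1 : Module.finrank k (LinearMap.range S) + Module.finrank k A = Module.finrank k V :=
    Subspace.finrank_add_finrank_dualCoannihilator_eq _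
  have h2 : W ⊔ R ≤ A := by
    refine sup_le ?_ ?_
    · intro v hv
      rw [Submodule.mem_dualCoannihilator]
      rintro _ ⟨w, rfl⟩
      simpa [S] using hW v hv w w.2
    · intro v hv
      rw [Submodule.mem_dualCoannihilator]
      rintro _ ⟨w, rfl⟩
      have := hR v hv w
      rw [hB] at this
      simpa [S] using this
  have h3 := Submodule.finrank_mono h2
  have h4 := Submodule.finrank_sup_add_finrank_inf_eq W R
  rw [hdis.eq_bot, finrank_bot] at h4
  rw [LinearMap.finrank_range_of_inj hS] at h1
  omega

end LinAlg

namespace Params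

variable {k : Type*} [Field k] [CharZero k] (d : Params k)

/-! ### Regular parameters -/

/-- The singular points `e_i`, `b` are distinct, and the `e_i` have centre of mass `0`. -/
structure Regular : Prop where
  inj : ∀ i j, d.e i = d.e j → i = j
  ne : ∀ i, d.b ≠ d.e i
  sum : ∑ i, d.e i = 0

variable {d}

lemma Regular.chat_b (h : d.Regular) : d.chat.eval d.b ≠ 0 := by
  rw [← prod_sub_e_eq]
  exact Finset.prod_ne_zero_iff.mpr fun i _ => sub_ne_zero.mpr (h.ne i)

lemma Regular.chatAt_e (h : d.Regular) (i : Fin 3) : (d.chatAt i).eval (d.e i) ≠ 0 := by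
  have h1 : d.e i ≠ d.e (i + 1) := fun h' => by
    have := h.inj _ _ h'
    revert this
    fin_cases i <;> decide
  have h2 : d.e i ≠ d.e (i + 2) := fun h' => by
    have := h.inj _ _ h'
    revert this
    fin_cases i <;> decide
  simp [chatAt, sub_ne_zero, h1, h2]

variable (d)

/-- The exponent `0` at `e_i`. -/
lemma sq_dvd_symOp (i : Fin 3) (G : k[X]) : (X - C (d.e i)) ^ 2 ∣ d.symOp G := by
  obtain ⟨K, hK, h0⟩ := d.symOp_pow_mul i 0 G
  have : (X - C (d.e i)) ∣ K := dvd_iff_isRoot.mpr (by rw [IsRoot, h0]; simp)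
  obtain ⟨K', rfl⟩ := this
  rw [pow_zero, one_mul] at hK
  exact ⟨K', by rw [hK]; ring⟩

/-- The exponent `2 l_i + 1` at `e_i`. -/
lemma pow_dvd_symOp (i : Fin 3) (G : k[X]) :
    (X - C (d.e i)) ^ (2 * d.l i + 3) ∣ d.symOp ((X - C (d.e i)) ^ (2 * d.l i + 1) * G) := by
  obtain ⟨K, hK, h0⟩ := d.symOp_pow_mul i (2 * d.l i + 1) G
  have : (X - C (d.e i)) ∣ K := dvd_iff_isRoot.mpr (by rw [IsRoot, h0]; push_cast; ring)
  obtain ⟨K', rfl⟩ := this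
  exact ⟨K', by rw [hK]; ring⟩

/-- The exponent `0` at `b`. -/
lemma dvd_symOp_b (G : k[X]) : (X - C d.b) ∣ d.symOp G := by
  obtain ⟨K, hK, h0⟩ := d.symOp_pow_mul_b 0 G
  rw [pow_zero, one_mul, one_mul] at hK
  exact dvd_iff_isRoot.mpr (by rw [IsRoot, hK, h0]; simp)

/-- The exponent `4` at `b`. -/
lemma pow_dvd_symOp_b (G : k[X]) : (X - C d.b) ^ 5 ∣ d.symOp ((X - C d.b) ^ 4 * G) := by
  obtain ⟨K, hK, h0⟩ := d.symOp_pow_mul_b 4 G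
  have : (X - C d.b) ∣ K := dvd_iff_isRoot.mpr (by rw [IsRoot, h0]; push_cast; ring)
  obtain ⟨K', rfl⟩ := this
  exact ⟨K', by rw [hK]; ring⟩

variable {d}

/-- Vanishing to second order at the apparent singularity implies vanishing to third order, by
`symOp_jet`. -/
lemma Regular.cube_dvd_symOp (h : d.Regular) {G : k[X]} (hG : (X - C d.b) ^ 2 ∣ d.symOp G) :
    (X - C d.b) ^ 3 ∣ d.symOp G := by
  obtain ⟨K, hK⟩ := hG
  have jet := d.symOp_jet h.sum G
  have h1 : (derivative (d.symOp G)).eval d.b = 0 := by rw [hK]; simp [pow_two]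
  have h2 : (derivative (derivative (d.symOp G))).eval d.b = 2 * K.eval d.b := by
    rw [hK]
    simp only [pow_two, derivative_mul, derivative_add, derivative_X_sub_C, eval_add, eval_mul,
      eval_sub, eval_X, eval_C, one_mul, mul_one, sub_self, zero_mul, mul_zero, derivative_one,
      eval_one, zero_add, add_zero]
    ring
  rw [h1, h2, mul_zero] at jet
  have : (X - C d.b) ∣ K := dvd_iff_isRoot.mpr (by
    have := h.chat_b
    simpa [this] using jet)
  obtain ⟨K', rfl⟩ := this
  exact ⟨K', by rw [hK]; ring⟩

end Params
end HKAnsatz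

namespace HKAnsatz
open Polynomial
namespace Params

/-! ### The residue pairing -/

section Ring
variable {A : Type*} [CommRing A] (d : Params A)

lemma monic_base : d.base.Monic := by
  rw [base, chat]
  exact (monic_X_sub_C _).mul (monic_prod_of_monic _ _ fun _ _ => monic_X_sub_C _)

lemma monic_den : d.den.Monic := by
  rw [den, gauge]
  exact (monic_X_sub_C _).mul (monic_prod_of_monic _ _ fun _ _ => (monic_X_sub_C _).pow _)

noncomputable section

/-- The common denominator `M² base²`. -/
def zden : A[X] := d.den ^ 2 * d.base ^ 2

lemma monic_zden : d.zden.Monic := (d.monic_den.pow 2).mul (d.monic_base.pow 2)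

lemma base_mul_derivative_zden :
    d.base * derivative d.zden = 2 * (d.logDen + derivative d.base) * d.zden := by
  have := d.base_mul_derivative_den
  rw [zden]
  simp only [pow_two, derivative_mul]
  linear_combination 2 * d.den * d.base ^ 2 * this

end
end Ring

variable {k : Type*} [Field k] [CharZero k] (d : Params k)

lemma natDegree_base : d.base.natDegree = 4 := by
  apply natDegree_eq_of_le_of_coeff_ne_zero d.leads_base.1
  rw [d.leads_base.2]; exact one_ne_zero

lemma natDegree_den : d.den.natDegree = d.degDen := by
  rw [den, gauge, (monic_X_sub_C _).natDegree_mul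
    (monic_prod_of_monic _ _ fun _ _ => (monic_X_sub_C _).pow _),
    natDegree_prod_of_monic _ _ fun _ _ => (monic_X_sub_C _).pow _]
  simp [Fin.sum_univ_three, degDen]; ring

noncomputable section

/-- The modulus of the residue pairing. -/
def modulus : k[X] := d.zden * d.base

lemma monic_modulus : d.modulus.Monic := d.monic_zden.mul d.monic_base

lemma natDegree_zden : d.zden.natDegree = 2 * d.degDen + 8 := by
  rw [zden, (d.monic_den.pow 2).natDegree_mul (d.monic_base.pow 2), d.monic_den.natDegree_pow,
    d.monic_base.natDegree_pow, natDegree_base, natDegree_den]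

lemma natDegree_modulus : d.modulus.natDegree = 2 * d.degDen + 12 := by
  rw [modulus, d.monic_zden.natDegree_mul d.monic_base, natDegree_base, natDegree_zden]

/-- The sum of the residues of `G / modulus` at the finite poles. -/
def res : k[X] →ₗ[k] k := lcoeff k (2 * d.degDen + 11) ∘ₗ modByMonicHom d.modulus

lemma res_apply (G : k[X]) : d.res G = (G %ₘ d.modulus).coeff (2 * d.degDen + 11) := rfl

lemma res_of_dvd {G : k[X]} (h : d.modulus ∣ G) : d.res G = 0 := by
  rw [res_apply, (modByMonic_eq_zero_iff_dvd d.monic_modulus).mpr h, coeff_zero]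

lemma res_of_natDegree_lt {G : k[X]} (h : G.natDegree < 2 * d.degDen + 12) :
    d.res G = G.coeff (2 * d.degDen + 11) := by
  rw [res_apply, (modByMonic_eq_self_iff d.monic_modulus).mpr]
  apply degree_lt_degree
  rwa [natDegree_modulus]

/-- The residues of a derivative vanish. -/
lemma res_exact (H : k[X]) :
    d.res (d.base * derivative H - 2 * (d.logDen + derivative d.base) * H) = 0 := by
  -- After splitting off a multiple of `zden`, whose contribution is divisible by the modulus, the
  -- remainder is of low degree: its image has no coefficient in the degree which `res` reads.
  have hz := d.base_mul_derivative_zden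
  set q := H /ₘ d.zden with hq
  set r := H %ₘ d.zden with hr
  have hH : H = r + d.zden * q := (modByMonic_add_div H _).symm
  have hrd : r.natDegree < 2 * d.degDen + 8 := by
    have := natDegree_modByMonic_lt H d.monic_zden (by
      intro h
      have := congrArg natDegree h
      rw [natDegree_zden, natDegree_one] at this
      omega)
    rwa [natDegree_zden] at this
  have : d.base * derivative H - 2 * (d.logDen + derivative d.base) * H =
      (d.base * derivative r - 2 * (d.logDen + derivative d.base) * r)
        + d.modulus * derivative q := by
    rw [hH, modulus, derivative_add, derivative_mul]
    linear_combination q * hz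
  rw [this, map_add, res_of_dvd _ (dvd_mul_right _ _), add_zero]
  have hr0 : Leads r (2 * d.degDen + 7) (r.coeff (2 * d.degDen + 7)) := ⟨by omega, rfl⟩
  have h1 : Leads (derivative r) (2 * d.degDen + 6)
    (r.coeff (2 * d.degDen + 7) * ((2 * d.degDen + 6 : ℕ) + 1)) := Leads.derivative hr0
  have h2 := (d.leads_base.mul h1).sub ((((d.leads_logDen.add
    d.leads_base.derivative).ofNat_mul 2).mul hr0).congr
    (m := 4 + (2 * d.degDen + 6)) (by ring) rfl)
  have h3 : (d.base * derivative r - 2 * (d.logDen + derivative d.base) * r).natDegree ≤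
      4 + (2 * d.degDen + 6) := h2.1
  rw [res_of_natDegree_lt _ (by omega), coeff_eq_zero_of_natDegree_lt (by omega)]

/-- The residue pairing `(F, G) ↦ res (F * symOp G)`. -/
def pairing : k[X] →ₗ[k] k[X] →ₗ[k] k :=
  ((LinearMap.mul k k[X]).compl₂ d.symOp).compr₂ d.res

lemma pairing_apply (F G : k[X]) : d.pairing F G = d.res (F * d.symOp G) := rfl

/-- By `mul_symOp_add` the symmetric part of the pairing is the residue of a derivative. -/
lemma pairing_skew (F G : k[X]) : d.pairing F G = -d.pairing G F := by
  have := d.res_exact (d.bracket F G)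
  rw [← mul_symOp_add, map_add] at this
  rw [pairing_apply, pairing_apply]
  linear_combination this

lemma pairing_self (F : k[X]) : d.pairing F F = 0 := by
  have := d.pairing_skew F F
  have : 2 * d.pairing F F = 0 := by linear_combination this
  simpa using this

lemma pairing_eq_zero_of_dvd {F G : k[X]} (h : d.modulus ∣ d.symOp G) : d.pairing F G = 0 :=
  d.res_of_dvd (dvd_mul_of_dvd_right h F)

lemma pairing_eq_zero_of_natDegree {F G : k[X]}
    (h : F.natDegree + (d.symOp G).natDegree < 2 * d.degDen + 11) : d.pairing F G = 0 := by
  have : (F * d.symOp G).natDegree < 2 * d.degDen + 11 := natDegree_mul_le.trans_lt h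
  rw [pairing_apply, res_of_natDegree_lt _ (by omega), coeff_eq_zero_of_natDegree_lt this]

/-- The pairing detects `symOp G` as long as the latter has small degree. -/
lemma symOp_eq_zero_of_pairing {G : k[X]} (h : (d.symOp G).natDegree < 2 * d.degDen + 12)
    (h' : ∀ j < 2 * d.degDen + 12, d.pairing (X ^ j) G = 0) : d.symOp G = 0 := by
  by_contra hne
  set m := (d.symOp G).natDegree with hm
  have h1 := h' (2 * d.degDen + 11 - m) (by omega)
  have h2 : (X ^ (2 * d.degDen + 11 - m) * d.symOp G).natDegree = 2 * d.degDen + 11 := by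
    rw [natDegree_X_pow_mul _ hne]; omega
  rw [pairing_apply, res_of_natDegree_lt _ (by omega)] at h1
  apply hne
  rw [← leadingCoeff_eq_zero, leadingCoeff, ← hm, ← h1,
    show 2 * d.degDen + 11 = m + (2 * d.degDen + 11 - m) by omega]
  simp

/-- If the pairing annihilates a full system of remainders, it annihilates everything. -/
lemma pairing_eq_zero_of_block {P D : k[X]} (hP : P.Monic) {m : ℕ} (hm : P.natDegree = m)
    (hcop : IsCoprime D P)
    (hdvd : ∀ T, d.modulus ∣ D * d.symOp (P * T)) {h : k[X]}
    (hh : ∀ h' ∈ degreeLT k m, d.pairing (D * h') (D * h) = 0) (F : k[X]) :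
    d.pairing F (D * h) = 0 := by
  have key : ∀ T G, d.pairing (P * T) (D * G) = 0 := by
    intro T G
    rw [pairing_skew, pairing_apply, res_of_dvd, neg_zero]
    rw [mul_right_comm]
    exact dvd_mul_of_dvd_left (hdvd T) _
  obtain ⟨u, v, huv⟩ := hcop
  have hdeg : (F * u) %ₘ P ∈ degreeLT k m := by
    rw [mem_degreeLT, ← hm, ← degree_eq_natDegree hP.ne_zero]
    exact degree_modByMonic_lt _ hP
  have hF : F = D * ((F * u) %ₘ P) + P * (D * ((F * u) /ₘ P) + v * F) := by
    have := modByMonic_add_div (F * u) P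
    linear_combination (-F) * huv - D * this
  rw [hF, map_add, LinearMap.add_apply, hh _ hdeg, key, add_zero]

/-! ### Local solutions at the finite singular points -/

/-- The finite singular points: `b`, then the `e_i`. -/
def pt : Fin 4 → k := Fin.cons d.b d.e

/-- The largest exponent of the symmetric square at a singular point, after multiplication by
`den`. -/
def mult : Fin 4 → ℕ := Fin.cons 4 fun i => 2 * d.l i + 1

/-- The order of vanishing that `symOp` gains at a singular point. -/
def gap : Fin 4 → ℕ := ![1, 2, 2, 2]

lemma modulus_eq : d.modulus = ∏ j, (X - C (d.pt j)) ^ (d.mult j + gap j) := by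
  simp only [modulus, zden, den, gauge, base, chat, Fin.prod_univ_three, Fin.prod_univ_succ,
    Finset.univ_eq_empty, Finset.prod_empty, pt, mult, gap, Fin.cons_zero, Fin.cons_succ]
  simp
  ring

/-- The remainders modulo `expo j` are the jets at the singular point `j` on which the pairing
depends. -/
def expo (j : Fin 4) : k[X] := (X - C (d.pt j)) ^ d.mult j

/-- The product of the `expo i` at the other singular points; a multiple of it does not interact
with those points. -/
def coexpo (j : Fin 4) : k[X] := ∏ i ∈ Finset.univ.erase j, d.expo i

lemma monic_expo (j : Fin 4) : (d.expo j).Monic := (monic_X_sub_C _).pow _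

lemma natDegree_expo (j : Fin 4) : (d.expo j).natDegree = d.mult j := by
  rw [expo, (monic_X_sub_C _).natDegree_pow, natDegree_X_sub_C, mul_one]

lemma gap_dvd (j : Fin 4) (G : k[X]) : (X - C (d.pt j)) ^ gap j ∣ d.symOp G := by
  refine Fin.cases ?_ (fun i => ?_) j
  · simpa [pt, gap] using d.dvd_symOp_b G
  · have := d.sq_dvd_symOp i G
    have h : gap i.succ = 2 := by fin_cases i <;> rfl
    simpa [pt, h] using this

lemma expo_dvd (j : Fin 4) (G : k[X]) :
    (X - C (d.pt j)) ^ (d.mult j + gap j) ∣ d.symOp (d.expo j * G) := by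
  refine Fin.cases ?_ (fun i => ?_) j
  · simpa [pt, gap, mult, expo] using d.pow_dvd_symOp_b G
  · have := d.pow_dvd_symOp i G
    have h : gap i.succ = 2 := by fin_cases i <;> rfl
    simpa [pt, h, mult, expo] using this

variable {d}

lemma Regular.pt_injective (h : d.Regular) : Function.Injective d.pt := by
  rw [pt, Fin.cons_injective_iff]
  exact ⟨by rintro ⟨i, hi⟩; exact h.ne i hi.symm, fun i j => h.inj i j⟩

lemma Regular.modulus_dvd (h : d.Regular) {G : k[X]}
    (hG : ∀ j, (X - C (d.pt j)) ^ (d.mult j + gap j) ∣ G) : d.modulus ∣ G := by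
  rw [modulus_eq]
  refine Finset.prod_dvd_of_coprime (fun i _ j _ hij => ?_) fun j _ => hG j
  exact (pairwise_coprime_X_sub_C h.pt_injective hij).pow

lemma Regular.isCoprime_coexpo (h : d.Regular) (j : Fin 4) :
    IsCoprime (d.coexpo j) (d.expo j) := by
  refine IsCoprime.prod_left fun i hi => ?_
  exact (pairwise_coprime_X_sub_C h.pt_injective (Finset.ne_of_mem_erase hi)).pow

lemma Regular.modulus_dvd_coexpo_mul (h : d.Regular) (j : Fin 4) (T : k[X]) :
    d.modulus ∣ d.coexpo j * d.symOp (d.expo j * T) := by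
  refine h.modulus_dvd fun i => ?_
  by_cases hij : i = j
  · subst hij; exact dvd_mul_of_dvd_right (d.expo_dvd i T) _
  · rw [pow_add]
    exact mul_dvd_mul (Finset.dvd_prod_of_mem _ (by simpa using hij)) (d.gap_dvd _ _)

variable (d)

/-- The pairing on the remainders modulo `expo j`. -/
def blockForm (j : Fin 4) : degreeLT k (d.mult j) →ₗ[k] degreeLT k (d.mult j) →ₗ[k] k :=
  (d.pairing.compl₁₂ (LinearMap.mulLeft k (d.coexpo j))
    (LinearMap.mulLeft k (d.coexpo j))).domRestrict₁₂ _ _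

lemma blockForm_apply (j : Fin 4) (g h : degreeLT k (d.mult j)) :
    d.blockForm j g h = d.pairing (d.coexpo j * g) (d.coexpo j * h) := rfl

lemma blockForm_skew (j : Fin 4) (g h : degreeLT k (d.mult j)) :
    d.blockForm j g h = -d.blockForm j h g := d.pairing_skew _ _

lemma finrank_degreeLT (n : ℕ) : Module.finrank k (degreeLT k n) = n := by
  rw [(degreeLTEquiv k n).finrank_eq, Module.finrank_fin_fun]

variable {d}

/-- Local solutions at `b`: a nonzero remainder modulo `(z - b) ^ 4` in the radical. -/
lemma Regular.exists_block_b (hd : d.Regular) :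
    ∃ h : degreeLT k (d.mult 0), h ≠ 0 ∧ ∀ F, d.blockForm 0 F h = 0 := by
  -- Vanishing to fifth order is needed. Of the five Taylor coefficients, those of order `0` and `2`
  -- vanish by themselves, and the other three are linear conditions on a space of dimension `4`.
  let φ : degreeLT k (d.mult 0) →ₗ[k] (Fin 3 → k) := LinearMap.pi fun i =>
    (lcoeff k (![1, 3, 4] i) ∘ₗ (taylor d.b : k[X] →ₗ[k] k[X]) ∘ₗ d.symOp ∘ₗ
      LinearMap.mulLeft k (d.coexpo 0)) ∘ₗ (degreeLT k (d.mult 0)).subtype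
  have hker : LinearMap.ker φ ≠ ⊥ := by
    apply LinearMap.ker_ne_bot_of_finrank_lt
    rw [finrank_degreeLT, Module.finrank_fin_fun]
    exact (by decide : 3 < 4)
  obtain ⟨h, hh, hne⟩ := Submodule.exists_mem_ne_zero_of_ne_bot hker
  refine ⟨h, hne, fun F => ?_⟩
  have hφ : ∀ i, (taylor d.b (d.symOp (d.coexpo 0 * h))).coeff (![1, 3, 4] i) = 0 := fun i =>
    congrFun (LinearMap.mem_ker.mp hh) i
  have c1 := hφ 0
  have c3 := hφ 1
  have c4 := hφ 2
  simp only [Matrix.cons_val] at c1 c3 c4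
  set G := d.symOp (d.coexpo 0 * h) with hG
  have dvd_iff : ∀ n, (X - C d.b) ^ n ∣ G ↔ ∀ m < n, (taylor d.b G).coeff m = 0 := fun n => by
    rw [X_sub_C_pow_dvd_iff, ← taylor_apply, X_pow_dvd_iff]
  have c0 := (dvd_iff 1).mp (by simpa using d.dvd_symOp_b _) 0 (by norm_num)
  have c2 := (dvd_iff 3).mp (hd.cube_dvd_symOp ((dvd_iff 2).mpr fun m hm => by
    interval_cases m <;> assumption)) 2 (by norm_num)
  rw [blockForm_apply]
  apply pairing_eq_zero_of_dvd
  refine hd.modulus_dvd fun j => ?_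
  refine Fin.cases ?_ (fun i => ?_) j
  · exact (dvd_iff 5).mpr fun m hm => by interval_cases m <;> assumption
  · obtain ⟨T, hT⟩ : d.expo i.succ ∣ d.coexpo 0 :=
      Finset.dvd_prod_of_mem _ (by simp)
    have := d.expo_dvd i.succ (T * h)
    rwa [← mul_assoc, ← hT] at this

variable (d) in
/-- The radical of `blockForm`. -/
def blockRad (j : Fin 4) : Submodule k (degreeLT k (d.mult j)) :=
  LinearMap.ker (d.blockForm j).flip

lemma mem_blockRad {j : Fin 4} {h : degreeLT k (d.mult j)} :
    h ∈ d.blockRad j ↔ ∀ F, d.blockForm j F h = 0 := by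
  rw [blockRad, LinearMap.mem_ker, LinearMap.ext_iff]; rfl

/-- The space of remainders at `e_i` has odd dimension `2 l_i + 1`. -/
lemma Regular.one_le_finrank_blockRad (i : Fin 3) :
    1 ≤ Module.finrank k (d.blockRad i.succ) := by
  obtain ⟨v, hv, h⟩ := exists_radical_of_odd (d.blockForm i.succ) (d.blockForm_skew _) (by
    rw [finrank_degreeLT]; exact ⟨d.l i, rfl⟩)
  rw [Nat.one_le_iff_ne_zero, Ne, Submodule.finrank_eq_zero]
  intro h0
  have := mem_blockRad.mpr h
  rw [h0] at this
  exact hv (by simpa using this)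

/-- The space of remainders at `b` has dimension `4`, so its radical has even dimension. -/
lemma Regular.two_le_finrank_blockRad (hd : d.Regular) :
    2 ≤ Module.finrank k (d.blockRad 0) := by
  obtain ⟨v, hv, h⟩ := hd.exists_block_b
  obtain ⟨u, hu, h'⟩ := exists_radical_notMem_span (d.blockForm 0) (d.blockForm_skew _) (by
    rw [finrank_degreeLT]; exact (by decide : Even 4)) hv h
  by_contra! hlt
  apply hu
  rw [Submodule.eq_of_le_of_finrank_le (S₁ := Submodule.span k {v}) (S₂ := d.blockRad 0)
    (by rw [Submodule.span_singleton_le_iff_mem]; exact mem_blockRad.mpr h)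
    (by rw [finrank_span_singleton hv]; omega)]
  exact mem_blockRad.mpr h'

/-- Local solutions lie in the radical of the residue pairing. -/
lemma Regular.pairing_blockRad (hd : d.Regular) {j : Fin 4} (h : d.blockRad j) (F : k[X]) :
    d.pairing F (d.coexpo j * h) = 0 := by
  refine d.pairing_eq_zero_of_block (d.monic_expo j) (d.natDegree_expo j) (hd.isCoprime_coexpo j)
    (hd.modulus_dvd_coexpo_mul j) (fun g hg => ?_) F
  exact mem_blockRad.mp h.2 ⟨g, hg⟩

end
end Params
end HKAnsatz

namespace HKAnsatz
open Polynomial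
namespace Params

/-! ### Existence of a solution -/

variable {k : Type*} [Field k] [CharZero k] {d : Params k}

noncomputable section

variable (d) in
lemma sum_mult : ∑ j, d.mult j = 2 * d.degDen + 5 := by
  simp [Fin.sum_univ_succ, mult, degDen]; ring

variable (d) in
/-- The dimension of the space of test functions. -/
def bigDim : ℕ := 2 * d.degDen + 12 + d.l₀

lemma coexpo_mul_mem (j : Fin 4) (h : degreeLT k (d.mult j)) :
    d.coexpo j * h ∈ degreeLT k d.bigDim := by
  have h1 : (d.coexpo j * d.expo j).natDegree = 2 * d.degDen + 5 := by
    rw [coexpo, Finset.prod_erase_mul _ _ (Finset.mem_univ j),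
      natDegree_prod_of_monic _ _ fun i _ => d.monic_expo i]
    simp_rw [natDegree_expo, sum_mult]
  by_cases h0 : (h : k[X]) = 0
  · rw [h0, mul_zero]; exact Submodule.zero_mem _
  have hm : (d.coexpo j).Monic := monic_prod_of_monic _ _ fun i _ => d.monic_expo i
  rw [hm.natDegree_mul (d.monic_expo j), natDegree_expo] at h1
  have h2 := mem_degreeLT.mp h.2
  rw [degree_eq_natDegree h0, Nat.cast_lt] at h2
  rw [mem_degreeLT, degree_eq_natDegree (mul_ne_zero hm.ne_zero h0),
    hm.natDegree_mul' h0, Nat.cast_lt, bigDim]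
  omega

lemma prod_expo_mul_mem (T : degreeLT k (7 + d.l₀)) :
    (∏ j, d.expo j) * T ∈ degreeLT k d.bigDim := by
  by_cases h0 : (T : k[X]) = 0
  · rw [h0, mul_zero]; exact Submodule.zero_mem _
  have hm : (∏ j, d.expo j).Monic := monic_prod_of_monic _ _ fun i _ => d.monic_expo i
  have h2 := mem_degreeLT.mp T.2
  rw [degree_eq_natDegree h0, Nat.cast_lt] at h2
  rw [mem_degreeLT, degree_eq_natDegree (mul_ne_zero hm.ne_zero h0),
    hm.natDegree_mul' h0, Nat.cast_lt, bigDim,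
      natDegree_prod_of_monic _ _ fun i _ => d.monic_expo i]
  simp_rw [natDegree_expo, sum_mult]
  omega

variable (d) in
/-- The part of the radical of the residue pairing that consists of combinations of local solutions
and of multiples of all the `expo j`. -/
def radMap : ((j : Fin 4) → d.blockRad j) × degreeLT k (7 + d.l₀) →ₗ[k] degreeLT k d.bigDim where
  toFun x := ⟨∑ j, d.coexpo j * ((x.1 j : degreeLT k (d.mult j)) : k[X]) +
    (∏ j, d.expo j) * (x.2 : k[X]),
    Submodule.add_mem _ (Submodule.sum_mem _ fun j _ => coexpo_mul_mem j _)
      (prod_expo_mul_mem _)⟩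
  map_add' x y := by
    apply Subtype.ext
    simp [mul_add, Finset.sum_add_distrib]
    ring
  map_smul' c x := by
    apply Subtype.ext
    simp [Finset.smul_sum]

lemma Regular.radMap_injective (hd : d.Regular) : Function.Injective d.radMap := by
  rintro ⟨s, T⟩ ⟨s', T'⟩ h
  have h1 : ∑ j, d.coexpo j * ((s j : degreeLT k (d.mult j)) : k[X]) +
      (∏ j, d.expo j) * (T : k[X]) = ∑ j, d.coexpo j * ((s' j : degreeLT k (d.mult j)) : k[X]) +
      (∏ j, d.expo j) * (T' : k[X]) := congrArg Subtype.val h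
  have h' : ∑ j, d.coexpo j * (((s j : degreeLT k (d.mult j)) : k[X])
      - ((s' j : degreeLT k (d.mult j)) : k[X])) + (∏ j, d.expo j) * ((T : k[X]) - T') = 0 := by
    simp only [mul_sub, Finset.sum_sub_distrib]
    linear_combination h1
  -- The other summands are divisible by `expo j`, while `s j` is a remainder modulo `expo j`.
  have hs : s = s' := by
    ext1 j
    apply Subtype.ext
    apply Subtype.ext
    have hdvd : d.expo j ∣ ((s j : degreeLT k (d.mult j)) : k[X])
        - ((s' j : degreeLT k (d.mult j)) : k[X]) := by
      refine (hd.isCoprime_coexpo j).symm.dvd_of_dvd_mul_left ?_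
      rw [← Finset.add_sum_erase _ _ (Finset.mem_univ j), add_assoc] at h'
      rw [eq_neg_of_add_eq_zero_left h', dvd_neg]
      refine dvd_add (Finset.dvd_sum fun i hi => ?_) ?_
      · exact dvd_mul_of_dvd_left (Finset.dvd_prod_of_mem _ (by
          simpa using (Finset.ne_of_mem_erase hi).symm)) _
      · exact dvd_mul_of_dvd_left (Finset.dvd_prod_of_mem _ (Finset.mem_univ _)) _
    refine sub_eq_zero.mp (eq_zero_of_dvd_of_degree_lt hdvd ?_)
    rw [degree_eq_natDegree (d.monic_expo j).ne_zero, natDegree_expo]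
    exact mem_degreeLT.mp (Submodule.sub_mem _ (s j).1.2 (s' j).1.2)
  subst hs
  have hm : (∏ j, d.expo j).Monic := monic_prod_of_monic _ _ fun i _ => d.monic_expo i
  have hT : (T : k[X]) - T' = 0 := by simpa [hm.ne_zero] using h'
  rw [Prod.mk_inj]
  exact ⟨rfl, Subtype.ext (sub_eq_zero.mp hT)⟩

lemma Regular.pairing_radMap (hd : d.Regular) (x) (F : k[X]) :
    d.pairing F (d.radMap x) = 0 := by
  change d.pairing F (∑ j, d.coexpo j * ((x.1 j : degreeLT k (d.mult j)) : k[X]) +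
    (∏ j, d.expo j) * (x.2 : k[X])) = 0
  rw [map_add, map_sum, Finset.sum_eq_zero fun j _ => hd.pairing_blockRad _ _, zero_add]
  apply pairing_eq_zero_of_dvd
  refine hd.modulus_dvd fun j => ?_
  rw [← Finset.mul_prod_erase _ _ (Finset.mem_univ j), mul_assoc]
  exact d.expo_dvd _ _

variable (d) in
/-- A solution at infinity, up to an error of low degree. -/
lemma exists_at_infinity : ∃ u : k[X], u ∉ degreeLT k d.degDen ∧ u.natDegree ≤ d.degDen + d.l₀ ∧
    (d.symOp u).natDegree < d.degDen + 12 := by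
  -- Of the `l₀ + 1` leading coefficients of `symOp u` the top one vanishes, as `l₀` is an exponent
  -- at infinity; the others are `l₀` conditions on the `l₀ + 1` leading coefficients of `u`.
  let φ : degreeLT k (d.l₀ + 1) →ₗ[k] (Fin d.l₀ → k) := LinearMap.pi fun i =>
    (lcoeff k (d.degDen + 12 + i) ∘ₗ d.symOp ∘ₗ LinearMap.mulLeft k (X ^ d.degDen))
      ∘ₗ (degreeLT k (d.l₀ + 1)).subtype
  have hker : LinearMap.ker φ ≠ ⊥ := by
    apply LinearMap.ker_ne_bot_of_finrank_lt
    rw [finrank_degreeLT, Module.finrank_fin_fun]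
    omega
  obtain ⟨q, hq, hne⟩ := Submodule.exists_mem_ne_zero_of_ne_bot hker
  have hφ : ∀ i : Fin d.l₀, (d.symOp (X ^ d.degDen * (q : k[X]))).coeff (d.degDen + 12 + i) = 0 :=
    fun i => congrFun (LinearMap.mem_ker.mp hq) i
  have hq0 : (q : k[X]) ≠ 0 := by simpa using hne
  have hqd := mem_degreeLT.mp q.2
  rw [degree_eq_natDegree hq0, Nat.cast_lt] at hqd
  have hu : (X ^ d.degDen * (q : k[X])).natDegree = (q : k[X]).natDegree + d.degDen :=
    natDegree_X_pow_mul _ hq0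
  refine ⟨X ^ d.degDen * (q : k[X]), fun hmem => ?_, by omega, ?_⟩
  · rw [mem_degreeLT, degree_eq_natDegree (mul_ne_zero (pow_ne_zero _ X_ne_zero) hq0),
      Nat.cast_lt] at hmem
    omega
  · have hl := d.leads_symOp (F := X ^ d.degDen * (q : k[X])) (n := d.degDen + d.l₀)
      (x := _) ⟨by omega, rfl⟩
    rw [Nat.lt_iff_le_pred (by omega), natDegree_le_iff_coeff_eq_zero]
    intro m hm
    rcases lt_trichotomy m (d.degDen + d.l₀ + 12) with hlt | rfl | hgt
    · have := hφ ⟨m - (d.degDen + 12), by omega⟩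
      simpa [show d.degDen + 12 + (m - (d.degDen + 12)) = m by omega] using this
    · rw [hl.2]; push_cast; ring
    · exact coeff_eq_zero_of_natDegree_lt (hl.1.trans_lt hgt)

/-- The product equation has a solution with the expected poles. In the space of polynomials of
degree less than `2 * degDen + 12 + l₀`, the polynomials of degree less than `degDen`, together
with the solution at infinity, form an isotropic space of dimension `degDen + 1`, and the range of
`radMap` is a subspace of the radical of dimension at least `5 + 7 + l₀`. So the former contains a
nonzero element of the radical, which is a solution by `symOp_eq_zero_of_pairing`. -/
theorem Regular.exists_solution (hd : d.Regular) :
    ∃ U : k[X], U ≠ 0 ∧ U.natDegree ≤ d.degDen + d.l₀ ∧ d.symOp U = 0 := by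
  obtain ⟨u, hu, hun, hus⟩ := d.exists_at_infinity
  have hN : d.bigDim = 2 * d.degDen + 12 + d.l₀ := rfl
  have hle : degreeLT k d.degDen ≤ degreeLT k d.bigDim := degreeLT_mono (by omega)
  have hmem : u ∈ degreeLT k d.bigDim := by
    rw [mem_degreeLT]
    refine (degree_le_natDegree).trans_lt ?_
    rw [Nat.cast_lt]; omega
  let w : degreeLT k d.degDen × k →ₗ[k] degreeLT k d.bigDim :=
    (Submodule.inclusion hle).coprod (LinearMap.toSpanSingleton k _ ⟨u, hmem⟩)
  have hw : ∀ x, (w x : k[X]) = x.1 + x.2 • u := fun x => rfl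
  have hwinj : Function.Injective w := by
    rw [← LinearMap.ker_eq_bot, LinearMap.ker_eq_bot']
    rintro ⟨f, c⟩ h
    have h' : (f : k[X]) + c • u = 0 := congrArg Subtype.val h
    have hc : c = 0 := by
      by_contra hc
      apply hu
      have : u = (-c⁻¹) • (f : k[X]) := by
        rw [eq_neg_of_add_eq_zero_left h', smul_neg, neg_smul, neg_neg, smul_smul,
          inv_mul_cancel₀ hc, one_smul]
      rw [this]
      exact Submodule.smul_mem _ _ f.2
    subst hc
    rw [Prod.mk_eq_zero]
    exact ⟨Subtype.ext (by simpa using h'), rfl⟩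
  have hlow : ∀ f : degreeLT k d.degDen, (f : k[X]).natDegree < d.degDen := fun f => by
    by_cases h0 : (f : k[X]) = 0
    · rw [h0, natDegree_zero, degDen]; omega
    · exact (natDegree_lt_iff_degree_lt h0).mpr (mem_degreeLT.mp f.2)
  have hlow' : ∀ f : degreeLT k d.degDen, (d.symOp f).natDegree < d.degDen + 12 := fun f => by
    have := (d.leads_symOp (F := (f : k[X])) (n := d.degDen - 1) (x := _)
      ⟨by have := hlow f; omega, rfl⟩).1
    have := hlow f
    omega
  let B : degreeLT k d.bigDim →ₗ[k] degreeLT k d.bigDim →ₗ[k] k := d.pairing.domRestrict₁₂ _ _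
  have hB : ∀ v w, B v w = -B w v := fun v w => d.pairing_skew _ _
  obtain ⟨v, ⟨x, rfl⟩, hne, hrad⟩ := exists_mem_radical B hB (LinearMap.range w)
    (LinearMap.range d.radMap) (by
      rintro _ ⟨x, rfl⟩ _ ⟨y, rfl⟩
      change d.pairing (w x) (w y) = 0
      have e1 : d.pairing x.1 y.1 = 0 :=
        d.pairing_eq_zero_of_natDegree (by have := hlow x.1; have := hlow' y.1; omega)
      have e2 : d.pairing x.1 u = 0 :=
        d.pairing_eq_zero_of_natDegree (by have := hlow x.1; omega)
      have e3 : d.pairing u y.1 = 0 := by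
        rw [pairing_skew, d.pairing_eq_zero_of_natDegree (by have := hlow y.1; omega), neg_zero]
      rw [hw, hw]
      simp only [map_add, LinearMap.add_apply, map_smul, LinearMap.smul_apply, e1, e2, e3,
        pairing_self, smul_zero, add_zero])
    (by rintro _ ⟨x, rfl⟩ F; exact hd.pairing_radMap x F)
    (by
      have : ∀ j, Module.Free k (d.blockRad j) := fun j =>
        Module.Free.of_divisionRing k (d.blockRad j)
      rw [LinearMap.finrank_range_of_inj hwinj, LinearMap.finrank_range_of_inj hd.radMap_injective,
        Module.finrank_prod, Module.finrank_prod, finrank_degreeLT, finrank_degreeLT,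
        finrank_degreeLT, Module.finrank_self, Module.finrank_pi_fintype, Fin.sum_univ_succ,
        Fin.sum_univ_three]
      have := hd.two_le_finrank_blockRad
      have := Regular.one_le_finrank_blockRad (d := d) 0
      have := Regular.one_le_finrank_blockRad (d := d) 1
      have := Regular.one_le_finrank_blockRad (d := d) 2
      omega)
  have hsym : d.symOp (w x) = 0 := by
    apply d.symOp_eq_zero_of_pairing
    · rw [hw, map_add, map_smul]
      refine (natDegree_add_le _ _).trans_lt (max_lt ?_ ?_)
      · have := hlow' x.1; omega
      · refine (natDegree_smul_le _ _).trans_lt (by omega)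
    · intro j hj
      exact hrad ⟨X ^ j, by
        rw [mem_degreeLT, degree_X_pow, Nat.cast_lt]; omega⟩
  refine ⟨w x, by simpa using hne, ?_, hsym⟩
  rw [hw]
  refine (natDegree_add_le _ _).trans (max_le ?_ ?_)
  · have := hlow x.1; omega
  · exact (natDegree_smul_le _ _).trans hun

end
end Params
end HKAnsatz

namespace HKAnsatz
open Polynomial

/-! ### Uniqueness of the solution -/

section Wronskian
variable {A : Type*} [CommRing A] [IsDomain A] [CharZero A]

/-- If the Wronskian of two polynomials vanishes, its top coefficient shows that the degrees agree.
-/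
lemma natDegree_eq_of_wronskian {F G : A[X]} (hF : F ≠ 0) (hG : G ≠ 0)
    (h : derivative F * G = F * derivative G) : F.natDegree = G.natDegree := by
  have hcoef : ∀ {P Q : A[X]}, (derivative P * Q).coeff (P.natDegree + Q.natDegree - 1)
      = P.natDegree * (P.leadingCoeff * Q.leadingCoeff) := by
    intro P Q
    rcases Nat.eq_zero_or_pos P.natDegree with h0 | h0
    · rw [h0, natDegree_eq_zero.mp h0 |>.choose_spec.symm]; simp
    · have h1 : Params.Leads (derivative P) (P.natDegree - 1) (P.leadingCoeff * P.natDegree) := by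
        have := Params.Leads.derivative (F := P) (n := P.natDegree - 1) (x := P.leadingCoeff)
          ⟨by omega, by rw [Nat.sub_add_cancel h0, coeff_natDegree]⟩
        refine this.congr rfl ?_
        rw [← Nat.cast_add_one, Nat.sub_add_cancel h0]
      have h2 := h1.mul (G := Q) (n := Q.natDegree) (y := Q.leadingCoeff) ⟨le_rfl, rfl⟩
      rw [show P.natDegree + Q.natDegree - 1 = P.natDegree - 1 + Q.natDegree by omega, h2.2]
      ring
  have h1 := hcoef (P := F) (Q := G)
  have h2 := hcoef (P := G) (Q := F)
  rw [h, mul_comm, add_comm, h2] at h1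
  have hne : F.leadingCoeff * G.leadingCoeff ≠ 0 :=
    mul_ne_zero (leadingCoeff_ne_zero.mpr hF) (leadingCoeff_ne_zero.mpr hG)
  rw [mul_comm G.leadingCoeff] at h1
  exact_mod_cast (mul_right_cancel₀ hne h1).symm

/-- Two polynomials with vanishing Wronskian are proportional. -/
lemma eq_C_mul_of_wronskian {F Z : A[X]} (hZ : Z.Monic)
    (h : derivative F * Z = F * derivative Z) : F = C (F.coeff Z.natDegree) * Z := by
  by_contra hne
  set G := F - C (F.coeff Z.natDegree) * Z with hG
  have hG0 : G ≠ 0 := sub_ne_zero.mpr hne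
  have hd := natDegree_eq_of_wronskian hG0 hZ.ne_zero (by
    rw [hG, derivative_sub, derivative_C_mul]; linear_combination h)
  have : G.coeff Z.natDegree = 0 := by
    rw [hG, coeff_sub, coeff_C_mul, hZ.coeff_natDegree, mul_one, sub_self]
  rw [← hd, coeff_natDegree, leadingCoeff_eq_zero] at this
  exact hG0 this

end Wronskian

namespace Params

/-- The first integral of a solution, whose value `Q` is a constant of the coefficient ring. -/
lemma exists_quad_eq {A : Type*} [CommRing A] [IsDomain A] [CharZero A] {d : Params A} {U : A[X]}
    (hU : d.symOp U = 0) : ∃ Q, d.quad U = C Q * d.zden := by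
  refine ⟨_, eq_C_mul_of_wronskian d.monic_zden ?_⟩
  have h1 := d.quad_derivative U
  have h2 := d.base_mul_derivative_zden
  rw [hU, mul_zero] at h1
  have h3 : d.base * derivative (d.quad U) - 2 * (d.logDen + derivative d.base) * d.quad U = 0 := by
    simpa using h1
  apply mul_left_cancel₀ d.monic_base.ne_zero
  linear_combination d.zden * h3 - d.quad U * h2

variable {k : Type*} [Field k] [CharZero k] {d : Params k}

noncomputable section

lemma exists_eq_pow_mul {U : k[X]} (hU : U ≠ 0) (p : k) :
    ∃ g, U = (X - C p) ^ U.rootMultiplicity p * g ∧ g.eval p ≠ 0 := by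
  obtain ⟨g, hg, hg'⟩ := exists_eq_pow_rootMultiplicity_mul_and_not_dvd U hU p
  exact ⟨g, hg, fun h => hg' (dvd_iff_isRoot.mpr h)⟩

/-- A solution that vanishes at `e_i` vanishes there to the order of the largest exponent. -/
lemma Regular.pow_dvd_of_eval_e (hd : d.Regular) {U : k[X]} (hU : d.symOp U = 0) (i : Fin 3)
    (h : U.eval (d.e i) = 0) : (X - C (d.e i)) ^ (2 * d.l i + 1) ∣ U := by
  by_cases h0 : U = 0
  · simp [h0]
  obtain ⟨g, hg, hg'⟩ := exists_eq_pow_mul h0 (d.e i)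
  set a := U.rootMultiplicity (d.e i) with ha
  obtain ⟨K, hK, hK'⟩ := d.symOp_pow_mul i a g
  rw [← hg, hU, eq_comm, mul_eq_zero] at hK
  have hK0 := hK.resolve_left (pow_ne_zero _ (X_sub_C_ne_zero _))
  rw [hK0, eval_zero] at hK'
  have ha0 : a ≠ 0 := by
    intro h0'; rw [h0', pow_zero, one_mul] at hg; rw [hg] at h; exact hg' h
  have h1 : (2 * (a - d.l i) - 1 : k) ≠ 0 := by
    intro h
    have : (2 * a : k) = 2 * d.l i + 1 := by linear_combination h
    have : 2 * a = 2 * d.l i + 1 := by exact_mod_cast this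
    omega
  have h2 : (a - d.l i - d.l i - 1 : k) = 0 := by
    have e1 := hd.chatAt_e i
    have e2 : d.e i - d.b ≠ 0 := sub_ne_zero.mpr (hd.ne i).symm
    have e3 : (a : k) ≠ 0 := by exact_mod_cast ha0
    simpa [e1, e2, e3, h1, hg'] using hK'.symm
  have h3 : a = 2 * d.l i + 1 := by
    have : (a : k) = 2 * d.l i + 1 := by linear_combination h2
    exact_mod_cast this
  rw [hg, h3]; exact dvd_mul_right _ _

/-- A solution that vanishes at `b` does so to second order. -/
lemma Regular.pow_dvd_of_eval_b (hd : d.Regular) {U : k[X]} (hU : d.symOp U = 0)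
    (h : U.eval d.b = 0) : (X - C d.b) ^ 2 ∣ U := by
  by_cases h0 : U = 0
  · simp [h0]
  obtain ⟨g, hg, hg'⟩ := exists_eq_pow_mul h0 d.b
  set a := U.rootMultiplicity d.b with ha
  obtain ⟨K, hK, hK'⟩ := d.symOp_pow_mul_b a g
  rw [← hg, hU, eq_comm, mul_eq_zero] at hK
  have hK0 := hK.resolve_left (pow_ne_zero _ (X_sub_C_ne_zero _))
  rw [hK0, eval_zero] at hK'
  have ha0 : a ≠ 0 := by
    intro h0'; rw [h0', pow_zero, one_mul] at hg; rw [hg] at h; exact hg' h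
  have h2 : 2 ≤ a := by
    by_contra! hlt
    have : a = 1 := by omega
    rw [this] at hK'
    have := hd.chat_b
    norm_num [this, hg'] at hK'
  rw [hg]; exact dvd_mul_of_dvd_left (pow_dvd_pow _ h2) _

/-- A solution that does not attain the largest growth at infinity has the smallest one. -/
lemma natDegree_add_le_of_lt {U : k[X]} (hU : d.symOp U = 0) (h0 : U ≠ 0)
    (h : U.natDegree < d.degDen + d.l₀) : U.natDegree + d.l₀ + 1 ≤ d.degDen := by
  have hl := d.leads_symOp (F := U) (n := U.natDegree) (x := U.leadingCoeff) ⟨le_rfl, rfl⟩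
  have := hl.2
  rw [hU, coeff_zero, eq_comm] at this
  set n := U.natDegree
  have h1 : (2 * (n - d.degDen) + 1 : k) ≠ 0 := by
    intro h
    have : (2 * n + 1 : k) = 2 * d.degDen := by linear_combination h
    have : 2 * n + 1 = 2 * d.degDen := by exact_mod_cast this
    omega
  have h2 : (n - d.degDen - d.l₀ : k) ≠ 0 := by
    intro h'
    have : (n : k) = d.degDen + d.l₀ := by linear_combination h'
    have : n = d.degDen + d.l₀ := by exact_mod_cast this
    omega
  have h3 : (n - d.degDen + d.l₀ + 1 : k) = 0 := by
    simpa [h1, h2, h0] using this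
  have : (n + d.l₀ + 1 : k) = d.degDen := by linear_combination h3
  have : n + d.l₀ + 1 = d.degDen := by exact_mod_cast this
  omega

/-- A solution with the expected poles is unique up to a factor. The gaps between the exponents
force the Wronskian of two solutions to be divisible by `∏ (z - e_i) ^ (2 l_i) * (z - b)`, which has
degree `2 * degDen - 1`, and at infinity to have a smaller degree. -/
theorem Regular.proportional (hd : d.Regular) {U V : k[X]} (hU : d.symOp U = 0)
    (hV : d.symOp V = 0) (hUn : U.natDegree ≤ d.degDen + d.l₀)
    (hVn : V.natDegree ≤ d.degDen + d.l₀) (hV0 : V ≠ 0) : ∃ c, U = C c * V := by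
  have hcomb : ∀ c, d.symOp (U - C c * V) = 0 := fun c => by
    rw [← smul_eq_C_mul, map_sub, map_smul, hU, hV, smul_zero, sub_zero]
  set Y := derivative U * V - U * derivative V with hY
  have hYc : ∀ c, Y = derivative (U - C c * V) * V - (U - C c * V) * derivative V := fun c => by
    rw [derivative_sub, derivative_C_mul]; ring
  have hpow : ∀ {p : k} {n : ℕ} {P : k[X]}, (X - C p) ^ (n + 1) ∣ P →
      (X - C p) ^ n ∣ derivative P := by
    rintro p n _ ⟨T, rfl⟩
    rw [derivative_mul, derivative_X_sub_C_pow, pow_succ]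
    exact ⟨C ((n : k) + 1) * T + (X - C p) * derivative T, by
      push_cast
      simp only [Nat.add_sub_cancel, map_add, map_natCast, map_one]; ring⟩
  -- At a singular point a combination with the same Wronskian vanishes, hence to high order.
  have hloc : ∀ (p : k) (n : ℕ), (∀ P, d.symOp P = 0 → P.eval p = 0 → (X - C p) ^ (n + 1) ∣ P) →
      (X - C p) ^ n ∣ Y := by
    intro p n hp
    by_cases h : V.eval p = 0
    · have h1 := hp V hV h
      exact dvd_sub (dvd_mul_of_dvd_right ((pow_dvd_pow _ (Nat.le_succ n)).trans h1) _)
        (dvd_mul_of_dvd_right (hpow h1) _)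
    · have h1 := hp _ (hcomb (U.eval p / V.eval p)) (by simp [h])
      rw [hYc (U.eval p / V.eval p)]
      exact dvd_sub (dvd_mul_of_dvd_left (hpow h1) _)
        (dvd_mul_of_dvd_left ((pow_dvd_pow _ (Nat.le_succ n)).trans h1) _)
  have hdvd : ∏ j, (X - C (d.pt j)) ^ (Fin.cons 1 fun i => 2 * d.l i : Fin 4 → ℕ) j ∣ Y := by
    refine Finset.prod_dvd_of_coprime (fun i _ j _ hij => ?_) fun j _ => ?_
    · exact (pairwise_coprime_X_sub_C hd.pt_injective hij).pow
    · refine Fin.cases ?_ (fun i => ?_) j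
      · exact hloc _ 1 fun P hP h => hd.pow_dvd_of_eval_b hP h
      · exact hloc _ (2 * d.l i) fun P hP h => hd.pow_dvd_of_eval_e hP i h
  have hdeg : ∀ {P R : k[X]}, d.symOp P = 0 → P ≠ 0 → P.natDegree < d.degDen + d.l₀ →
      R.natDegree ≤ d.degDen + d.l₀ →
      (derivative P * R - P * derivative R).natDegree < 2 * d.degDen - 1 := by
    intro P R hP h0 hlt hR
    have h1 := natDegree_add_le_of_lt hP h0 hlt
    have hconst : ∀ {P : k[X]}, P.natDegree = 0 → derivative P = 0 := fun h => by
      rw [natDegree_eq_zero.mp h |>.choose_spec.symm, derivative_C]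
    refine (natDegree_sub_le _ _).trans_lt (max_lt ?_ ?_)
    · rcases Nat.eq_zero_or_pos P.natDegree with h | h
      · rw [hconst h, zero_mul, natDegree_zero]; omega
      · have := natDegree_mul_le (p := derivative P) (q := R)
        have := natDegree_derivative_le P
        omega
    · rcases Nat.eq_zero_or_pos R.natDegree with h | h
      · rw [hconst h, mul_zero, natDegree_zero]; omega
      · have := natDegree_mul_le (p := P) (q := derivative R)
        have := natDegree_derivative_le R
        omega
  -- At infinity a combination with the same Wronskian has the small growth.
  have hYd : Y = 0 ∨ Y.natDegree < 2 * d.degDen - 1 := by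
    by_cases hlt : V.natDegree < d.degDen + d.l₀
    · right
      have hYn : Y = -(derivative V * U - V * derivative U) := by rw [hY]; ring
      rw [hYn, natDegree_neg]
      exact hdeg hV hV0 hlt hUn
    · have hVe : V.natDegree = d.degDen + d.l₀ := by omega
      set c := U.coeff (d.degDen + d.l₀) / V.leadingCoeff with hc
      by_cases h0 : U - C c * V = 0
      · left; rw [hYc c, h0]; simp
      · right
        rw [hYc c]
        refine hdeg (hcomb c) h0 ?_ hVn
        have hle : (U - C c * V).natDegree ≤ d.degDen + d.l₀ :=
          (natDegree_sub_le _ _).trans (max_le hUn ((natDegree_C_mul_le _ _).trans hVn))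
        refine lt_of_le_of_ne hle fun he => h0 ?_
        rw [← leadingCoeff_eq_zero, leadingCoeff, he, coeff_sub, coeff_C_mul, hc, ← hVe,
          coeff_natDegree, div_mul_cancel₀ _ (leadingCoeff_ne_zero.mpr hV0), sub_self]
  have hY0 : Y = 0 := by
    rcases hYd with h | h
    · exact h
    · refine eq_zero_of_dvd_of_natDegree_lt hdvd (h.trans_le ?_)
      rw [natDegree_prod_of_monic _ _ fun i _ => (monic_X_sub_C _).pow _]
      simp_rw [(monic_X_sub_C _).natDegree_pow, natDegree_X_sub_C, mul_one]
      rw [Fin.sum_univ_succ, Fin.sum_univ_three]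
      simp only [Fin.cons_zero, Fin.cons_succ, degDen]
      omega
  set m := C V.leadingCoeff⁻¹ * V with hm
  have hmon : m.Monic := by
    rw [hm, mul_comm]; exact monic_mul_leadingCoeff_inv hV0
  refine ⟨U.coeff m.natDegree * V.leadingCoeff⁻¹,
    (eq_C_mul_of_wronskian (F := U) hmon ?_).trans ?_⟩
  · rw [hm, derivative_C_mul]; linear_combination C V.leadingCoeff⁻¹ * hY0
  · rw [C_mul, mul_assoc, ← hm]

end
end Params
end HKAnsatz

namespace HKAnsatz
open Polynomial
namespace Params

/-! ### Solutions with nonzero first integral -/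

variable {k : Type*} [Field k] [CharZero k] {d : Params k}

noncomputable section

lemma Regular.zden_eq (hd : d.Regular) (i : Fin 3) : ∃ Y : k[X],
    d.zden = (X - C (d.e i)) ^ (2 * d.l i + 2) * Y ∧ Y.eval (d.e i) ≠ 0 := by
  refine ⟨(X - C d.b) ^ 4 * d.chatAt i ^ 2 *
    (∏ j ∈ Finset.univ.erase i, (X - C (d.e j)) ^ d.l j) ^ 2, ?_, ?_⟩
  · rw [zden, den, gauge, ← Finset.mul_prod_erase _ _ (Finset.mem_univ i), d.base_eq i]; ring
  · have h1 := hd.chatAt_e i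
    have h2 : d.e i - d.b ≠ 0 := sub_ne_zero.mpr (hd.ne i).symm
    have h3 : ∀ j ∈ Finset.univ.erase i, (d.e i - d.e j) ^ d.l j ≠ 0 := fun j hj =>
      pow_ne_zero _ (sub_ne_zero.mpr fun h => Finset.ne_of_mem_erase hj (hd.inj _ _ h).symm)
    simp only [eval_mul, eval_pow, eval_sub, eval_X, eval_C, eval_prod]
    exact mul_ne_zero (mul_ne_zero (pow_ne_zero _ h2) (pow_ne_zero _ h1))
      (pow_ne_zero _ (Finset.prod_ne_zero_iff.mpr h3))

/-- If `U` vanished at `e_i`, it would do so to order `2 l_i + 1`, and `quad U` to a larger order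
than `zden`. -/
lemma Regular.eval_e_ne_zero (hd : d.Regular) {U : k[X]} (hU : d.symOp U = 0) {Q : k}
    (hQ : d.quad U = C Q * d.zden) (hQ0 : Q ≠ 0) (i : Fin 3) : U.eval (d.e i) ≠ 0 := by
  intro h
  obtain ⟨g, hg⟩ := hd.pow_dvd_of_eval_e hU i h
  obtain ⟨K, hK, -⟩ := d.quad_pow_mul i (2 * d.l i + 1) g
  obtain ⟨Y, hY, hY'⟩ := hd.zden_eq i
  rw [← hg, hQ, hY] at hK
  have hne : X - C (d.e i) ≠ 0 := X_sub_C_ne_zero _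
  have hz : (X - C (d.e i)).eval (d.e i) = 0 := by simp
  generalize X - C (d.e i) = t at hK hne hz
  generalize d.l i = l at hK
  have h1 : C Q * Y = t ^ (2 * l + 1) * K := by
    refine mul_left_cancel₀ (pow_ne_zero (2 * l + 2) hne) ?_
    rw [← mul_assoc (t ^ (2 * l + 2)) (t ^ (2 * l + 1)), ← pow_add,
      show 2 * l + 2 + (2 * l + 1) = 2 * (2 * l + 1) + 1 by ring, ← hK]
    ring
  have := congrArg (eval (d.e i)) h1
  rw [eval_mul, eval_mul, eval_pow, hz, eval_C, zero_pow (Nat.succ_ne_zero _), zero_mul] at this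
  exact mul_ne_zero hQ0 hY' this

/-- With the smaller growth at infinity, `quad U` would have smaller degree than `zden`. -/
lemma natDegree_eq_of_quad {U : k[X]} (hU : d.symOp U = 0) {Q : k}
    (hQ : d.quad U = C Q * d.zden) (hQ0 : Q ≠ 0) (hn : U.natDegree ≤ d.degDen + d.l₀) :
    U.natDegree = d.degDen + d.l₀ := by
  by_contra hne
  have h0 : U ≠ 0 := by
    rintro rfl
    have : d.quad (0 : k[X]) = 0 := by simp [quad]
    rw [this, eq_comm, mul_eq_zero, C_eq_zero] at hQ
    exact hQ.elim hQ0 d.monic_zden.ne_zero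
  have h1 := natDegree_add_le_of_lt hU h0 (by omega)
  have h2 := (d.leads_quad (F := U) (n := U.natDegree) (x := _) ⟨le_rfl, rfl⟩).1
  rw [hQ, natDegree_C_mul hQ0, natDegree_zden] at h2
  omega

lemma Regular.isCoprime_base (hd : d.Regular) {U : k[X]} (hU : d.symOp U = 0) {Q : k}
    (hQ : d.quad U = C Q * d.zden) (hQ0 : Q ≠ 0) (hb : U.eval d.b ≠ 0) :
    IsCoprime U d.base := by
  have h : ∀ p, U.eval p ≠ 0 → IsCoprime U (X - C p) := fun p hp =>
    (((irreducible_X_sub_C p).coprime_iff_not_dvd).mpr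
      fun h => hp (dvd_iff_isRoot.mp h)).symm
  exact (h _ hb).mul_right (IsCoprime.prod_right fun i _ => h _ (hd.eval_e_ne_zero hU hQ hQ0 i))

lemma isCoprime_den {U : k[X]} (h : IsCoprime U d.base) : IsCoprime U d.den := by
  have h1 : ∀ i, IsCoprime U (X - C (d.e i)) := fun i =>
    h.of_isCoprime_of_dvd_right
      (dvd_mul_of_dvd_right (Finset.dvd_prod_of_mem _ (Finset.mem_univ i)) _)
  exact (h.of_mul_right_left).mul_right (IsCoprime.prod_right fun i _ => (h1 i).pow_right)

/-- The first integral modulo the solution. In particular `U'` does not vanish at a zero of `U`. -/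
lemma dvd_of_quad {U : k[X]} {Q : k} (hQ : d.quad U = C Q * d.zden) (h : IsCoprime U d.base) :
    U ∣ d.chat * derivative U ^ 2 + C Q * d.den ^ 2 := by
  refine (h.pow_right (n := 2)).dvd_of_dvd_mul_left ?_
  refine ⟨-d.pot * U + 2 * d.chat * d.theta 1 (d.theta 0 U)
    + derivative d.chat * d.base * d.theta 0 U
    - d.chat * (d.logDen ^ 2 * U - 2 * d.base * d.logDen * derivative U), ?_⟩
  rw [quad, zden] at hQ
  have : d.theta 0 U = d.base * derivative U - d.logDen * U := by simp [theta_apply]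
  linear_combination (-1 : k[X]) * hQ
    - d.chat * (d.theta 0 U + d.base * derivative U - d.logDen * U) * this

lemma squarefree_of_quad {U : k[X]} {Q : k} (hQ : d.quad U = C Q * d.zden) (hQ0 : Q ≠ 0)
    (h : IsCoprime U d.base) : Squarefree U := by
  obtain ⟨S, hS⟩ := dvd_of_quad hQ h
  obtain ⟨u, v, huv⟩ := (isCoprime_den h).pow_right (n := 2)
  refine Separable.squarefree ⟨u + C Q⁻¹ * v * S, -(C Q⁻¹ * v * d.chat * derivative U), ?_⟩
  have : C Q⁻¹ * C Q = (1 : k[X]) := by rw [← C_mul, inv_mul_cancel₀ hQ0, C_1]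
  linear_combination huv - C Q⁻¹ * v * hS + v * d.den ^ 2 * this

end
end Params
end HKAnsatz

namespace HKAnsatz
open Polynomial
namespace Params

/-! ### Dependence on the accessory parameter -/

section Lead
variable {D : Type*} [CommRing D]

noncomputable section

/-- The coefficient of `T^j` of a polynomial in `X` with coefficients in `D[T]`. -/
def tCoeff (j : ℕ) (F : D[X][X]) : D[X] :=
  ∑ i ∈ F.support, monomial i ((F.coeff i).coeff j)

lemma coeff_tCoeff (j i : ℕ) (F : D[X][X]) : (tCoeff j F).coeff i = (F.coeff i).coeff j := by
  simp only [tCoeff, finsetSum_coeff, coeff_monomial]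
  simp
  intro h; rw [h]; simp

lemma tCoeff_add (j : ℕ) (F G : D[X][X]) : tCoeff j (F + G) = tCoeff j F + tCoeff j G := by
  ext i; simp [coeff_tCoeff]

lemma tCoeff_sub (j : ℕ) (F G : D[X][X]) : tCoeff j (F - G) = tCoeff j F - tCoeff j G := by
  ext i; simp [coeff_tCoeff]

lemma tCoeff_zero (j : ℕ) : tCoeff j (0 : D[X][X]) = 0 := by
  ext i; simp [coeff_tCoeff]

lemma tCoeff_derivative (j : ℕ) (F : D[X][X]) :
    tCoeff j (derivative F) = derivative (tCoeff j F) := by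
  ext i
  simp only [coeff_tCoeff, coeff_derivative]
  rw [← Nat.cast_succ, ← Nat.cast_succ, coeff_mul_natCast]

lemma tCoeff_map_mul (j : ℕ) (p : D[X]) (F : D[X][X]) :
    tCoeff j (p.map C * F) = p * tCoeff j F := by
  ext i
  rw [coeff_tCoeff, coeff_mul, finsetSum_coeff, coeff_mul]
  simp only [coeff_tCoeff, coeff_map, coeff_C_mul]

lemma tCoeff_C_X_mul (j : ℕ) (F : D[X][X]) : tCoeff (j + 1) (C X * F) = tCoeff j F := by
  ext i
  simp only [coeff_tCoeff, coeff_C_mul, coeff_X_mul]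

/-- The parameters with constant `e_i`, `b` and variable `μ`. -/
def generic (d : Params D) : Params D[X] where
  e i := C (d.e i)
  b := C d.b
  μ := X
  l := d.l
  l₀ := d.l₀

variable (d : Params D)

lemma generic_chat : d.generic.chat = d.chat.map C := by
  simp [chat, generic, Polynomial.map_prod]

lemma generic_base : d.generic.base = d.base.map C := by
  rw [base, generic_chat, base]; simp [generic]

lemma generic_logDen : d.generic.logDen = d.logDen.map C := by
  rw [logDen, generic_chat, logDen]; simp [generic, Polynomial.map_sum]

/-- The coefficient of `μ` in the potential. -/
def pot₁ : D[X] := -(C (4 * d.chat.eval d.b) * (X - C d.b) * d.chat ^ 2)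
  - C (∑ i, (4 * (d.l i : D) + 2) * ((d.b - d.e (i + 1)) * (d.b - d.e (i + 2)))) * d.base ^ 2

lemma generic_wRes : ∃ w : D, d.generic.wRes = C w - C (4 * d.chat.eval d.b) * X := by
  refine ⟨2 * ∑ i, ((d.b - d.e (i + 1)) * (d.b - d.e (i + 2))) +
      ∑ i, 2 * (d.l i : D) * ((d.b - d.e (i + 1)) * (d.b - d.e (i + 2))), ?_⟩
  simp only [wRes, sTl, generic, ← prod_sub_e_eq, Fin.sum_univ_three, Fin.prod_univ_three]
  simp [C_ofNat]
  ring

lemma generic_wConst : ∃ w : D, d.generic.wConst = C w + C (4 * d.chat.eval d.b) * X ^ 2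
    - C (∑ i, (4 * (d.l i : D) + 2) * ((d.b - d.e (i + 1)) * (d.b - d.e (i + 2)))) * X := by
  refine ⟨∑ i, (d.l i : D) * (d.l i + 1) * d.e i + 3 * d.b
      - (-(d.b * (∑ i, (d.l i : D) - d.l₀) * (∑ i, (d.l i : D) + d.l₀ + 1))
      + 2 * ∑ i, (d.l (i + 1) : D) * d.l (i + 2) * d.e i
      - ∑ i, (d.l i : D) * (d.l i * d.e i + 2 * (d.e i + d.b))), ?_⟩
  simp only [wConst, eTl, pApp, generic, ← prod_sub_e_eq, Fin.sum_univ_three,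
    Fin.prod_univ_three]
  simp [C_ofNat]
  ring

lemma exists_generic_pot : ∃ W : D[X], d.generic.pot = W.map C + C X * d.pot₁.map C
    + C X * (C X * (C (4 * d.chat.eval d.b) * d.base ^ 2).map C) := by
  obtain ⟨w, hw⟩ := d.generic_wConst
  obtain ⟨r, hr⟩ := d.generic_wRes
  refine ⟨(X - C d.b) ^ 2 * d.chat ^ 2 * (C ((d.l₀ : D) * (d.l₀ + 1)) * X + C w)
    + (X - C d.b) ^ 2 * d.chat * (∑ i, C ((d.l i : D) * (d.l i + 1) * d.resH i) *
      ((X - C (d.e (i + 1))) * (X - C (d.e (i + 2)))))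
    + d.chat ^ 2 * (C (3 * ∏ i, (d.b - d.e i)) + C r * (X - C d.b)), ?_⟩
  have h1 : ∀ i, d.generic.resH i = C (d.resH i) := fun i => by simp [resH, generic]
  have h2 : ∏ i, (d.generic.b - d.generic.e i) = C (∏ i, (d.b - d.e i)) := by
    simp [generic]
  have h3 : ∑ i, C ((d.generic.l i : D[X]) * (d.generic.l i + 1) * d.generic.resH i) *
      ((X - C (d.generic.e (i + 1))) * (X - C (d.generic.e (i + 2)))) =
      (∑ i, C ((d.l i : D) * (d.l i + 1) * d.resH i) *
      ((X - C (d.e (i + 1))) * (X - C (d.e (i + 2))))).map C := by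
    simp_rw [h1]
    simp [generic, Polynomial.map_sum]
  have h4 : C ((d.generic.l₀ : D[X]) * (d.generic.l₀ + 1)) =
      (C ((d.l₀ : D) * (d.l₀ + 1)) : D[X]).map C := by simp [generic]
  have h5 : X - C d.generic.b = (X - C d.b : D[X]).map C := by simp [generic]
  rw [pot, h2, h3, h4, h5, generic_chat, hw, hr, pot₁, base]
  generalize (∑ i, C ((d.l i : D) * (d.l i + 1) * d.resH i) *
      ((X - C (d.e (i + 1))) * (X - C (d.e (i + 2))))) = S
  generalize (∑ i, (4 * (d.l i : D) + 2) * ((d.b - d.e (i + 1)) * (d.b - d.e (i + 2)))) = s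
  generalize ∏ i, (d.b - d.e i) = t
  simp only [Polynomial.map_add, Polynomial.map_sub, Polynomial.map_mul, Polynomial.map_pow,
    Polynomial.map_neg, Polynomial.map_ofNat, C_ofNat, map_C, map_X, map_add, map_sub, map_mul,
    map_pow]
  ring

variable {d}

/-- A polynomial `F` for which `F / den` has derivative zero is a multiple of `den`. -/
lemma eq_C_mul_den_of_theta [IsDomain D] [CharZero D] {F : D[X]} (h : d.theta 0 F = 0)
    (hb : d.base.Monic) (hd : d.den.Monic) : ∃ u, F = C u * d.den := by
  refine ⟨_, eq_C_mul_of_wronskian hd ?_⟩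
  have h1 := d.base_mul_derivative_den
  have h2 : d.base * derivative F = d.logDen * F := by
    simp only [theta_apply, Nat.cast_zero, zero_mul, add_zero] at h
    linear_combination h
  apply mul_left_cancel₀ hb.ne_zero
  linear_combination d.den * h2 - F * h1

/-- For variable `μ` a solution vanishes neither at `b` nor in its first integral. The two leading
coefficients of the equation in `μ` determine the leading coefficient of `U`, a multiple of `den`,
and `theta 0` of the second one; the latter gives the value of `U` at `b`, and the former the
leading coefficient of `quad U`. -/
lemma generic_solution [IsDomain D] [CharZero D] (hc : d.chat.eval d.b ≠ 0)
    (hg : d.gauge.eval d.b ≠ 0) (hb : d.base.Monic) (hd : d.den.Monic)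
    {U : D[X][X]} (hU0 : U ≠ 0) (hU : d.generic.symOp U = 0) :
    U.eval (C d.b) ≠ 0 ∧ d.generic.quad U ≠ 0 := by
  obtain ⟨W, hW⟩ := d.exists_generic_pot
  -- the top coefficient of `U` in `μ`
  obtain ⟨m, hm0, hm⟩ : ∃ m, tCoeff m U ≠ 0 ∧ ∀ j, m < j → tCoeff j U = 0 := by
    obtain ⟨i, hi, hsup⟩ := Finset.exists_mem_eq_sup U.support
      (Finset.nonempty_iff_ne_empty.mpr (mt support_eq_empty.mp hU0))
      (fun i => (U.coeff i).natDegree)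
    refine ⟨(U.coeff i).natDegree, fun h => ?_, fun j hj => ?_⟩
    · have := congrArg (fun F => F.coeff i) h
      simp only [coeff_tCoeff, coeff_zero, coeff_natDegree, leadingCoeff_eq_zero] at this
      exact mem_support_iff.mp hi this
    · ext i'
      rw [coeff_tCoeff, coeff_zero]
      by_cases hi' : i' ∈ U.support
      · refine coeff_eq_zero_of_natDegree_lt (lt_of_le_of_lt ?_ hj)
        rw [← hsup]
        exact Finset.le_sup (f := fun i => (U.coeff i).natDegree) hi'
      · rw [notMem_support_iff.mp hi', coeff_zero]
  have hth : ∀ j F n, tCoeff n (d.generic.theta j F) = d.theta j (tCoeff n F) := by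
    intro j F n
    have : d.generic.theta j F = d.base.map C * derivative F
        - (d.logDen + j * derivative d.base).map C * F := by
      rw [theta_apply, generic_base, generic_logDen]
      simp [derivative_map]
    rw [this, tCoeff_sub, tCoeff_map_mul, tCoeff_map_mul, tCoeff_derivative, theta_apply]
  -- Multiplication by `μ` makes room for a second coefficient also if `U` does not depend on `μ`.
  set V := C X * U with hV
  have hVs : d.generic.symOp V = 0 := by rw [hV, ← smul_eq_C_mul, map_smul, hU, smul_zero]
  have hVm : tCoeff (m + 1) V = tCoeff m U := tCoeff_C_X_mul _ _
  have hVj : ∀ j, m + 1 < j → tCoeff j V = 0 := fun j hj => by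
    obtain ⟨j, rfl⟩ : ∃ i, j = i + 1 := ⟨j - 1, by omega⟩
    rw [hV, tCoeff_C_X_mul]; exact hm _ (by omega)
  have hdec : d.generic.symOp V = ((4 * d.chat).map C * d.generic.theta 2 (d.generic.theta 1
        (d.generic.theta 0 V))
      + (6 * derivative d.chat * d.base).map C * d.generic.theta 1 (d.generic.theta 0 V)
      + (2 * derivative (derivative d.chat) * d.base ^ 2 - 4 * W).map C * d.generic.theta 0 V
      + (-2 * (d.base * derivative W - 2 * derivative d.base * W)).map C * V)
      + C X * ((-4 * d.pot₁).map C * d.generic.theta 0 V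
        + (-8 * C (d.chat.eval d.b) * d.base * d.chat ^ 2).map C * V)
      + C X * (C X * ((-16 * C (d.chat.eval d.b) * d.base ^ 2).map C * d.generic.theta 0 V)) := by
    have hd0 : derivative d.base = d.chat + (X - C d.b) * derivative d.chat := by
      rw [base, derivative_mul, derivative_X_sub_C, one_mul]
    have hp1 : d.base * derivative d.pot₁ - 2 * derivative d.base * d.pot₁ =
        4 * C (d.chat.eval d.b) * d.base * d.chat ^ 2 := by
      rw [pot₁, derivative_sub, derivative_neg, hd0]
      simp only [derivative_mul, derivative_C, pow_two, hd0, derivative_X_sub_C]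
      rw [base, C_mul, show (C 4 : D[X]) = 4 from rfl]
      ring
    have hp1' := congrArg (Polynomial.map (C : D →+* D[X])) hp1
    rw [symOp_apply, generic_chat, generic_base, hW]
    simp only [derivative_add, derivative_mul, derivative_map, derivative_C, derivative_X,
      Polynomial.map_add, Polynomial.map_sub, Polynomial.map_mul, Polynomial.map_pow,
      Polynomial.map_neg, Polynomial.map_ofNat, map_C, pow_two, C_mul] at hp1' ⊢
    rw [show (C (C 4) : D[X][X]) = 4 from rfl]
    linear_combination (-2 * C X * V) * hp1'
  -- the coefficient of `μ ^ (m + 3)` of the equation for `V`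
  have htop : d.theta 0 (tCoeff m U) = 0 := by
    have := congrArg (tCoeff (m + 3)) (hdec.symm.trans hVs)
    simp only [tCoeff_add, tCoeff_C_X_mul, tCoeff_map_mul, hth, tCoeff_zero,
      hVj (m + 3) (by omega), hVj (m + 2) (by omega), map_zero, mul_zero, add_zero, zero_add,
      hVm] at this
    rcases mul_eq_zero.mp this with h | h
    · exfalso
      refine mul_ne_zero (mul_ne_zero ?_ (C_ne_zero.mpr hc)) (pow_ne_zero 2 hb.ne_zero) h
      norm_num
    · exact h
  obtain ⟨u, hu⟩ := eq_C_mul_den_of_theta htop hb hd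
  have hu0 : u ≠ 0 := by rintro rfl; simp [hu] at hm0
  have hev : ∀ (F : D[X][X]) (p : D) (j : ℕ),
      (F.eval (C p)).coeff j = (tCoeff j F).eval p := by
    intro F p j
    induction F using Polynomial.induction_on' with
    | add F G hF hG => rw [eval_add, coeff_add, hF, hG, tCoeff_add, eval_add]
    | monomial n a =>
      have : tCoeff j (monomial n a) = monomial n (a.coeff j) := by
        ext i
        rw [coeff_tCoeff, coeff_monomial, coeff_monomial]
        split_ifs <;> simp
      rw [this, eval_monomial, eval_monomial, ← C_pow, coeff_mul_C]
  -- the coefficient of `μ ^ (m + 2)`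
  have hsec : 2 * d.theta 0 (tCoeff m V) = -(C u * d.chat * d.gauge) := by
    have := congrArg (tCoeff (m + 2)) (hdec.symm.trans hVs)
    simp only [tCoeff_add, tCoeff_C_X_mul, tCoeff_map_mul, hth, tCoeff_zero,
      hVj (m + 2) (by omega), map_zero, mul_zero, add_zero, zero_add, hVm, htop] at this
    have hne : (8 * C (d.chat.eval d.b) * d.base * d.base : D[X]) ≠ 0 :=
      mul_ne_zero (mul_ne_zero (mul_ne_zero (by norm_num) (C_ne_zero.mpr hc)) hb.ne_zero)
        hb.ne_zero
    apply mul_left_cancel₀ hne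
    rw [hu] at this
    rw [den] at this
    rw [base] at this ⊢
    linear_combination (-1 : D[X]) * this
  constructor
  · -- At `b`, where `base` vanishes, `hsec` determines the value of the second coefficient.
    intro h0
    have h1 : (V.eval (C d.b)).coeff m = 0 := by
      rw [hV, eval_mul, h0, mul_zero, coeff_zero]
    rw [hev] at h1
    have h2 := congrArg (eval d.b) hsec
    have e1 : d.base.eval d.b = 0 := by simp [base]
    simp only [theta_apply, eval_mul, eval_sub, eval_add, eval_neg, eval_C, h1, e1] at h2
    have : u * d.chat.eval d.b * d.gauge.eval d.b = 0 := by
      linear_combination h2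
    exact mul_ne_zero (mul_ne_zero hu0 hc) hg this
  · -- Only the term `pot * U ^ 2` of the first integral contributes to the power `2 * m + 2` of `μ`.
    intro h0
    have hne : tCoeff m U * d.base ≠ 0 := mul_ne_zero hm0 hb.ne_zero
    obtain ⟨p, hp⟩ : ∃ p, (tCoeff m U * d.base).eval p ≠ 0 := by
      by_contra! hcon
      exact hne (Polynomial.funext fun p => by rw [hcon, eval_zero])
    rw [eval_mul] at hp
    have lead : ∀ {F : D[X][X]} {n : ℕ}, (∀ j, n < j → tCoeff j F = 0) →
        Leads (F.eval (C p)) n ((tCoeff n F).eval p) := by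
      intro F n h
      refine ⟨natDegree_le_iff_coeff_eq_zero.mpr fun j hj => ?_, hev _ _ _⟩
      rw [hev, h j hj, eval_zero]
    have lU := lead hm
    have lmap : ∀ G : D[X], Leads ((G.map C).eval (C p)) 0 (G.eval p) := fun G => by
      rw [eval_map, eval₂_hom]; exact Leads.C _
    have l0 := lead (F := d.generic.theta 0 U) (n := m) fun j hj => by
      rw [hth, hm j hj, map_zero]
    have l1 := lead (F := d.generic.theta 1 (d.generic.theta 0 U)) (n := m) fun j hj => by
      rw [hth, hth, hm j hj, map_zero, map_zero]
    rw [hth, htop, eval_zero] at l0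
    have lX : Leads (X : D[X]) 1 1 := ⟨natDegree_X_le, coeff_X_one⟩
    have lp : Leads (d.generic.pot.eval (C p)) 2 (4 * d.chat.eval d.b * d.base.eval p ^ 2) := by
      rw [hW]
      simp only [eval_add, eval_mul, eval_C]
      have a0 : Leads (eval (C p) (Polynomial.map C W)) 2 0 :=
        Leads.of_lt ((lmap W).1.trans_lt (by norm_num))
      have a1 : Leads (X * eval (C p) (Polynomial.map C d.pot₁)) 2 0 :=
        Leads.of_lt ((lX.mul (lmap d.pot₁)).1.trans_lt (by norm_num))
      exact ((a0.add a1).add (lX.mul (lX.mul (lmap _)))).congr rfl (by simp)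
    have := congrArg (eval (C p)) h0
    rw [quad, generic_chat, generic_base, eval_zero] at this
    simp only [eval_add, eval_sub, eval_mul, eval_pow, eval_neg, derivative_map,
      eval_ofNat] at this
    have k1 := (lp.mul (lU.pow 2)).congr (m := 2 * m + 2) (by ring) rfl
    have k2 : Leads (2 * eval (C p) (Polynomial.map C d.chat) * eval (C p) U *
        eval (C p) (d.generic.theta 1 (d.generic.theta 0 U))) (2 * m + 2) 0 := by
      apply Leads.of_lt
      have := ((((lmap d.chat).ofNat_mul 2).mul lU).mul l1).1
      refine lt_of_le_of_lt this (by omega)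
    have k3 : Leads (eval (C p) (Polynomial.map C (derivative d.chat)) *
        eval (C p) (Polynomial.map C d.base) * eval (C p) U *
        eval (C p) (d.generic.theta 0 U)) (2 * m + 2) 0 := by
      apply Leads.of_lt
      exact lt_of_le_of_lt ((((lmap _).mul (lmap _)).mul lU).mul l0).1 (by omega)
    have k4 : Leads (eval (C p) (Polynomial.map C d.chat) *
        eval (C p) (d.generic.theta 0 U) ^ 2) (2 * m + 2) 0 := by
      apply Leads.of_lt
      exact lt_of_le_of_lt ((lmap _).mul (l0.pow 2)).1 (by omega)
    have k := ((k2.add k3).sub k4).sub k1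
    have hz : (2 * eval (C p) (Polynomial.map C d.chat) * eval (C p) U *
        eval (C p) (d.generic.theta 1 (d.generic.theta 0 U)) +
        eval (C p) (Polynomial.map C (derivative d.chat)) *
        eval (C p) (Polynomial.map C d.base) * eval (C p) U *
        eval (C p) (d.generic.theta 0 U) - eval (C p) (Polynomial.map C d.chat) *
        eval (C p) (d.generic.theta 0 U) ^ 2
        - eval (C p) d.generic.pot * eval (C p) U ^ 2) = 0 := by
      linear_combination this
    have hk := k.2
    rw [hz, coeff_zero] at hk
    have : 4 * d.chat.eval d.b * ((tCoeff m U).eval p * d.base.eval p) ^ 2 = 0 := by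
      linear_combination hk
    refine mul_ne_zero (mul_ne_zero (by norm_num) hc) (pow_ne_zero 2 hp) this

end
end Lead

end Params
end HKAnsatz

namespace HKAnsatz
open Polynomial
namespace Params

/-! ### The line attached to a solution -/

section Ring
variable {A : Type*} [CommRing A]

lemma Leads.X_mul_derivative {F : A[X]} {n : ℕ} {x : A} (hF : Leads F n x) :
    Leads (X * Polynomial.derivative F) n (n * x) := by
  constructor
  · rw [natDegree_le_iff_coeff_eq_zero]
    intro j hj
    obtain ⟨j, rfl⟩ : ∃ i, j = i + 1 := ⟨j - 1, by omega⟩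
    rw [coeff_X_mul, coeff_derivative, coeff_eq_zero_of_natDegree_lt (hF.1.trans_lt hj), zero_mul]
  · cases n with
    | zero => simp
    | succ n => rw [coeff_X_mul, coeff_derivative, hF.2]; push_cast; ring

lemma Leads.of_X_sq_mul [Nontrivial A] {F : A[X]} {n : ℕ} {x : A}
    (hF : Leads (X ^ 2 * F) (n + 2) x) : Leads F n x := by
  constructor
  · rw [natDegree_le_iff_coeff_eq_zero]
    intro j hj
    rw [← coeff_X_pow_mul F 2 j]
    exact coeff_eq_zero_of_natDegree_lt (hF.1.trans_lt (by omega))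
  · rw [← hF.2, coeff_X_pow_mul]

lemma Leads.congr' {F G : A[X]} {n : ℕ} {x : A} (hF : Leads F n x) (h : G = F) : Leads G n x :=
  h ▸ hF

/-- The numerator of the logarithmic derivative of `(P + c y R / h) / (P - c y R / h)` for `y ^ 2 =
4 h g` and a constant `c`, up to a factor `c / y`. -/
noncomputable def wnum (h g P R : A[X]) : A[X] :=
  2 * (h * derivative g - derivative h * g) * P * R
    + 4 * h * g * (P * derivative R - derivative P * R)

end Ring

variable {k : Type*} [Field k] [CharZero k]

/-- On the curve `y ^ 2 = 4 h g`, where `h * g` is a cubic, the zeros of `U` together with the signs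
of `y` given by `hdvd` form a divisor, which is linearly equivalent to a multiple of the point at
infinity up to a single point. So there is a function on the curve, with coefficients `P` and `R`,
whose norm is `U` times a linear factor with root the abscissa of that point. The linear factor is
kept in homogeneous form, as the point may be at infinity, where `ν₁ = 0`. The second identity
compares the logarithmic derivative of the function with that of the solution of the linear
equation, and the last clause says that the root of the linear factor carries a point of the curve.
-/
theorem exists_line_data {U M h g : k[X]} {Q : k} {n dh dg p r : ℕ} (hUn : U.natDegree = n)
    (hU0 : U ≠ 0)
    (hMn : M.natDegree ≤ n) (hsq : Squarefree U) (hcop : IsCoprime U M)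
    (hdvd : U ∣ h * g * derivative U ^ 2 + C Q * M ^ 2) (hQ : Q ≠ 0)
    (hh : Leads h dh 1) (hg : Leads g dg 1) (hdeg : dh + dg = 3) (hpr : p + r = n)
    (hpar : (2 * p + dh = n + 1 ∧ dg + 2 * r = n + 2) ∨ (2 * p + dh = n ∧ dg + 2 * r = n + 3)) :
    ∃ (P R : k[X]) (ν₁ ν₀ x₁ x₀ : k), (ν₁ ≠ 0 ∨ ν₀ ≠ 0) ∧
      h * P ^ 2 + 4 * g * C Q * R ^ 2 = U * (C ν₁ * X + C ν₀) ∧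
      M * (C ν₁ * X + C ν₀) - wnum h g P R = U * (C x₁ * X + C x₀) ∧
      (ν₁ = 0 → x₁ = 0) ∧
      (∀ a, ν₁ * a + ν₀ = 0 → (h * g).eval a * ν₁ ^ 2 = - Q * (x₁ * a + x₀) ^ 2) := by
  have hlU : U.leadingCoeff ≠ 0 := leadingCoeff_ne_zero.mpr hU0
  have hn1 : h ≠ 0 := by rintro rfl; simpa using hh.2
  have hn2 : g ≠ 0 := by rintro rfl; simpa using hg.2
  have dh' : h.natDegree = dh := natDegree_eq_of_le_of_coeff_ne_zero hh.1 (by rw [hh.2]; simp)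
  have dg' : g.natDegree = dg := natDegree_eq_of_le_of_coeff_ne_zero hg.1 (by rw [hg.2]; simp)
  -- a nonzero pair `(P, R)` by counting dimensions
  obtain ⟨P, R, hP, hR, hPR0, S, hS⟩ : ∃ P R : k[X], P ∈ degreeLT k (p + 1) ∧ R ∈ degreeLT k r ∧
      (P ≠ 0 ∨ R ≠ 0) ∧ U ∣ M * P + 2 * g * derivative U * R := by
    set m := C U.leadingCoeff⁻¹ * U with hm
    have hmon : m.Monic := by rw [hm, mul_comm]; exact monic_mul_leadingCoeff_inv hU0
    have hmd : m.natDegree = n := by rw [hm, natDegree_C_mul (inv_ne_zero hlU), hUn]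
    have hmem : ∀ F : k[X], F %ₘ m ∈ degreeLT k n := fun F => by
      rw [mem_degreeLT, ← hmd, ← degree_eq_natDegree hmon.ne_zero]
      exact degree_modByMonic_lt _ hmon
    let φ : degreeLT k (p + 1) × degreeLT k r →ₗ[k] degreeLT k n :=
      LinearMap.codRestrict _ (modByMonicHom m ∘ₗ
        ((LinearMap.mulLeft k M ∘ₗ (degreeLT k (p + 1)).subtype).coprod
          (LinearMap.mulLeft k (2 * g * derivative U) ∘ₗ (degreeLT k r).subtype)))
        fun x => hmem _
    have hker : LinearMap.ker φ ≠ ⊥ := by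
      apply LinearMap.ker_ne_bot_of_finrank_lt
      rw [Module.finrank_prod, finrank_degreeLT, finrank_degreeLT, finrank_degreeLT]
      omega
    obtain ⟨⟨P, R⟩, hx, hne⟩ := Submodule.exists_mem_ne_zero_of_ne_bot hker
    refine ⟨P, R, P.2, R.2, ?_, ?_⟩
    · by_contra! hcon
      exact hne (Prod.ext (Subtype.ext hcon.1) (Subtype.ext hcon.2))
    · have h1 : (M * (P : k[X]) + 2 * g * derivative U * (R : k[X])) %ₘ m = 0 :=
        congrArg Subtype.val (LinearMap.mem_ker.mp hx)
      exact (Dvd.intro_left (C U.leadingCoeff⁻¹) rfl : U ∣ m).trans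
        ((modByMonic_eq_zero_iff_dvd hmon).mp h1)
  obtain ⟨T, hT⟩ := hdvd
  -- Leading coefficients. The factors `X ^ 2` and `X` give `R` the formal degree `r - 1` also for
  -- `r = 0`. The two summands of the norm `N` have degrees of different parity, so they cannot
  -- cancel.
  have lP : Leads P p (P.coeff p) := by
    refine ⟨natDegree_le_iff_coeff_eq_zero.mpr fun j hj => ?_, rfl⟩
    exact coeff_eq_zero_of_degree_lt ((mem_degreeLT.mp hP).trans_le (by exact_mod_cast hj))
  have lR : Leads (X * R) r ((X * R).coeff r) := by
    refine ⟨natDegree_le_iff_coeff_eq_zero.mpr fun j hj => ?_, rfl⟩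
    obtain ⟨j, rfl⟩ : ∃ i, j = i + 1 := ⟨j - 1, by omega⟩
    rw [coeff_X_mul]
    exact coeff_eq_zero_of_degree_lt ((mem_degreeLT.mp hR).trans_le
      (by exact_mod_cast (by omega : r ≤ j)))
  set α := P.coeff p with hα
  set β := (X * R).coeff r with hβ
  have lX2 : Leads (X ^ 2 : k[X]) 2 1 := ⟨natDegree_X_pow_le 2, by simp⟩
  set N := h * P ^ 2 + 4 * g * C Q * R ^ 2 with hN
  have lN1 : Leads (X ^ 2 * (h * P ^ 2)) (2 * p + dh + 2) (α ^ 2) :=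
    (lX2.mul (hh.mul (lP.pow 2))).congr (by ring) (by ring)
  have lN2 : Leads (4 * g * C Q * (X * R) ^ 2) (dg + 2 * r) (4 * Q * β ^ 2) :=
    (((hg.ofNat_mul 4).mul (Leads.C Q)).mul (lR.pow 2)).congr (by ring) (by ring)
  obtain ⟨γ, lN, hγ⟩ : ∃ γ, Leads N (n + 1) γ ∧ (γ = 0 → α = 0 ∨ β = 0) := by
    rcases hpar with ⟨h1, h2⟩ | ⟨h1, h2⟩
    · refine ⟨α ^ 2, Leads.of_X_sq_mul ((((lN1.congr (m := n + 3) (by omega) rfl).add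
        (Leads.of_lt (n := n + 3) (lN2.1.trans_lt (by omega)))).congr rfl (add_zero _)).congr' ?_),
        ?_⟩
      · rw [hN]; ring
      · intro h; left; simpa using h
    · refine ⟨4 * Q * β ^ 2, Leads.of_X_sq_mul ((((lN2.congr (m := n + 3) (by omega) rfl).add
        (Leads.of_lt (n := n + 3) (lN1.1.trans_lt (by omega)))).congr rfl (add_zero _)).congr' ?_),
        ?_⟩
      · rw [hN]; ring
      · intro h; right; simpa [hQ] using h
  obtain ⟨ω, lW⟩ : ∃ ω, Leads (wnum h g P R) (n + 1) (ω * (α * β)) := by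
    have l1 := ((((hh.mul hg.X_mul_derivative).congr (m := 3) hdeg rfl).sub
      ((hh.X_mul_derivative.mul hg).congr (m := 3) hdeg rfl)).ofNat_mul 2).mul (lP.mul lR)
    have l2 := ((hh.mul hg).ofNat_mul 4).mul (((lP.mul (lR.X_mul_derivative.sub lR)).sub
      (lP.X_mul_derivative.mul lR)))
    refine ⟨2 * (dg - dh) + 4 * (r - 1 - p), Leads.of_X_sq_mul ((((l1.congr (m := n + 3)
      (by omega) rfl).add (l2.congr (m := n + 3) (by omega) rfl)).congr rfl ?_).congr' ?_)⟩
    · ring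
    · rw [wnum, derivative_mul, derivative_X]; ring
  -- `U` divides the norm.
  have hUN : U ∣ N := by
    refine (hcop.pow_right (n := 2)).dvd_of_dvd_mul_left ?_
    refine ⟨4 * g * R ^ 2 * T + h * (M * P - 2 * g * derivative U * R) * S, ?_⟩
    rw [hN]
    linear_combination 4 * g * R ^ 2 * hT + h * (M * P - 2 * g * derivative U * R) * hS
  obtain ⟨V, hV⟩ := hUN
  have hN0 : N ≠ 0 := by
    intro h0
    have e1 : h * P ^ 2 = -(C (4 * Q) * (g * R ^ 2)) := by
      rw [C_mul, show (C 4 : k[X]) = 4 from rfl]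
      linear_combination h0
    have hiff : P = 0 ↔ R = 0 := by
      constructor
      · rintro rfl
        simpa [hn2, hQ] using e1
      · rintro rfl
        simpa [hn1] using e1
    have hP0 : P ≠ 0 := by
      rcases hPR0 with h | h
      · exact h
      · exact mt hiff.mp h
    have hR0 : R ≠ 0 := mt hiff.mpr hP0
    have := congrArg natDegree e1
    rw [natDegree_neg, natDegree_C_mul (mul_ne_zero (by norm_num) hQ),
      natDegree_mul hn1 (pow_ne_zero _ hP0), natDegree_mul hn2 (pow_ne_zero _ hR0), natDegree_pow,
      natDegree_pow, dh', dg'] at this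
    omega
  have hV0 : V ≠ 0 := by rintro rfl; exact hN0 (by rw [hV, mul_zero])
  -- A multiple of `U` of degree at most `n + 1` has a linear cofactor.
  have hlin : ∀ {F V : k[X]}, F.natDegree ≤ n + 1 → F = U * V → ∃ a b, V = C a * X + C b := by
    intro F V hF hV
    by_cases hV0 : V = 0
    · exact ⟨0, 0, by simp [hV0]⟩
    apply exists_eq_X_add_C_of_natDegree_le_one
    have := natDegree_mul hU0 hV0
    rw [← hV] at this
    omega
  obtain ⟨ν₁, ν₀, hν⟩ := hlin lN.1 hV
  set W := wnum h g P R with hW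
  set Y := M * V - W with hY
  have hdN : derivative N = derivative h * P ^ 2 + 2 * h * P * derivative P
      + 4 * derivative g * C Q * R ^ 2 + 8 * g * C Q * R * derivative R := by
    rw [hN]
    simp only [derivative_add, derivative_mul, derivative_C, pow_two, derivative_ofNat]
    ring
  have hdN' : derivative N = derivative U * V + U * derivative V := by rw [hV, derivative_mul]
  have hPY : P * Y = U * (V * S + 2 * g * R * derivative V
      - (2 * derivative g * R + 4 * g * derivative R) * V) := by
    rw [hY, hW, wnum]
    linear_combination V * hS + 2 * g * R * (hdN.symm.trans hdN')
      - (2 * derivative g * R + 4 * g * derivative R) * (hN.symm.trans hV)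
  -- the companion congruence
  obtain ⟨S', hS'⟩ : U ∣ 2 * C Q * M * R - h * derivative U * P := by
    refine hcop.dvd_of_dvd_mul_left ⟨2 * R * T - h * derivative U * S, ?_⟩
    linear_combination 2 * R * hT - h * derivative U * hS
  have hRY : 2 * C Q * R * Y = U * (V * S' - h * P * derivative V
      + (derivative h * P + 2 * h * derivative P) * V) := by
    rw [hY, hW, wnum]
    linear_combination V * hS' - h * P * (hdN.symm.trans hdN')
      + (derivative h * P + 2 * h * derivative P) * (hN.symm.trans hV)
  -- As `U` is squarefree it suffices that `U` divides `Y ^ 3`, and `V * Y` is a combination of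
  -- `P * Y` and `R * Y`.
  have hUY : U ∣ Y := by
    rw [← hsq.dvd_pow_iff_dvd (n := 3) three_ne_zero]
    set a₁ := V * S + 2 * g * R * derivative V - (2 * derivative g * R + 4 * g * derivative R) * V
    set a₂ := V * S' - h * P * derivative V + (derivative h * P + 2 * h * derivative P) * V
    have hVY : V * Y = h * P * a₁ + 2 * g * R * a₂ := by
      apply mul_left_cancel₀ hU0
      linear_combination (-Y) * (hN.symm.trans hV) + h * P * hPY + 2 * g * R * hRY
    have hCQ : C Q⁻¹ * C Q = (1 : k[X]) := by rw [← C_mul, inv_mul_cancel₀ hQ, C_1]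
    have hRY' : 2 * (R * Y) = U * (C Q⁻¹ * a₂) := by
      linear_combination C Q⁻¹ * hRY - 2 * R * Y * hCQ
    have hWY : U ∣ W * Y := by
      refine ⟨(2 * (h * derivative g - derivative h * g) * R + 4 * h * g * derivative R) * a₁
        - 2 * h * g * derivative P * (C Q⁻¹ * a₂), ?_⟩
      rw [hW, wnum]
      linear_combination (2 * (h * derivative g - derivative h * g) * R + 4 * h * g * derivative R)
        * hPY - 2 * h * g * derivative P * hRY'
    obtain ⟨w, hw⟩ := hWY
    refine ⟨M * (h * a₁ * a₁ + g * a₂ * (C Q⁻¹ * a₂)) - w * Y, ?_⟩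
    have : V * Y * Y = U * (h * a₁ * a₁ + g * a₂ * (C Q⁻¹ * a₂)) := by
      rw [hVY]; linear_combination h * a₁ * hPY + g * a₂ * hRY'
    have hYY : Y ^ 3 = M * (V * Y * Y) - W * Y * Y := by rw [hY]; ring
    rw [hYY, this, hw]; ring
  obtain ⟨V', hV'⟩ := hUY
  have hVd : V.natDegree ≤ 1 := by
    rw [hν]; exact natDegree_linear_le
  obtain ⟨x₁, x₀, hx⟩ := hlin (F := Y) (by
    refine (natDegree_sub_le _ _).trans (max_le ?_ lW.1)
    exact natDegree_mul_le.trans (Nat.add_le_add hMn hVd)) hV'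
  refine ⟨P, R, ν₁, ν₀, x₁, x₀, ?_, by rw [← hν]; exact hV, by rw [← hν, ← hx]; exact hV', ?_, ?_⟩
  · by_contra! hcon
    apply hV0
    rw [hν, hcon.1, hcon.2]; simp
  · intro h0
    have lUV : ∀ a b : k, Leads (U * (C a * X + C b)) (n + 1) (U.leadingCoeff * a) := fun a b =>
      (Leads.mul (y := a) ⟨hUn.le, by rw [← hUn, coeff_natDegree]⟩
        ⟨natDegree_linear_le, by simp⟩)
    have hγ0 : γ = 0 := by
      rw [← lN.2, hV, hν, (lUV _ _).2, h0, mul_zero]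
    have hαβ : α * β = 0 := by
      rcases hγ hγ0 with h | h <;> simp [h]
    have e1 : Y.coeff (n + 1) = U.leadingCoeff * x₁ := by rw [hV', hx, (lUV _ _).2]
    have e2 : Y.coeff (n + 1) = 0 := by
      rw [hY, coeff_sub, lW.2, hαβ, mul_zero, sub_zero, hν, h0, C_0, zero_mul, zero_add]
      refine coeff_eq_zero_of_natDegree_lt ?_
      exact (natDegree_mul_le.trans (by simpa using hMn)).trans_lt (Nat.lt_succ_self n)
    rw [e1] at e2
    simpa [hlU] using e2
  · intro a ha
    have hVa : V.eval a = 0 := by rw [hν]; simpa using ha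
    have hV'a : V'.eval a = x₁ * a + x₀ := by rw [hx]; simp
    have hdVa : (derivative V).eval a = ν₁ := by rw [hν]; simp
    rw [← hV'a]
    -- the two congruences, divided by `U`
    have e1 : P * V' = V * S + 2 * g * R * derivative V
        - (2 * derivative g * R + 4 * g * derivative R) * V := by
      apply mul_left_cancel₀ hU0
      rw [← hPY, hV']; ring
    have e2 : 2 * C Q * R * V' = V * S' - h * P * derivative V
        + (derivative h * P + 2 * h * derivative P) * V := by
      apply mul_left_cancel₀ hU0
      rw [← hRY, hV']; ring
    have f1 := congrArg (eval a) e1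
    have f2 := congrArg (eval a) e2
    simp only [eval_add, eval_sub, eval_mul, eval_C, eval_ofNat, hVa, hdVa, zero_mul, mul_zero,
      zero_add, sub_zero, zero_sub, add_zero] at f1 f2
    rw [eval_mul]
    -- At most one of `f1` and `f2` is trivial unless `P` and `R` both vanish at `a`; in that case
    -- `a` is a zero of `U`, and the relation follows from the first integral there.
    by_cases hPa : P.eval a = 0
    · by_cases hRa : R.eval a = 0
      · obtain ⟨P', rfl⟩ : (X - C a) ∣ P := dvd_iff_isRoot.mpr hPa
        obtain ⟨R', rfl⟩ : (X - C a) ∣ R := dvd_iff_isRoot.mpr hRa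
        by_cases h1 : ν₁ = 0
        · have : ν₀ = 0 := by rw [h1] at ha; simpa using ha
          exact absurd (by rw [hν, h1, this]; simp) hV0
        have hVe : V = C ν₁ * (X - C a) := by
          have : ν₀ = -(ν₁ * a) := by linear_combination ha
          rw [hν, this, C_neg, C_mul]; ring
        have hX : X - C a ≠ 0 := X_sub_C_ne_zero a
        have g1 : (X - C a) * (h * P' ^ 2 + 4 * g * C Q * R' ^ 2) = U * C ν₁ := by
          apply mul_left_cancel₀ hX
          rw [hVe] at hV
          linear_combination (hN.symm.trans hV)
        have hUa : U.eval a = 0 := by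
          have := congrArg (eval a) g1
          simpa [h1] using this
        have hMa : M.eval a ≠ 0 := by
          obtain ⟨u, v, huv⟩ := hcop
          intro h0
          have := congrArg (eval a) huv
          simp [hUa, h0] at this
        have g2 : U * V' = (X - C a) * (M * C ν₁ - (X - C a) * wnum h g P' R') := by
          rw [← hV', hY, hW, hVe, wnum, wnum]
          simp only [derivative_mul, derivative_X_sub_C]
          ring
        have g3 := congrArg (eval a) (congrArg derivative g2)
        simp only [derivative_mul, derivative_sub, derivative_C, derivative_X, eval_add, eval_mul,
          eval_sub, eval_X, eval_C, hUa, sub_self, zero_mul, add_zero, eval_one,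
          one_mul, sub_zero] at g3
        have g4 := congrArg (eval a) hT
        simp only [eval_add, eval_mul, eval_pow, eval_C, hUa, zero_mul] at g4
        have hUd : (derivative U).eval a ≠ 0 := by
          intro h0
          rw [h0] at g4
          have : Q * M.eval a ^ 2 = 0 := by linear_combination g4
          exact mul_ne_zero hQ (pow_ne_zero 2 hMa) this
        apply mul_left_cancel₀ (pow_ne_zero 2 hUd)
        linear_combination ν₁ ^ 2 * g4
          + Q * ((derivative U).eval a * V'.eval a + M.eval a * ν₁) * g3
      · apply mul_left_cancel₀ hRa
        linear_combination (ν₁ / 2 * h.eval a) * (-f1) + V'.eval a / 2 * f2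
    · apply mul_left_cancel₀ hPa
      linear_combination Q * V'.eval a * f1 + g.eval a * ν₁ * f2

end Params
end HKAnsatz

namespace HKAnsatz
open Polynomial
namespace Params

/-! ### Change of the base ring -/

section Map
variable {A B : Type*} [CommRing A] [CommRing B] (d : Params A) (φ : A →+* B)

noncomputable section

/-- The image of the parameters under a ring homomorphism. -/
def map : Params B where
  e i := φ (d.e i)
  b := φ d.b
  μ := φ d.μ
  l := d.l
  l₀ := d.l₀

@[simp] lemma map_e (i : Fin 3) : (d.map φ).e i = φ (d.e i) := rfl
@[simp] lemma map_b : (d.map φ).b = φ d.b := rfl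
@[simp] lemma map_μ : (d.map φ).μ = φ d.μ := rfl
@[simp] lemma map_l : (d.map φ).l = d.l := rfl
@[simp] lemma map_l₀ : (d.map φ).l₀ = d.l₀ := rfl
@[simp] lemma map_degDen : (d.map φ).degDen = d.degDen := rfl

lemma map_chat : (d.map φ).chat = d.chat.map φ := by
  simp [chat, Polynomial.map_prod]

lemma map_chatAt (i : Fin 3) : (d.map φ).chatAt i = (d.chatAt i).map φ := by
  simp [chatAt]

lemma map_base : (d.map φ).base = d.base.map φ := by
  simp [base, map_chat]

lemma map_gauge : (d.map φ).gauge = d.gauge.map φ := by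
  simp [gauge, Polynomial.map_prod]

lemma map_den : (d.map φ).den = d.den.map φ := by
  simp [den, map_gauge]

lemma map_logDen : (d.map φ).logDen = d.logDen.map φ := by
  simp [logDen, map_chat, Polynomial.map_sum]

lemma map_zden : (d.map φ).zden = d.zden.map φ := by
  simp [zden, map_den, map_base]

lemma map_pot : (d.map φ).pot = d.pot.map φ := by
  simp [pot, map_chat, Polynomial.map_sum, wConst, wRes, eTl, pApp, sTl, resH, C_ofNat,
    Polynomial.map_prod]

lemma map_theta (j : ℕ) (F : A[X]) : (d.map φ).theta j (F.map φ) = (d.theta j F).map φ := by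
  simp [theta_apply, map_base, map_logDen, derivative_map]

lemma map_symOp (F : A[X]) : (d.map φ).symOp (F.map φ) = (d.symOp F).map φ := by
  simp [symOp_apply, map_base, map_chat, map_pot, derivative_map, map_theta]

lemma map_quad (F : A[X]) : (d.map φ).quad (F.map φ) = (d.quad F).map φ := by
  simp [quad, map_base, map_chat, map_pot, derivative_map, map_theta]

lemma map_wnum (h g P R : A[X]) :
    wnum (h.map φ) (g.map φ) (P.map φ) (R.map φ) = (wnum h g P R).map φ := by
  simp [wnum, derivative_map]

lemma map_map {C : Type*} [CommRing C] (ψ : B →+* C) : (d.map φ).map ψ = d.map (ψ.comp φ) := rfl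

variable {d} in
lemma map_solution {φ : A →+* B} {U : A[X]} (hU : d.symOp U = 0) :
    (d.map φ).symOp (U.map φ) = 0 := by
  rw [map_symOp, hU, Polynomial.map_zero]

variable {d} in
lemma map_quad_eq {φ : A →+* B} {U : A[X]} {Q : A} (hU : d.quad U = C Q * d.zden) :
    (d.map φ).quad (U.map φ) = C (φ Q) * (d.map φ).zden := by
  rw [map_quad, hU, map_zden, Polynomial.map_mul, map_C]

/-! ### The universal solution -/

/-- The parameters with the `e_i` fixed and `b`, `μ` variable: `b` is the inner and `μ` the outer
indeterminate. -/
def universal (e : Fin 3 → ℂ) (l : Fin 3 → ℕ) (l₀ : ℕ) : Params ℂ[X][X] :=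
  generic ⟨fun i => C (e i), X, 0, l, l₀⟩

/-- The square class of `gauge`: `none` stands for the class of `1`, and `some i` for that of
`z - e_i`, modulo the class of `chat`. -/
def sqPart (o : Option (Fin 3)) : A[X] := o.elim 1 fun i => X - C (d.e i)

/-- The complementary factor of `chat`. -/
def cosqPart (o : Option (Fin 3)) : A[X] := o.elim d.chat d.chatAt

lemma sqPart_mul (o : Option (Fin 3)) : d.sqPart o * d.cosqPart o = d.chat := by
  cases o with
  | none => simp [sqPart, cosqPart]
  | some i => exact (d.chat_eq i).symm

lemma map_sqPart (o : Option (Fin 3)) : (d.map φ).sqPart o = (d.sqPart o).map φ := by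
  cases o <;> simp [sqPart]

lemma map_cosqPart (o : Option (Fin 3)) : (d.map φ).cosqPart o = (d.cosqPart o).map φ := by
  cases o <;> simp [cosqPart, map_chat, map_chatAt]

end
end Map

/-- The line attached to a solution of the equation. The numbers `p` and `r` of free coefficients
are chosen according to the parity of the degree of `U`; in the last clause the root of the linear
factor is substituted, with denominators cleared. -/
lemma Regular.exists_line_data {k : Type*} [Field k] [CharZero k] {d : Params k} (hd : d.Regular)
    (o : Option (Fin 3)) {U : k[X]} {Q : k} (hU : d.symOp U = 0)
    (hUn : U.natDegree ≤ d.degDen + d.l₀) (hQ : d.quad U = C Q * d.zden) (hQ0 : Q ≠ 0)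
    (hb : U.eval d.b ≠ 0) :
    ∃ (P R : k[X]) (ν₁ ν₀ x₁ x₀ : k), (ν₁ ≠ 0 ∨ ν₀ ≠ 0) ∧
      d.sqPart o * P ^ 2 + 4 * d.cosqPart o * C Q * R ^ 2 = U * (C ν₁ * X + C ν₀) ∧
      d.den * (C ν₁ * X + C ν₀) - wnum (d.sqPart o) (d.cosqPart o) P R
        = U * (C x₁ * X + C x₀) ∧
      (ν₁ = 0 → x₁ = 0) ∧
      (ν₁ ≠ 0 → ν₁ * ∏ i, (ν₀ + d.e i * ν₁) = Q * (x₀ * ν₁ - x₁ * ν₀) ^ 2) := by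
  have hn := natDegree_eq_of_quad hU hQ hQ0 hUn
  have hc := hd.isCoprime_base hU hQ hQ0 hb
  have hM : d.den.natDegree ≤ d.degDen + d.l₀ := by rw [natDegree_den]; omega
  have hU0 : U ≠ 0 := by rintro rfl; simp at hb
  have hdvd : U ∣ d.sqPart o * d.cosqPart o * derivative U ^ 2 + C Q * d.den ^ 2 := by
    rw [sqPart_mul]; exact dvd_of_quad hQ hc
  have hdeg : ∃ dh dg p r, Leads (d.sqPart o) dh 1 ∧ Leads (d.cosqPart o) dg 1 ∧ dh + dg = 3 ∧
      p + r = d.degDen + d.l₀ ∧ ((2 * p + dh = d.degDen + d.l₀ + 1 ∧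
        dg + 2 * r = d.degDen + d.l₀ + 2) ∨ (2 * p + dh = d.degDen + d.l₀ ∧
        dg + 2 * r = d.degDen + d.l₀ + 3)) := by
    have hpos : 1 ≤ d.degDen := Nat.le_add_left _ _
    generalize d.degDen + d.l₀ = n at *
    cases o with
    | none =>
      refine ⟨0, 3, (n + 1) / 2, n / 2, Leads.C 1, d.leads_chat, rfl, by omega, by omega⟩
    | some i =>
      refine ⟨1, 2, n / 2, (n + 1) / 2, Leads.X_sub _, ?_, rfl, by omega, by omega⟩
      exact ((Leads.X_sub _).mul (Leads.X_sub _)).congr rfl (mul_one _)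
  obtain ⟨dh, dg, p, r, h1, h2, h3, h4, h5⟩ := hdeg
  obtain ⟨P, R, ν₁, ν₀, x₁, x₀, g0, g1, g2, g3, g4⟩ := Params.exists_line_data hn hU0 hM
    (squarefree_of_quad hQ hQ0 hc) (isCoprime_den hc) hdvd hQ0 h1 h2 h3 h4 h5
  refine ⟨P, R, ν₁, ν₀, x₁, x₀, g0, g1, g2, g3, fun hν => ?_⟩
  have := g4 (-ν₀ / ν₁) (by field_simp; ring)
  rw [sqPart_mul, chat, eval_prod, Fin.prod_univ_three] at this
  simp only [eval_sub, eval_X, eval_C] at this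
  rw [Fin.prod_univ_three]
  field_simp at this
  linear_combination (-1 : k) * this

open IsLocalization in
lemma exists_smul_eq_map {A : Type*} [CommRing A] [IsDomain A] (F : (FractionRing A)[X]) :
    ∃ c : A, c ≠ 0 ∧ ∃ G : A[X], G.map (algebraMap A (FractionRing A)) =
      C (algebraMap A (FractionRing A) c) * F := by
  obtain ⟨c, hcm, hc⟩ := integerNormalization_spec (nonZeroDivisors A) F
  refine ⟨c, nonZeroDivisors.ne_zero hcm, integerNormalization (nonZeroDivisors A) F, ?_⟩
  rw [hc, ← smul_eq_C_mul, algebraMap_smul]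

/-- The solution for variable `b` and `μ`, with its line. Both are constructed over the field of
rational functions, where `generic_solution` guarantees a nonzero first integral and a nonzero
value at `b`; then denominators are cleared. -/
theorem universal_line_data {e : Fin 3 → ℂ} (he : Function.Injective e) (hs : ∑ i, e i = 0)
    (l : Fin 3 → ℕ) (l₀ : ℕ) (o : Option (Fin 3)) {d : Params ℂ[X][X]}
    (hd : d = universal e l l₀) :
    ∃ (U P R : ℂ[X][X][X]) (Q ν₁ ν₀ x₁ x₀ : ℂ[X][X]),
      d.symOp U = 0 ∧ U.natDegree ≤ d.degDen + l₀ ∧ d.quad U = C Q * d.zden ∧ Q ≠ 0 ∧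
      U.eval d.b ≠ 0 ∧ (ν₁ ≠ 0 ∨ ν₀ ≠ 0) ∧
      d.sqPart o * P ^ 2 + 4 * d.cosqPart o * C Q * R ^ 2 = U * (C ν₁ * X + C ν₀) ∧
      d.den * (C ν₁ * X + C ν₀) - wnum (d.sqPart o) (d.cosqPart o) P R
        = U * (C x₁ * X + C x₀) ∧
      (ν₁ = 0 → x₁ = 0) ∧
      (ν₁ ≠ 0 → ν₁ * ∏ i, (ν₀ + d.e i * ν₁) = Q * (x₀ * ν₁ - x₁ * ν₀) ^ 2) := by
  have hXC : ∀ i, (X - C (e i) : ℂ[X]) ≠ 0 := fun i => X_sub_C_ne_zero _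
  set φ := algebraMap ℂ[X][X] (FractionRing ℂ[X][X]) with hφ
  have hinj : Function.Injective φ := IsFractionRing.injective _ _
  have hreg : (d.map φ).Regular := by
    subst hd
    refine ⟨fun i j h => ?_, fun i h => ?_, ?_⟩
    · exact he (C_injective (C_injective (hinj h)))
    · have : (X : ℂ[X]) = C (e i) := C_injective (hinj h)
      exact hXC i (sub_eq_zero.mpr this)
    · have : ∑ i, (universal e l l₀).e i = 0 := by
        change ∑ i, C (C (e i)) = 0
        rw [← map_sum, ← map_sum, hs, map_zero, map_zero]
      simp_rw [map_e, ← map_sum, this, map_zero]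
  obtain ⟨U', hU0', hUn', hU'⟩ := hreg.exists_solution
  obtain ⟨c, hc, U, hU⟩ := exists_smul_eq_map U'
  have hc' : φ c ≠ 0 := (map_ne_zero_iff φ hinj).mpr hc
  have hUs : d.symOp U = 0 := by
    apply map_injective φ hinj
    rw [← map_symOp, hU, ← smul_eq_C_mul, map_smul, hU', smul_zero, Polynomial.map_zero]
  have hUd : U.natDegree ≤ d.degDen + l₀ := by
    rw [← natDegree_map_eq_of_injective hinj, hU, natDegree_C_mul hc']
    subst hd; exact hUn'
  have hU0 : U ≠ 0 := by
    rintro rfl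
    rw [Polynomial.map_zero, eq_comm, mul_eq_zero, C_eq_zero] at hU
    exact hU.elim hc' hU0'
  obtain ⟨Q, hQ⟩ := exists_quad_eq hUs
  obtain ⟨hUb, hq⟩ : U.eval d.b ≠ 0 ∧ d.quad U ≠ 0 := by
    subst hd
    refine generic_solution ?_ ?_ (monic_base _) (monic_den _) hU0 hUs
    · rw [chat, eval_prod, Finset.prod_ne_zero_iff]
      intro i _; simpa using hXC i
    · rw [gauge, eval_prod, Finset.prod_ne_zero_iff]
      intro i _; simpa using pow_ne_zero _ (hXC i)
  have hQ0 : Q ≠ 0 := by rintro rfl; exact hq (by rw [hQ, C_0, zero_mul])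
  obtain ⟨P, R, ν₁, ν₀, x₁, x₀, g0, g1, g2, g3, g4⟩ := hreg.exists_line_data o
    (map_solution hUs) (by rw [natDegree_map_eq_of_injective hinj]; subst hd; exact hUd)
    (map_quad_eq hQ)
    ((map_ne_zero_iff φ hinj).mpr hQ0)
    (by rw [map_b, eval_map, eval₂_hom]; exact (map_ne_zero_iff φ hinj).mpr hUb)
  -- A common denominator. The auxiliary cubic collects the four coefficients of the linear factors.
  obtain ⟨c, hc, hcP, hcR, hc1, hc2, hc3, hc4⟩ : ∃ c : ℂ[X][X], c ≠ 0 ∧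
      (∃ P' : ℂ[X][X][X], P'.map φ = C (φ c) * P) ∧ (∃ R' : ℂ[X][X][X], R'.map φ = C (φ c) * R) ∧
      (∃ t, φ t = φ c * ν₁) ∧ (∃ t, φ t = φ c * ν₀) ∧ (∃ t, φ t = φ c * x₁) ∧
      (∃ t, φ t = φ c * x₀) := by
    obtain ⟨c1, h1, G1, e1⟩ := exists_smul_eq_map P
    obtain ⟨c2, h2, G2, e2⟩ := exists_smul_eq_map R
    obtain ⟨c3, h3, G3, e3⟩ := exists_smul_eq_map (C ν₁ * X ^ 3 + C ν₀ * X ^ 2 + C x₁ * X + C x₀)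
    have hcoef : ∀ i, φ (c1 * c2 * G3.coeff i) = φ (c1 * c2 * c3) *
        (C ν₁ * X ^ 3 + C ν₀ * X ^ 2 + C x₁ * X + C x₀).coeff i := by
      intro i
      have := congrArg (fun F => F.coeff i) e3
      simp only [coeff_map, coeff_C_mul] at this
      rw [map_mul, map_mul _ (c1 * c2) c3, this]; ring
    refine ⟨c1 * c2 * c3, mul_ne_zero (mul_ne_zero h1 h2) h3, ⟨C (c2 * c3) * G1, ?_⟩,
      ⟨C (c1 * c3) * G2, ?_⟩, ⟨_, (hcoef 3).trans ?_⟩, ⟨_, (hcoef 2).trans ?_⟩,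
      ⟨_, (hcoef 1).trans ?_⟩, ⟨_, (hcoef 0).trans ?_⟩⟩
    · rw [Polynomial.map_mul, map_C, e1]; simp only [map_mul]; ring
    · rw [Polynomial.map_mul, map_C, e2]; simp only [map_mul]; ring
    all_goals simp [coeff_X, coeff_C, coeff_X_pow]
  obtain ⟨P', hP'⟩ := hcP
  obtain ⟨R', hR'⟩ := hcR
  obtain ⟨t1, ht1⟩ := hc1
  obtain ⟨t2, ht2⟩ := hc2
  obtain ⟨t3, ht3⟩ := hc3
  obtain ⟨t4, ht4⟩ := hc4
  have hc' : φ c ≠ 0 := (map_ne_zero_iff φ hinj).mpr hc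
  -- `P` and `R` are multiplied by `c`, so the linear factors are multiplied by `c ^ 2`.
  have k1 : φ (c * t1) = φ c ^ 2 * ν₁ := by rw [map_mul, ht1]; ring
  have k2 : φ (c * t2) = φ c ^ 2 * ν₀ := by rw [map_mul, ht2]; ring
  have k3 : φ (c * t3) = φ c ^ 2 * x₁ := by rw [map_mul, ht3]; ring
  have k4 : φ (c * t4) = φ c ^ 2 * x₀ := by rw [map_mul, ht4]; ring
  have hc2 : φ c ^ 2 ≠ 0 := pow_ne_zero 2 hc'
  have hzero : ∀ {t ν}, φ t = φ c ^ 2 * ν → (t = 0 ↔ ν = 0) := fun {t ν} h => by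
    rw [← map_eq_zero_iff φ hinj, h, mul_eq_zero, or_iff_right hc2]
  refine ⟨U, P', R', Q, c * t1, c * t2, c * t3, c * t4, hUs, hUd, hQ, hQ0, hUb, ?_, ?_, ?_, ?_, ?_⟩
  · rwa [Ne, Ne, hzero k1, hzero k2]
  · apply map_injective φ hinj
    simp only [Polynomial.map_add, Polynomial.map_mul, Polynomial.map_pow, map_C, map_X, hP', hR',
      k1, k2, ← map_sqPart, ← map_cosqPart, Polynomial.map_ofNat]
    simp only [map_mul, map_pow]
    linear_combination C (φ c) ^ 2 * g1
  · apply map_injective φ hinj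
    simp only [Polynomial.map_add, Polynomial.map_sub, Polynomial.map_mul, Polynomial.map_pow,
      map_C, map_X, ← map_wnum, hP', hR', k1, k2, k3, k4, ← map_sqPart, ← map_cosqPart, ← map_den]
    simp only [map_mul, map_pow, wnum, derivative_mul, derivative_C, zero_mul, zero_add] at g2 ⊢
    linear_combination C (φ c) ^ 2 * g2
  · rw [hzero k1, hzero k3]; exact g3
  · rw [Ne, hzero k1]
    intro h
    apply hinj
    have := g4 h
    simp only [Fin.prod_univ_three, map_mul _ (c * t1), map_mul _ Q, map_add, map_sub, map_pow,
      k1, k2, k3, k4, map_mul _ (d.e _), map_mul _ (c * t4), map_mul _ (c * t3)] at this ⊢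
    rw [map_mul, map_mul]
    simp only [Fin.prod_univ_three, map_mul _ (c * t1), map_mul _ Q, map_add, map_sub, map_pow,
      k1, k2, k3, k4, map_mul _ (d.e _), map_mul _ (c * t4), map_mul _ (c * t3)]
    simp only [map_e] at this
    linear_combination φ c ^ 8 * this

end Params
end HKAnsatz

namespace HKAnsatz
open Filter Topology

/-! ### The Weierstrass sigma and zeta functions -/

section Sigma
variable (L : PeriodPair)

/-- The Weierstrass elementary factor `(1 - z / w) exp (z / w + z² / (2 w²))`. -/
noncomputable def sigmaFactor (w z : ℂ) : ℂ :=
  (1 - z / w) * Complex.exp (z / w + z ^ 2 / (2 * w ^ 2))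

lemma differentiable_sigmaFactor (w : ℂ) : Differentiable ℂ (sigmaFactor w) := by
  unfold sigmaFactor; fun_prop

/-- The derivative of `(1 - u) exp (u + u² / 2)` is `-u² exp (u + u² / 2)`, of second order at `0`.
-/
lemma norm_one_sub_mul_exp_sub_one_le {u : ℂ} (hu : ‖u‖ ≤ 1) :
    ‖(1 - u) * Complex.exp (u + u ^ 2 / 2) - 1‖ ≤ Real.exp 2 * ‖u‖ ^ 3 := by
  set f : ℂ → ℂ := fun u => (1 - u) * Complex.exp (u + u ^ 2 / 2) with hf
  have hd : ∀ x, HasDerivAt f (-(x ^ 2) * Complex.exp (x + x ^ 2 / 2)) x := by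
    intro x
    have h1 : HasDerivAt (fun u : ℂ => 1 - u) (-1) x := by
      simpa using (hasDerivAt_id x).const_sub 1
    have h2 : HasDerivAt (fun u : ℂ => u + u ^ 2 / 2) (1 + x) x := by
      have := (hasDerivAt_id x).add (((hasDerivAt_id x).pow 2).div_const 2)
      refine this.congr_deriv ?_
      simp
    refine (h1.mul h2.cexp).congr_deriv ?_
    ring
  have hb : ∀ x ∈ Metric.closedBall (0 : ℂ) ‖u‖,
      ‖-(x ^ 2) * Complex.exp (x + x ^ 2 / 2)‖ ≤ Real.exp 2 * ‖u‖ ^ 2 := by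
    intro x hx
    rw [mem_closedBall_zero_iff] at hx
    rw [norm_mul, norm_neg, norm_pow, mul_comm]
    gcongr
    rw [Complex.norm_exp]
    apply Real.exp_le_exp.mpr
    refine (Complex.re_le_norm _).trans ((norm_add_le _ _).trans ?_)
    rw [norm_div, norm_pow, Complex.norm_ofNat]
    have := norm_nonneg x
    nlinarith
  have := (convex_closedBall (0 : ℂ) ‖u‖).norm_image_sub_le_of_norm_hasDerivWithin_le
    (fun x _ => (hd x).hasDerivWithinAt) hb (x := 0) (y := u) (by simp) (by simp)
  simp only [hf, sub_zero] at this
  simp only [zero_pow two_ne_zero, zero_div, add_zero, Complex.exp_zero, mul_one] at this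
  calc _ ≤ _ := this
    _ = _ := by ring

lemma sigmaFactor_eq_zero_iff {w z : ℂ} (hw : w ≠ 0) : sigmaFactor w z = 0 ↔ z = w := by
  rw [sigmaFactor, mul_eq_zero, or_iff_left (Complex.exp_ne_zero _), sub_eq_zero, eq_comm,
    div_eq_one_iff_eq hw]

lemma norm_sigmaFactor_sub_one_le {w z : ℂ} {r : ℝ} (hz : ‖z‖ ≤ r) (hw : r ≤ ‖w‖) :
    ‖sigmaFactor w z - 1‖ ≤ Real.exp 2 * r ^ 3 * ‖w‖ ^ (-3 : ℝ) := by
  have h := norm_one_sub_mul_exp_sub_one_le (u := z / w) (by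
    rw [norm_div]; exact div_le_one_of_le₀ (hz.trans hw) (norm_nonneg _))
  have e : sigmaFactor w z = (1 - z / w) * Complex.exp (z / w + (z / w) ^ 2 / 2) := by
    rw [sigmaFactor, div_pow]; congr 3; rw [div_div, mul_comm 2]
  rw [e]
  refine h.trans ?_
  rw [mul_assoc]
  gcongr
  rw [norm_div, div_pow, div_eq_mul_inv, Real.rpow_neg (norm_nonneg _)]
  norm_cast
  gcongr

/-- The index set of the sigma product. -/
abbrev NonzeroPeriod : Type := {w : L.lattice // w ≠ 0}

lemma NonzeroPeriod.ne {L : PeriodPair} (w : NonzeroPeriod L) : (w.1 : ℂ) ≠ 0 := by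
  have := w.2; simpa using this

lemma summable_norm_period : Summable fun w : NonzeroPeriod L => ‖(w.1 : ℂ)‖ ^ (-3 : ℝ) :=
  (ZLattice.summable_norm_rpow L.lattice (-3) (by simp; norm_num)).subtype _

lemma eventually_le_norm_period (r : ℝ) : ∀ᶠ w : NonzeroPeriod L in cofinite, r ≤ ‖(w.1 : ℂ)‖ := by
  have h : {l : L.lattice | ¬ r ≤ ‖(l : ℂ)‖}.Finite := by
    refine (isCompact_iff_finite.mp (isCompact_closedBall (0 : L.lattice) r)).subset ?_
    intro l hl
    simp only [Set.mem_ofPred_eq, not_le] at hl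
    simpa using hl.le
  exact h.preimage Subtype.val_injective.injOn

lemma hasProdLocallyUniformlyOn_sigmaFactor :
    HasProdLocallyUniformlyOn (fun (w : NonzeroPeriod L) z => sigmaFactor (w.1 : ℂ) z)
      (fun z => ∏' w : NonzeroPeriod L, sigmaFactor (w.1 : ℂ) z) Set.univ := by
  have key : ∀ r > 0, HasProdLocallyUniformlyOn (fun (w : NonzeroPeriod L) z =>
      sigmaFactor (w.1 : ℂ) z) (fun z => ∏' w : NonzeroPeriod L, sigmaFactor (w.1 : ℂ) z)
      (Metric.ball 0 r) := by
    intro r hr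
    have := Summable.hasProdLocallyUniformlyOn_one_add
      (f := fun (w : NonzeroPeriod L) z => sigmaFactor (w.1 : ℂ) z - 1)
      (K := Metric.ball (0 : ℂ) r) Metric.isOpen_ball
      ((summable_norm_period L).mul_left (Real.exp 2 * r ^ 3)) ?_ ?_
    · simpa using this
    · filter_upwards [eventually_le_norm_period L r] with w hw z hz
      exact norm_sigmaFactor_sub_one_le (by simpa using (mem_ball_zero_iff.mp hz).le) hw
    · exact fun w => ((differentiable_sigmaFactor _).continuous.sub continuous_const).continuousOn
  rw [hasProdLocallyUniformlyOn_iff_tendstoLocallyUniformlyOn]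
  intro u hu x hx
  have h := key (‖x‖ + 1) (by positivity)
  rw [hasProdLocallyUniformlyOn_iff_tendstoLocallyUniformlyOn] at h
  obtain ⟨t, ht, hts⟩ := h u hu x (by simp)
  exact ⟨t, by
    rwa [nhdsWithin_univ,
      ← Metric.isOpen_ball.nhdsWithin_eq (s := Metric.ball 0 (‖x‖ + 1)) (by simp)], hts⟩

/-- The sigma function without its zero at the origin. -/
noncomputable def sigmaProd (z : ℂ) : ℂ := ∏' w : NonzeroPeriod L, sigmaFactor (w.1 : ℂ) z

lemma sigma_eq (z : ℂ) : sigma L z = z * sigmaProd L z := rfl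

lemma tendsto_sigmaProd :
    TendstoLocallyUniformlyOn (fun (s : Finset (NonzeroPeriod L)) z =>
      ∏ w ∈ s, sigmaFactor (w.1 : ℂ) z) (sigmaProd L) atTop Set.univ :=
  (hasProdLocallyUniformlyOn_iff_tendstoLocallyUniformlyOn).mp
    (hasProdLocallyUniformlyOn_sigmaFactor L)

lemma differentiable_prod_sigmaFactor (s : Finset (NonzeroPeriod L)) :
    Differentiable ℂ fun z => ∏ w ∈ s, sigmaFactor (w.1 : ℂ) z := by
  have := fun w : NonzeroPeriod L => differentiable_sigmaFactor (w.1 : ℂ)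
  fun_prop

lemma differentiable_sigmaProd : Differentiable ℂ (sigmaProd L) := by
  rw [← differentiableOn_univ]
  exact (tendsto_sigmaProd L).differentiableOn
    (.of_forall fun s => (differentiable_prod_sigmaFactor L s).differentiableOn) isOpen_univ

lemma sigmaProd_zero : sigmaProd L 0 = 1 := by
  simp [sigmaProd, sigmaFactor]

lemma sigmaProd_ne_zero {z : ℂ} (hz : ∀ w : NonzeroPeriod L, z ≠ w.1) : sigmaProd L z ≠ 0 := by
  have h := tprod_one_add_ne_zero_of_summable
    (f := fun w : NonzeroPeriod L => sigmaFactor (w.1 : ℂ) z - 1) ?_ ?_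
  · simpa [sigmaProd] using h
  · intro w
    rw [add_sub_cancel, Ne, sigmaFactor_eq_zero_iff w.ne]
    exact hz w
  · refine Summable.of_norm_bounded_eventually
      ((summable_norm_period L).mul_left (Real.exp 2 * ‖z‖ ^ 3)) ?_
    filter_upwards [eventually_le_norm_period L ‖z‖] with w hw
    rw [norm_norm]
    exact norm_sigmaFactor_sub_one_le le_rfl hw

lemma sigmaProd_coe (w : NonzeroPeriod L) : sigmaProd L w.1 = 0 := by
  have := (tendsto_sigmaProd L).tendsto_at (Set.mem_univ (w.1 : ℂ))
  refine tendsto_nhds_unique this (tendsto_const_nhds.congr' ?_)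
  filter_upwards [eventually_ge_atTop {w}] with s hs
  rw [Finset.prod_eq_zero (hs (Finset.mem_singleton_self w))]
  rw [sigmaFactor_eq_zero_iff w.ne]

lemma differentiable_sigma : Differentiable ℂ (sigma L) :=
  differentiable_id.mul (differentiable_sigmaProd L)

lemma sigma_eq_zero_iff {z : ℂ} : sigma L z = 0 ↔ z ∈ L.lattice := by
  rw [sigma_eq]
  constructor
  · intro h
    rcases mul_eq_zero.mp h with h | h
    · rw [h]; exact zero_mem _
    · by_contra hz
      exact sigmaProd_ne_zero L (fun w hw => hz (by rw [hw]; exact w.1.2)) h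
  · intro h
    by_cases h0 : z = 0
    · rw [h0, zero_mul]
    · rw [sigmaProd_coe L ⟨⟨z, h⟩, by simpa using h0⟩, mul_zero]

lemma sigma_neg (z : ℂ) : sigma L (-z) = -sigma L z := by
  rw [sigma_eq, sigma_eq, neg_mul]
  congr 2
  have : (∏' w : NonzeroPeriod L, sigmaFactor ((-w.1 : L.lattice) : ℂ) z) = sigmaProd L z :=
    ((Equiv.neg L.lattice).subtypeEquiv fun w => by simp).tprod_eq
      fun w : NonzeroPeriod L => sigmaFactor (w.1 : ℂ) z
  rw [← this]
  refine tprod_congr fun w => ?_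
  simp only [sigmaFactor, NegMemClass.coe_neg, neg_div, div_neg, neg_sq]

lemma logDeriv_sigmaFactor {w z : ℂ} (hw : w ≠ 0) (hz : z ≠ w) :
    logDeriv (sigmaFactor w) z = 1 / (z - w) + 1 / w + z / w ^ 2 := by
  have h1 : HasDerivAt (fun u : ℂ => 1 - u / w) (-(1 / w)) z := by
    simpa using ((hasDerivAt_id z).div_const w).const_sub 1
  have h2 : HasDerivAt (fun u : ℂ => u / w + u ^ 2 / (2 * w ^ 2)) (1 / w + z / w ^ 2) z := by
    refine (((hasDerivAt_id z).div_const w).add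
      (((hasDerivAt_id z).pow 2).div_const (2 * w ^ 2))).congr_deriv ?_
    simp; field_simp
  have h3 : 1 - z / w ≠ 0 := by
    rw [sub_ne_zero, Ne, eq_comm, div_eq_one_iff_eq hw]; exact hz
  rw [logDeriv_apply, show sigmaFactor w =
    fun u => (1 - u / w) * Complex.exp (u / w + u ^ 2 / (2 * w ^ 2)) from rfl,
    HasDerivAt.deriv (h1.fun_mul h2.cexp)]
  have h4 : z - w ≠ 0 := sub_ne_zero.mpr hz
  have h5 : w - z ≠ 0 := sub_ne_zero.mpr (Ne.symm hz)
  have h6 := Complex.exp_ne_zero (z / w + z ^ 2 / (2 * w ^ 2))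
  field_simp
  ring

lemma hasDerivAt_logDeriv {f : ℂ → ℂ} {z : ℂ} (hf : Differentiable ℂ f) (hz : f z ≠ 0) :
    HasDerivAt (logDeriv f) ((deriv (deriv f) z * f z - deriv f z ^ 2) / f z ^ 2) z := by
  have h := ((hf.analyticAt z).deriv.differentiableAt.hasDerivAt).div (hf z).hasDerivAt hz
  refine h.congr_deriv ?_
  ring

lemma isOpen_compl_lattice : IsOpen (L.lattice : Set ℂ)ᶜ := L.isClosed_lattice.isOpen_compl

/-- The derivative of `ζ` is `-℘`: the second logarithmic derivatives of the partial products of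
`σ` are the partial sums of the series of `-℘`. -/
lemma hasDerivAt_zeta {z : ℂ} (hz : z ∉ L.lattice) :
    HasDerivAt (zeta L) (-L.weierstrassP z) z := by
  have hzw : ∀ w : NonzeroPeriod L, z ≠ w.1 := fun w h => hz (h ▸ w.1.2)
  have hP := sigmaProd_ne_zero L hzw
  have t0 := tendsto_sigmaProd L
  have t1 := t0.deriv (.of_forall fun s => (differentiable_prod_sigmaFactor L s).differentiableOn)
    isOpen_univ
  have t2 := t1.deriv (.of_forall fun s =>
    ((differentiable_prod_sigmaFactor L s).deriv).differentiableOn) isOpen_univ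
  have lim := (((t2.tendsto_at (Set.mem_univ z)).mul (t0.tendsto_at (Set.mem_univ z))).sub
    ((t1.tendsto_at (Set.mem_univ z)).pow 2)).div ((t0.tendsto_at (Set.mem_univ z)).pow 2)
    (pow_ne_zero 2 hP)
  have hsum : HasSum (fun w : NonzeroPeriod L => -(1 / (z - w.1) ^ 2 - 1 / (w.1 : ℂ) ^ 2))
      (-(L.weierstrassP z - 1 / z ^ 2)) := by
    refine HasSum.neg ?_
    have h := L.hasSum_weierstrassPExcept 0 z
    have e := L.weierstrassPExcept_def 0 z
    simp only [ZeroMemClass.coe_zero, sub_zero, ne_eq, OfNat.ofNat_ne_zero, not_false_eq_true,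
      zero_pow, div_zero, zero_sub] at e
    rw [e, ← sub_eq_add_neg] at h
    rw [← hasSum_subtype_iff_of_support_subset (s := {w : L.lattice | w ≠ 0})] at h
    · have h' : HasSum (fun w : NonzeroPeriod L => if (w.1 : ℂ) = 0 then 0 else
        (1 / (z - w.1) ^ 2 - 1 / (w.1 : ℂ) ^ 2)) _ := h
      simpa only [if_neg (NonzeroPeriod.ne _)] using h'
    · intro w hw h0
      subst h0
      simp at hw
  have hd : deriv (logDeriv (sigmaProd L)) z = -(L.weierstrassP z - 1 / z ^ 2) := by
    rw [(hasDerivAt_logDeriv (differentiable_sigmaProd L) hP).deriv]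
    refine tendsto_nhds_unique lim (hsum.congr fun s => ?_)
    have hs : ∏ w ∈ s, sigmaFactor (w.1 : ℂ) z ≠ 0 := Finset.prod_ne_zero_iff.mpr fun w _ => by
      rw [Ne, sigmaFactor_eq_zero_iff w.ne]; exact hzw w
    refine Eq.trans ?_ (hasDerivAt_logDeriv (differentiable_prod_sigmaFactor L s) hs).deriv
    have e : logDeriv (fun z => ∏ w ∈ s, sigmaFactor (w.1 : ℂ) z) =ᶠ[𝓝 z]
        fun z => ∑ w ∈ s, (1 / (z - w.1) + 1 / (w.1 : ℂ) + z / (w.1 : ℂ) ^ 2) := by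
      filter_upwards [(isOpen_compl_lattice L).mem_nhds hz] with x hx
      have hx' : ∀ w : NonzeroPeriod L, x ≠ w.1 := fun w h => hx (h ▸ w.1.2)
      rw [logDeriv_prod]
      · exact Finset.sum_congr rfl fun w _ => logDeriv_sigmaFactor w.ne (hx' w)
      · intro w _; rw [Ne, sigmaFactor_eq_zero_iff w.ne]; exact hx' w
      · intro w _; exact differentiable_sigmaFactor _ x
    rw [e.deriv_eq]
    refine (HasDerivAt.deriv (HasDerivAt.fun_sum fun w _ => ?_)).symm
    have h4 : z - w.1 ≠ 0 := sub_ne_zero.mpr (hzw w)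
    have h5 := w.ne
    refine ((((hasDerivAt_id z).sub_const _).inv h4).add_const (1 / (w.1 : ℂ)) |>.add
      ((hasDerivAt_id z).div_const ((w.1 : ℂ) ^ 2))).congr_deriv ?_ |>.congr_of_eventuallyEq ?_
    · simp; ring
    · exact .of_forall fun x => by simp
  have hz0 : z ≠ 0 := fun h => hz (h ▸ zero_mem _)
  have hP' : HasDerivAt (logDeriv (sigmaProd L)) (-(L.weierstrassP z - 1 / z ^ 2)) z := by
    rw [← hd]
    exact (hasDerivAt_logDeriv (differentiable_sigmaProd L) hP).differentiableAt.hasDerivAt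
  have e : zeta L =ᶠ[𝓝 z] fun x => x⁻¹ + logDeriv (sigmaProd L) x := by
    filter_upwards [(isOpen_compl_lattice L).mem_nhds hz] with x hx
    have hx0 : x ≠ 0 := fun h => hx (h ▸ zero_mem _)
    have h : logDeriv (fun y => y * sigmaProd L y) x = _ := logDeriv_mul x hx0
      (sigmaProd_ne_zero L fun w h => hx (h ▸ w.1.2)) differentiableAt_id
      (differentiable_sigmaProd L x)
    rw [logDeriv_id'] at h
    refine Eq.trans (b := logDeriv (fun y => y * sigmaProd L y) x) rfl (h.trans ?_)
    simp
  refine (((hasDerivAt_inv hz0).add hP').congr_of_eventuallyEq e).congr_deriv ?_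
  field_simp; ring

end Sigma
end HKAnsatz

namespace HKAnsatz
open Filter Topology

/-! ### Elliptic functions: Liouville's theorem and its consequences -/

section Liouville
variable {L : PeriodPair}

lemma countable_lattice (L : PeriodPair) : (L.lattice : Set ℂ).Countable := by
  have : Countable L.lattice := L.latticeEquivProd.toEquiv.countable_iff.mpr inferInstance
  exact Set.to_countable _

lemma isPreconnected_compl_of_countable {s : Set ℂ} (hs : s.Countable) : IsPreconnected sᶜ :=
  (hs.isPathConnected_compl_of_one_lt_rank (by
    rw [Complex.rank_real_complex]; exact_mod_cast one_lt_two)).isConnected.isPreconnected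

lemma isPreconnected_compl_lattice (L : PeriodPair) : IsPreconnected (L.lattice : Set ℂ)ᶜ :=
  isPreconnected_compl_of_countable (countable_lattice L)

/-- The set on which the Ansatz is made: the complement of the half lattice. -/
def offHalf (L : PeriodPair) : Set ℂ := {x | 2 * x ∉ L.lattice}

lemma isOpen_offHalf (L : PeriodPair) : IsOpen (offHalf L) :=
  (isOpen_compl_lattice L).preimage (by fun_prop : Continuous fun x : ℂ => 2 * x)

lemma isPreconnected_offHalf (L : PeriodPair) : IsPreconnected (offHalf L) := by
  have : offHalf L = ((fun x : ℂ => x / 2) '' (L.lattice : Set ℂ))ᶜ := by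
    ext x
    simp only [offHalf, Set.mem_ofPred_eq, Set.mem_compl_iff, Set.mem_image, not_exists, not_and]
    constructor
    · rintro h y hy rfl
      exact h (by rwa [mul_div_cancel₀ _ two_ne_zero])
    · intro h h2
      exact h _ h2 (by ring)
  rw [this]
  exact isPreconnected_compl_of_countable ((countable_lattice L).image _)

lemma notMem_of_mem_offHalf {x : ℂ} (hx : x ∈ offHalf L) : x ∉ L.lattice := fun h =>
  hx (by rw [two_mul]; exact add_mem h h)

lemma add_notMem {x w : ℂ} (hx : x ∉ L.lattice) (hw : w ∈ L.lattice) : x + w ∉ L.lattice :=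
  fun h => hx (by simpa using sub_mem h hw)

lemma weierstrassP_add (x : ℂ) {w : ℂ} (hw : w ∈ L.lattice) :
    L.weierstrassP (x + w) = L.weierstrassP x := L.weierstrassP_add_coe x ⟨w, hw⟩

lemma derivWeierstrassP_add (x : ℂ) {w : ℂ} (hw : w ∈ L.lattice) :
    L.derivWeierstrassP (x + w) = L.derivWeierstrassP x := L.derivWeierstrassP_add_coe x ⟨w, hw⟩

lemma analyticAt_weierstrassP {x : ℂ} (hx : x ∉ L.lattice) : AnalyticAt ℂ L.weierstrassP x :=
  L.analyticOnNhd_weierstrassP x hx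

lemma hasDerivAt_weierstrassP {x : ℂ} (hx : x ∉ L.lattice) :
    HasDerivAt L.weierstrassP (L.derivWeierstrassP x) x := by
  rw [← L.deriv_weierstrassP]
  exact (analyticAt_weierstrassP hx).differentiableAt.hasDerivAt

lemma analyticAt_derivWeierstrassP {x : ℂ} (hx : x ∉ L.lattice) :
    AnalyticAt ℂ L.derivWeierstrassP x := L.analyticOnNhd_derivWeierstrassP x hx

lemma tendsto_sub_mul_shift {f : ℂ → ℂ} {x w : ℂ} (hper : ∀ z, f (z + w) = f z)
    (h : Tendsto (fun y => (y - x) * f y) (𝓝[≠] x) (𝓝 0)) :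
    Tendsto (fun y => (y - (x + w)) * f y) (𝓝[≠] (x + w)) (𝓝 0) := by
  have ht : Tendsto (fun y => y - w) (𝓝[≠] (x + w)) (𝓝[≠] x) := by
    refine tendsto_nhdsWithin_of_tendsto_nhds_of_eventually_within _ ?_ ?_
    · refine Tendsto.mono_left ?_ nhdsWithin_le_nhds
      have : ContinuousAt (fun y : ℂ => y - w) (x + w) := by fun_prop
      simpa [ContinuousAt] using this
    · filter_upwards [self_mem_nhdsWithin] with y hy h
      exact hy (by rw [Set.mem_singleton_iff] at *; rw [← h]; ring)
  refine (h.comp ht).congr fun y => ?_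
  simp only [Function.comp]
  rw [← hper (y - w), sub_add_cancel]
  ring

lemma tendsto_sub_mul_of_continuousAt {f : ℂ → ℂ} {x : ℂ} (h : ContinuousAt f x) :
    Tendsto (fun y => (y - x) * f y) (𝓝[≠] x) (𝓝 0) := by
  have : ContinuousAt (fun y => (y - x) * f y) x := by fun_prop
  have h2 := this.tendsto
  simp only [sub_self, zero_mul] at h2
  exact h2.mono_left nhdsWithin_le_nhds

/-- Liouville's theorem: a doubly periodic function with at most removable singularities is
constant. -/
theorem exists_eq_of_periodic {f : ℂ → ℂ} (hper : ∀ z, ∀ w ∈ L.lattice, f (z + w) = f z)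
    (hd : ∀ x, ∀ᶠ y in 𝓝[≠] x, DifferentiableAt ℂ f y)
    (h0 : ∀ x, Tendsto (fun y => (y - x) * f y) (𝓝[≠] x) (𝓝 0)) :
    ∃ c, ∀ x, ContinuousAt f x → f x = c := by
  have ho : ∀ x, (fun z => f z - f x) =o[𝓝[≠] x] fun z => (z - x)⁻¹ := by
    intro x
    rw [Asymptotics.isLittleO_iff_tendsto']
    · have h2 : Tendsto (fun y => (y - x) * f y - (y - x) * f x) (𝓝[≠] x) (𝓝 (0 - 0)) :=
        (h0 x).sub (tendsto_sub_mul_of_continuousAt (f := fun _ => f x) continuousAt_const)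
      rw [sub_zero] at h2
      refine h2.congr fun y => ?_
      rw [div_inv_eq_mul]; ring
    · filter_upwards [self_mem_nhdsWithin] with y hy h
      exact absurd (sub_eq_zero.mp (inv_eq_zero.mp h)) hy
  -- Removing the singularities gives an entire function, bounded because of its periodicity.
  set g : ℂ → ℂ := fun x => limUnder (𝓝[≠] x) f with hg
  have hT : ∀ x, Tendsto f (𝓝[≠] x) (𝓝 (g x)) := fun x =>
    Complex.tendsto_limUnder_of_differentiable_on_punctured_nhds_of_isLittleO (hd x) (ho x)
  have hgf : ∀ x, ContinuousAt f x → g x = f x := fun x hx =>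
    tendsto_nhds_unique (hT x) (hx.tendsto.mono_left nhdsWithin_le_nhds)
  have hgd : Differentiable ℂ g := by
    intro x
    have h1 := Complex.differentiableOn_update_limUnder_insert_of_isLittleO
      (s := {y | DifferentiableAt ℂ f y}) (hd x)
      (fun y hy => hy.differentiableWithinAt) (ho x)
    have h2 := h1.differentiableAt (insert_mem_nhds_iff.2 (hd x))
    refine h2.congr_of_eventuallyEq ?_
    have h3 : ∀ᶠ y in 𝓝[≠] x, g y = Function.update f x (limUnder (𝓝[≠] x) f) y := by
      filter_upwards [hd x, self_mem_nhdsWithin] with y hy hne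
      rw [Function.update_of_ne hne, hgf y hy.continuousAt]
    rw [eventually_nhdsWithin_iff] at h3
    filter_upwards [h3] with y hy
    by_cases hyx : y = x
    · subst hyx; simp [hg]
    · exact hy hyx
  have hgper : ∀ z w, w ∈ L.lattice → g (z + w) = g z := by
    intro z w hw
    have ht : Tendsto (fun y => y + w) (𝓝[≠] z) (𝓝[≠] (z + w)) := by
      refine tendsto_nhdsWithin_of_tendsto_nhds_of_eventually_within _ ?_ ?_
      · refine Tendsto.mono_left ?_ nhdsWithin_le_nhds
        exact (by fun_prop : ContinuousAt (fun y : ℂ => y + w) z)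
      · filter_upwards [self_mem_nhdsWithin] with y hy h
        exact hy (add_right_cancel h)
    exact tendsto_nhds_unique (((hT (z + w)).comp ht).congr fun y => hper y w hw) (hT z)
  refine ⟨g 0, fun x hx => ?_⟩
  rw [← hgf x hx]
  exact hgd.apply_eq_apply_of_bounded
    (IsZLattice.isCompact_range_of_periodic L.lattice g hgd.continuous hgper).isBounded x 0

lemma eventually_notMem_lattice (x : ℂ) : ∀ᶠ y in 𝓝[≠] x, y ∉ L.lattice := by
  have h := L.compl_lattice_sdiff_singleton_mem_nhds x
  filter_upwards [nhdsWithin_le_nhds h, self_mem_nhdsWithin] with y hy hne hmem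
  exact hy ⟨hmem, hne⟩

/-- Liouville's theorem for functions whose only singularities are periods. -/
theorem exists_eq_of_periodic' {f : ℂ → ℂ} (hper : ∀ z, ∀ w ∈ L.lattice, f (z + w) = f z)
    (hd : ∀ x, x ∉ L.lattice → DifferentiableAt ℂ f x)
    (h0 : Tendsto (fun y => y * f y) (𝓝[≠] 0) (𝓝 0)) :
    ∃ c, ∀ x, x ∉ L.lattice → f x = c := by
  obtain ⟨c, hc⟩ := exists_eq_of_periodic (L := L) hper
    (fun x => (eventually_notMem_lattice x).mono fun y hy => hd y hy) (fun x => by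
      by_cases hx : x ∈ L.lattice
      · have := tendsto_sub_mul_shift (x := 0) (w := x) (fun z => hper z x hx) (by simpa using h0)
        simpa using this
      · exact tendsto_sub_mul_of_continuousAt (hd x hx).continuousAt)
  exact ⟨c, fun x hx => hc x (hd x hx).continuousAt⟩

/-- An even function has no simple pole at the origin. -/
lemma tendsto_mul_of_even {f : ℂ → ℂ} (heven : ∀ x, f (-x) = f x)
    (hd : ∀ᶠ x in 𝓝[≠] 0, DifferentiableAt ℂ f x)
    (h0 : Tendsto (fun y => y ^ 2 * f y) (𝓝[≠] 0) (𝓝 0)) :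
    Tendsto (fun y => y * f y) (𝓝[≠] 0) (𝓝 0) := by
  set φ : ℂ → ℂ := fun y => y ^ 2 * f y with hφ
  have hc : ContinuousAt φ 0 := by
    rw [continuousAt_iff_punctured_nhds]
    simpa [hφ] using h0
  have ha : AnalyticAt ℂ φ 0 :=
    Complex.analyticAt_of_differentiable_on_punctured_nhds_of_continuousAt
      (hd.mono fun y hy => ((differentiableAt_id.pow 2).mul hy)) hc
  have h1 := ha.differentiableAt.hasDerivAt
  have h2 : HasDerivAt φ (-(deriv φ 0)) 0 := by
    have h3 : HasDerivAt (fun x : ℂ => φ (-x)) (deriv φ 0 * -1) 0 :=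
      HasDerivAt.comp (h₂ := φ) (h := fun x : ℂ => -x) (0 : ℂ)
        (by rw [neg_zero]; exact h1) (hasDerivAt_neg 0)
    have e : (fun x : ℂ => φ (-x)) = φ := by ext x; simp [hφ, heven]
    rw [e] at h3
    exact h3.congr_deriv (by ring)
  have h4 : deriv φ 0 = 0 := self_eq_neg.mp (h1.unique h2)
  rw [h4, hasDerivAt_iff_tendsto_slope] at h1
  refine h1.congr' ?_
  filter_upwards [self_mem_nhdsWithin] with y hy
  have hy : y ≠ 0 := hy
  simp only [slope, hφ, vsub_eq_sub, smul_eq_mul]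
  field_simp
  ring

/-- Liouville's theorem for even functions with singularities weaker than double poles at the
periods. -/
theorem exists_eq_of_periodic_even {f : ℂ → ℂ} (hper : ∀ z, ∀ w ∈ L.lattice, f (z + w) = f z)
    (hd : ∀ x, x ∉ L.lattice → DifferentiableAt ℂ f x) (heven : ∀ x, f (-x) = f x)
    (h0 : Tendsto (fun y => y ^ 2 * f y) (𝓝[≠] 0) (𝓝 0)) :
    ∃ c, ∀ x, x ∉ L.lattice → f x = c :=
  exists_eq_of_periodic' hper hd (tendsto_mul_of_even heven
    ((eventually_notMem_lattice 0).mono fun y hy => hd y hy) h0)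

lemma tendsto_sq_mul_weierstrassP (L : PeriodPair) :
    Tendsto (fun x => x ^ 2 * L.weierstrassP x) (𝓝[≠] 0) (𝓝 1) := by
  have h : ContinuousAt (fun x => 1 + x ^ 2 * L.weierstrassPExcept 0 x) 0 := by
    have := (L.analyticAt_weierstrassPExcept 0).continuousAt
    fun_prop
  have h2 := h.tendsto
  simp only [ne_eq, OfNat.ofNat_ne_zero, not_false_eq_true, zero_pow, zero_mul, add_zero] at h2
  refine (h2.mono_left nhdsWithin_le_nhds).congr' ?_
  filter_upwards [self_mem_nhdsWithin] with x hx
  have hx : x ≠ 0 := hx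
  have := L.weierstrassPExcept_def 0 x
  simp only [ZeroMemClass.coe_zero] at this
  rw [this]
  field_simp
  simp
  ring

lemma tendsto_pow_zero {n : ℕ} (hn : n ≠ 0) : Tendsto (fun x : ℂ => x ^ n) (𝓝[≠] 0) (𝓝 0) := by
  have : ContinuousAt (fun x : ℂ => x ^ n) 0 := by fun_prop
  have h2 := this.tendsto
  simp only [zero_pow hn] at h2
  exact h2.mono_left nhdsWithin_le_nhds

/-- `℘` takes the value `a` at no point of a punctured neighbourhood of the origin. -/
lemma eventually_weierstrassP_ne (a : ℂ) : ∀ᶠ x in 𝓝[≠] 0, L.weierstrassP x ≠ a := by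
  have h := (tendsto_sq_mul_weierstrassP L).sub ((tendsto_pow_zero two_ne_zero).mul_const a)
  rw [zero_mul, sub_zero] at h
  filter_upwards [h.eventually_ne one_ne_zero] with x hx h2
  exact hx (by rw [h2, sub_self])

lemma not_eventually_weierstrassP_eq {x : ℂ} (hx : x ∉ L.lattice) (a : ℂ) :
    ¬ ∀ᶠ y in 𝓝 x, L.weierstrassP y = a := by
  intro h
  have h2 := L.analyticOnNhd_weierstrassP.eqOn_of_preconnected_of_eventuallyEq
    (analyticOnNhd_const (v := a)) (isPreconnected_compl_lattice L) hx h
  obtain ⟨y, hy, hy2⟩ := ((eventually_weierstrassP_ne (L := L) a).and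
    (eventually_notMem_lattice 0)).exists
  exact hy (h2 hy2)

lemma derivWeierstrassP_half {w : ℂ} (hw : 2 * w ∈ L.lattice) : L.derivWeierstrassP w = 0 := by
  have h1 := derivWeierstrassP_add (L := L) (-w) hw
  rw [show -w + 2 * w = w by ring, L.derivWeierstrassP_neg] at h1
  exact self_eq_neg.mp h1

/-- Translation by a half period acts on `℘` as an involution of the line, exchanging `∞` and `℘ w`.
-/
lemma exists_half_translation {w : ℂ} (hw : 2 * w ∈ L.lattice) (hw' : w ∉ L.lattice) :
    ∃ c, ∀ x, x ∉ L.lattice → x + w ∉ L.lattice →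
      (L.weierstrassP (x + w) - L.weierstrassP w) * (L.weierstrassP x - L.weierstrassP w) = c := by
  set f : ℂ → ℂ := fun x =>
    (L.weierstrassP (x + w) - L.weierstrassP w) * (L.weierstrassP x - L.weierstrassP w) with hf
  have hdx : ∀ x, x ∉ L.lattice → x + w ∉ L.lattice → DifferentiableAt ℂ f x := by
    intro x h1 h2
    have d1 := (analyticAt_weierstrassP h1).differentiableAt
    have d2 : DifferentiableAt ℂ (fun x => L.weierstrassP (x + w)) x :=
      DifferentiableAt.comp (f := fun x => x + w) x (analyticAt_weierstrassP h2).differentiableAt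
        (by fun_prop)
    fun_prop
  have hper : ∀ z, ∀ v ∈ L.lattice, f (z + v) = f z := by
    intro z v hv
    simp only [hf]
    rw [weierstrassP_add z hv, show z + v + w = z + w + v by ring, weierstrassP_add _ hv]
  have hperw : ∀ z, f (z + w) = f z := by
    intro z
    simp only [hf]
    rw [show z + w + w = z + 2 * w by ring, weierstrassP_add z hw, mul_comm]
  -- At the origin the double pole of `℘` meets a double zero, as `℘'` vanishes at `w`.
  have h00 : Tendsto (fun y => (y - 0) * f y) (𝓝[≠] 0) (𝓝 0) := by
    have h1 : HasDerivAt (fun x => L.weierstrassP (x + w)) (L.derivWeierstrassP w) 0 := by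
      have := HasDerivAt.comp_add_const (0 : ℂ) w (f := L.weierstrassP)
        (by simpa using hasDerivAt_weierstrassP hw')
      simpa using this
    rw [derivWeierstrassP_half hw, hasDerivAt_iff_tendsto_slope] at h1
    have h2 := (tendsto_sq_mul_weierstrassP L).sub
      ((tendsto_pow_zero two_ne_zero).mul_const (L.weierstrassP w))
    have h3 := h1.mul h2
    simp only [zero_mul] at h3
    refine h3.congr' ?_
    filter_upwards [self_mem_nhdsWithin] with y hy
    have hy : y ≠ 0 := hy
    simp only [slope, hf, vsub_eq_sub, smul_eq_mul, zero_add, sub_zero]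
    field_simp
  obtain ⟨c, hc⟩ := exists_eq_of_periodic (L := L) hper
    (fun x => by
      have h2 : ∀ᶠ y in 𝓝[≠] x, y + w ∉ L.lattice := by
        have ht : Tendsto (fun y => y + w) (𝓝[≠] x) (𝓝[≠] (x + w)) := by
          refine tendsto_nhdsWithin_of_tendsto_nhds_of_eventually_within _ ?_ ?_
          · refine Tendsto.mono_left ?_ nhdsWithin_le_nhds
            exact (by fun_prop : ContinuousAt (fun y : ℂ => y + w) x)
          · filter_upwards [self_mem_nhdsWithin] with y hy h
            exact hy (add_right_cancel h)
        exact ht.eventually (eventually_notMem_lattice _)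
      filter_upwards [eventually_notMem_lattice x, h2] with y h1 h2 using hdx y h1 h2)
    (fun x => by
      by_cases hx : x ∈ L.lattice
      · have := tendsto_sub_mul_shift (x := 0) (w := x) (fun z => hper z x hx) h00
        simpa using this
      by_cases hx' : x + w ∈ L.lattice
      · have h1 := tendsto_sub_mul_shift (x := 0) (w := w) hperw h00
        have h2 := tendsto_sub_mul_shift (x := 0 + w) (w := x + w - 2 * w)
          (fun z => hper z _ (sub_mem hx' hw)) h1
        simpa [show w + (x + w - 2 * w) = x by ring] using h2
      · exact tendsto_sub_mul_of_continuousAt (hdx x hx hx').continuousAt)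
  exact ⟨c, fun x h1 h2 => hc x (hdx x h1 h2).continuousAt⟩

/-- `℘` takes the value `℘ w` at a half period `w` only at the translates of `w`: otherwise the
constant of `exists_half_translation` vanishes, and `℘` is constant. -/
lemma weierstrassP_half_ne {w w' : ℂ} (hw : 2 * w ∈ L.lattice) (hw0 : w ∉ L.lattice)
    (hw'0 : w' ∉ L.lattice) (hs : w' + w ∉ L.lattice) :
    L.weierstrassP w' ≠ L.weierstrassP w := by
  intro h
  obtain ⟨c, hc⟩ := exists_half_translation hw hw0
  have h1 := hc w' hw'0 hs
  rw [h, sub_self, mul_zero] at h1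
  subst h1
  have h2 : ∀ᶠ x in 𝓝[≠] (0 : ℂ), L.weierstrassP (x + w) = L.weierstrassP w := by
    have hcont : ContinuousAt (fun x : ℂ => x + w) 0 := by fun_prop
    have : ∀ᶠ x in 𝓝 (0 : ℂ), x + w ∉ L.lattice :=
      hcont.eventually ((isOpen_compl_lattice L).mem_nhds (by simpa using hw0))
    filter_upwards [eventually_notMem_lattice 0, nhdsWithin_le_nhds this,
      eventually_weierstrassP_ne (L := L) (L.weierstrassP w)] with x h1 h2 h3
    exact sub_eq_zero.mp ((mul_eq_zero.mp (hc x h1 h2)).resolve_right (sub_ne_zero.mpr h3))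
  rw [eventually_nhdsWithin_iff] at h2
  refine not_eventually_weierstrassP_eq hw0 (L.weierstrassP w) ?_
  have hcont : ContinuousAt (fun x : ℂ => x - w) w := by fun_prop
  have h3 : Tendsto (fun x : ℂ => x - w) (𝓝 w) (𝓝 0) := by simpa [ContinuousAt] using hcont
  filter_upwards [h3.eventually h2] with y hy
  by_cases hyw : y = w
  · rw [hyw]
  · simpa using hy (by simpa [sub_eq_zero] using hyw)

/-- `℘` takes every complex value. -/
theorem exists_weierstrassP_eq (L : PeriodPair) (a : ℂ) :
    ∃ x, x ∉ L.lattice ∧ L.weierstrassP x = a := by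
  -- Otherwise `1 / (℘ - a)` is constant by Liouville's theorem.
  by_contra! h
  classical
  set f : ℂ → ℂ := fun x => if x ∈ L.lattice then 0 else (L.weierstrassP x - a)⁻¹ with hf
  have hfx : ∀ x, x ∉ L.lattice → f x = (L.weierstrassP x - a)⁻¹ := fun x hx => by simp [hf, hx]
  obtain ⟨c, hc⟩ := exists_eq_of_periodic' (L := L) (f := f) (fun z w hw => by
      have : z + w ∈ L.lattice ↔ z ∈ L.lattice := by
        constructor
        · intro h2; simpa using sub_mem h2 hw
        · intro h2; exact add_mem h2 hw
      simp only [hf, this, weierstrassP_add z hw]) (fun x hx => by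
      have e : f =ᶠ[𝓝 x] fun x => (L.weierstrassP x - a)⁻¹ := by
        filter_upwards [(isOpen_compl_lattice L).mem_nhds hx] with y hy using hfx y hy
      refine DifferentiableAt.congr_of_eventuallyEq ?_ e
      exact ((analyticAt_weierstrassP hx).differentiableAt.sub_const a).inv
        (sub_ne_zero.mpr (h x hx))) (by
      have h2 := (tendsto_sq_mul_weierstrassP L).sub ((tendsto_pow_zero two_ne_zero).mul_const a)
      have h3 := (tendsto_pow_zero (n := 3) three_ne_zero).div h2 (by simp)
      simp only [zero_div] at h3
      refine h3.congr' ?_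
      filter_upwards [self_mem_nhdsWithin, eventually_notMem_lattice 0] with y hy hy2
      have hy : y ≠ 0 := hy
      have := sub_ne_zero.mpr (h y hy2)
      simp only [Pi.div_apply]
      rw [hfx y hy2, ← mul_sub]
      field_simp)
  have h2 : ∀ x, x ∉ L.lattice → L.weierstrassP x = a + c⁻¹ := by
    intro x hx
    have := hc x hx
    rw [hfx x hx] at this
    rw [← this]; simp
  refine not_eventually_weierstrassP_eq (L := L) L.ω₁_div_two_notMem_lattice (a + c⁻¹) ?_
  filter_upwards [(isOpen_compl_lattice L).mem_nhds L.ω₁_div_two_notMem_lattice] with y hy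
  exact h2 y hy

end Liouville
end HKAnsatz

namespace HKAnsatz
open Filter Topology Polynomial

/-! ### The half periods and the cubic -/

section Half
variable {L : PeriodPair}

lemma two_mul_halfPeriod_mem (L : PeriodPair) (i : Fin 4) : 2 * halfPeriod L i ∈ L.lattice := by
  have h1 := L.ω₁_mem_lattice
  have h2 := L.ω₂_mem_lattice
  fin_cases i
  · simp [halfPeriod]
  · simpa [halfPeriod, mul_div_cancel₀] using h1
  · have : 2 * (-(L.ω₁ / 2) - L.ω₂ / 2) = -L.ω₁ - L.ω₂ := by ring
    simpa [halfPeriod, this] using sub_mem (neg_mem h1) h2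
  · simpa [halfPeriod, mul_div_cancel₀] using h2

lemma halfPeriod_notMem (L : PeriodPair) (i : Fin 3) : halfPeriod L i.succ ∉ L.lattice := by
  fin_cases i
  · exact L.ω₁_div_two_notMem_lattice
  · have := (L.mul_ω₁_add_mul_ω₂_mem_lattice (α := -1 / 2) (β := -1 / 2)).not.mpr (by norm_num)
    intro h
    apply this
    convert h using 1
    simp [halfPeriod]; ring
  · exact L.ω₂_div_two_notMem_lattice

lemma halfPeriod_add_notMem (L : PeriodPair) {i j : Fin 3} (hij : i ≠ j) :
    halfPeriod L i.succ + halfPeriod L j.succ ∉ L.lattice := by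
  have h01 : halfPeriod L 1 + halfPeriod L 2 ∉ L.lattice := by
    have : halfPeriod L 1 + halfPeriod L 2 = -(L.ω₂ / 2) := by simp [halfPeriod]; ring
    rw [this, neg_mem_iff]; exact L.ω₂_div_two_notMem_lattice
  have h12 : halfPeriod L 2 + halfPeriod L 3 ∉ L.lattice := by
    have : halfPeriod L 2 + halfPeriod L 3 = -(L.ω₁ / 2) := by simp [halfPeriod]
    rw [this, neg_mem_iff]; exact L.ω₁_div_two_notMem_lattice
  have h02 : halfPeriod L 1 + halfPeriod L 3 ∉ L.lattice := by
    have := (L.mul_ω₁_add_mul_ω₂_mem_lattice (α := 1 / 2) (β := 1 / 2)).not.mpr (by norm_num)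
    intro h
    apply this
    convert h using 1
    simp [halfPeriod]; ring
  fin_cases i <;> fin_cases j
  · exact absurd rfl hij
  · exact h01
  · exact h02
  · rw [add_comm]; exact h01
  · exact absurd rfl hij
  · exact h12
  · rw [add_comm]; exact h02
  · rw [add_comm]; exact h12
  · exact absurd rfl hij

/-- The three values `e_1, e_2, e_3`. -/
noncomputable def roots (L : PeriodPair) (i : Fin 3) : ℂ := e L i.succ

lemma roots_injective (L : PeriodPair) : Function.Injective (roots L) := by
  intro i j h
  by_contra hij
  exact weierstrassP_half_ne (two_mul_halfPeriod_mem L _) (halfPeriod_notMem L j)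
    (halfPeriod_notMem L i) (halfPeriod_add_notMem L hij) h

lemma roots_ne (L : PeriodPair) : roots L 0 ≠ roots L 1 ∧ roots L 0 ≠ roots L 2 ∧
    roots L 1 ≠ roots L 2 :=
  ⟨(roots_injective L).ne (by decide), (roots_injective L).ne (by decide),
    (roots_injective L).ne (by decide)⟩

/-- The values `e_i` are zeros of the cubic, since `℘'` vanishes at the half periods. -/
lemma cubic_roots (i : Fin 3) :
    4 * roots L i ^ 3 - L.g₂ * roots L i - L.g₃ = 0 := by
  have := L.derivWeierstrassP_sq _ (halfPeriod_notMem L i)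
  rw [derivWeierstrassP_half (two_mul_halfPeriod_mem L _)] at this
  rw [roots, e, ← this]; simp

lemma roots_vieta (L : PeriodPair) : roots L 0 + roots L 1 + roots L 2 = 0 ∧
    L.g₂ = -4 * (roots L 0 * roots L 1 + roots L 1 * roots L 2 + roots L 2 * roots L 0) ∧
    L.g₃ = 4 * (roots L 0 * roots L 1 * roots L 2) := by
  obtain ⟨h01, h02, h12⟩ := roots_ne L
  have c0 := cubic_roots (L := L) 0
  have c1 := cubic_roots (L := L) 1
  have c2 := cubic_roots (L := L) 2
  generalize roots L 0 = a at *
  generalize roots L 1 = b at *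
  generalize roots L 2 = c at *
  have k1 : 4 * (a ^ 2 + a * b + b ^ 2) = L.g₂ := by
    apply mul_left_cancel₀ (sub_ne_zero.mpr h01); linear_combination c0 - c1
  have k2 : 4 * (a ^ 2 + a * c + c ^ 2) = L.g₂ := by
    apply mul_left_cancel₀ (sub_ne_zero.mpr h02); linear_combination c0 - c2
  have k3 : a + b + c = 0 := by
    apply mul_left_cancel₀ (sub_ne_zero.mpr h12); linear_combination (k1 - k2) / 4
  have hc : c = -a - b := by linear_combination k3
  subst hc
  refine ⟨by ring, by rw [← k1]; ring, ?_⟩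
  linear_combination -c0 + a * k1

lemma sum_roots (L : PeriodPair) : ∑ i, roots L i = 0 := by
  rw [Fin.sum_univ_three]; exact (roots_vieta L).1

/-- The monic cubic with roots `e_1, e_2, e_3`. -/
noncomputable def rootPoly (L : PeriodPair) : ℂ[X] := ∏ i, (X - C (roots L i))

lemma rootPoly_eval (z : ℂ) :
    4 * (rootPoly L).eval z = 4 * z ^ 3 - L.g₂ * z - L.g₃ := by
  obtain ⟨h1, h2, h3⟩ := roots_vieta L
  have hc : roots L 2 = -roots L 0 - roots L 1 := by linear_combination h1
  rw [rootPoly, eval_prod, Fin.prod_univ_three]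
  simp only [eval_sub, eval_X, eval_C]
  rw [h2, h3, hc]; ring

lemma derivWeierstrassP_sq_eq {x : ℂ} (hx : x ∉ L.lattice) :
    L.derivWeierstrassP x ^ 2 = 4 * (rootPoly L).eval (L.weierstrassP x) := by
  rw [rootPoly_eval, L.derivWeierstrassP_sq x hx]

/-- The translation by `ω_i` in terms of `℘`. -/
lemma weierstrassP_add_half (i : Fin 3) {x : ℂ} (hx : x ∉ L.lattice)
    (hx' : x + halfPeriod L i.succ ∉ L.lattice) :
    (L.weierstrassP (x + halfPeriod L i.succ) - roots L i) * (L.weierstrassP x - roots L i)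
      = (roots L i - roots L (i + 1)) * (roots L i - roots L (i + 2)) := by
  obtain ⟨c, hc⟩ :=
    exists_half_translation (two_mul_halfPeriod_mem L i.succ) (halfPeriod_notMem L i)
  have hne : i + 1 ≠ i := by fin_cases i <;> decide
  -- The constant is found at another half period, as the sum of two of them is the third one.
  have key : halfPeriod L (i + 1).succ + halfPeriod L i.succ =
      halfPeriod L (i + 2).succ + (2 * (halfPeriod L (i + 1).succ + halfPeriod L i.succ)) := by
    fin_cases i <;> simp [halfPeriod] <;> ring
  have h1 := hc _ (halfPeriod_notMem L (i + 1)) (halfPeriod_add_notMem L hne)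
  have hm : 2 * (halfPeriod L (i + 1).succ + halfPeriod L i.succ) ∈ L.lattice := by
    rw [mul_add]
    exact add_mem (two_mul_halfPeriod_mem L _) (two_mul_halfPeriod_mem L _)
  rw [key, weierstrassP_add _ hm] at h1
  have h2 := hc x hx hx'
  change (_ - roots L i) * (_ - roots L i) = c at h2
  change (roots L (i + 2) - roots L i) * (roots L (i + 1) - roots L i) = c at h1
  rw [h2, ← h1]; ring

lemma add_half_notMem {x : ℂ} (hx : x ∈ offHalf L) (i : Fin 4) :
    x + halfPeriod L i ∉ L.lattice := fun h => hx (by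
  have := add_mem h h
  have h2 := sub_mem this (two_mul_halfPeriod_mem L i)
  convert h2 using 1; ring)

lemma weierstrassP_ne_roots {x : ℂ} (hx : x ∈ offHalf L) (i : Fin 3) :
    L.weierstrassP x ≠ roots L i := by
  intro h
  have := weierstrassP_add_half i (notMem_of_mem_offHalf hx) (add_half_notMem hx _)
  rw [h, sub_self, mul_zero, eq_comm, mul_eq_zero, sub_eq_zero, sub_eq_zero] at this
  have h1 : i ≠ i + 1 := by fin_cases i <;> decide
  have h2 : i ≠ i + 2 := by fin_cases i <;> decide
  exact this.elim ((roots_injective L).ne h1) ((roots_injective L).ne h2)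

lemma mem_offHalf_of_ne {x : ℂ} (hx : x ∉ L.lattice) (h : ∀ i, L.weierstrassP x ≠ roots L i) :
    x ∈ offHalf L := by
  intro h2
  obtain ⟨m, n, hmn⟩ := PeriodPair.mem_lattice.mp h2
  have hlat : ∀ a b : ℤ, (a : ℂ) * L.ω₁ + b * L.ω₂ ∈ L.lattice := fun a b =>
    PeriodPair.mem_lattice.mpr ⟨a, b, rfl⟩
  have hx2 : x = (m * L.ω₁ + n * L.ω₂) / 2 := by rw [hmn]; ring
  have key : ∀ i : Fin 3, ∀ a b : ℤ, x = halfPeriod L i.succ + (a * L.ω₁ + b * L.ω₂) → False :=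
    fun i a b hxi => h i (by rw [hxi, weierstrassP_add _ (hlat a b)]; rfl)
  rcases Int.even_or_odd' m with ⟨a, rfl | rfl⟩ <;> rcases Int.even_or_odd' n with ⟨b, rfl | rfl⟩
  · refine hx ?_
    rw [hx2]; convert hlat a b using 1; push_cast; ring
  · refine key 2 a b ?_
    rw [hx2]; simp [halfPeriod]; ring
  · refine key 0 a b ?_
    rw [hx2]; simp [halfPeriod]; ring
  · refine key 1 (a + 1) (b + 1) ?_
    rw [hx2]; simp [halfPeriod]; ring

lemma derivWeierstrassP_ne_zero {x : ℂ} (hx : x ∈ offHalf L) : L.derivWeierstrassP x ≠ 0 := by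
  intro h
  have := derivWeierstrassP_sq_eq (notMem_of_mem_offHalf hx)
  rw [h, rootPoly, eval_prod] at this
  simp only [ne_eq, OfNat.ofNat_ne_zero, not_false_eq_true, zero_pow, eval_sub, eval_X, eval_C,
    zero_eq_mul, Finset.prod_eq_zero_iff, Finset.mem_univ, true_and, false_or, sub_eq_zero] at this
  obtain ⟨i, hi⟩ := this
  exact weierstrassP_ne_roots hx i hi

/-- `℘'' = 2 (∏ (z - e_i))'` at `z = ℘`. -/
lemma hasDerivAt_derivWeierstrassP {x : ℂ} (hx : x ∈ offHalf L) :
    HasDerivAt L.derivWeierstrassP (2 * (derivative (rootPoly L)).eval (L.weierstrassP x)) x := by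
  have hx0 := notMem_of_mem_offHalf hx
  have h1 := (analyticAt_derivWeierstrassP hx0).differentiableAt.hasDerivAt
  have h2 := ((rootPoly L).hasDerivAt (L.weierstrassP x)).comp x (hasDerivAt_weierstrassP hx0)
  have h3 := (h1.fun_pow 2).congr_of_eventuallyEq
    (f₁ := fun x => 4 * (rootPoly L).eval (L.weierstrassP x))
    (by filter_upwards [(isOpen_compl_lattice L).mem_nhds hx0] with y hy
        exact (derivWeierstrassP_sq_eq hy).symm)
  have h4 := h3.unique (h2.const_mul 4)
  refine h1.congr_deriv ?_
  apply mul_left_cancel₀ (derivWeierstrassP_ne_zero hx)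
  simp at h4
  linear_combination h4 / 2

end Half

/-! ### Quasi-periods and addition formulas -/

section Addition
variable {L : PeriodPair}

lemma sigma_ne_zero {x : ℂ} (hx : x ∉ L.lattice) : sigma L x ≠ 0 :=
  fun h => hx ((sigma_eq_zero_iff L).mp h)

lemma hasDerivAt_sigma {x : ℂ} (hx : x ∉ L.lattice) :
    HasDerivAt (sigma L) (zeta L x * sigma L x) x := by
  rw [zeta, div_mul_cancel₀ _ (sigma_ne_zero hx)]
  exact (differentiable_sigma L x).hasDerivAt

/-- The quasi-periodicity of `σ` and `ζ`: first for `ζ`, whose derivative is periodic, and then for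
`σ` by comparison of logarithmic derivatives. -/
lemma exists_quasiPeriod {w : ℂ} (hw : w ∈ L.lattice) : ∃ η c : ℂ, c ≠ 0 ∧
    (∀ z, sigma L (z + w) = c * Complex.exp (η * z) * sigma L z) ∧
    ∀ z, z ∉ L.lattice → zeta L (z + w) = zeta L z + η := by
  have hne := L.ω₁_div_two_notMem_lattice
  set z₀ := L.ω₁ / 2
  have hz : ∀ z, z ∉ L.lattice → zeta L (z + w) = zeta L z + (zeta L (z₀ + w) - zeta L z₀) := by
    have hd : ∀ z, z ∉ L.lattice → HasDerivAt (fun z => zeta L (z + w) - zeta L z) 0 z := by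
      intro z hz
      have h1 := (hasDerivAt_zeta L (add_notMem hz hw)).comp_add_const z w
      refine (h1.sub (hasDerivAt_zeta L hz)).congr_deriv ?_
      rw [weierstrassP_add z hw]; ring
    intro z hzz
    have := (isOpen_compl_lattice L).is_const_of_deriv_eq_zero (isPreconnected_compl_lattice L)
      (fun z hz => (hd z hz).differentiableAt.differentiableWithinAt) (fun z hz => (hd z hz).deriv)
      hzz hne
    linear_combination this
  set η := zeta L (z₀ + w) - zeta L z₀
  have hd : ∀ z, z ∉ L.lattice →
      HasDerivAt (fun z => sigma L (z + w) * Complex.exp (-η * z) / sigma L z) 0 z := by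
    intro z hzz
    have h1 := (hasDerivAt_sigma (add_notMem hzz hw)).comp_add_const z w
    have h2 : HasDerivAt (fun z => Complex.exp (-η * z)) (Complex.exp (-η * z) * -η) z := by
      simpa using ((hasDerivAt_id z).const_mul (-η)).cexp
    refine ((h1.fun_mul h2).fun_div (hasDerivAt_sigma hzz) (sigma_ne_zero hzz)).congr_deriv ?_
    rw [hz z hzz]
    have := sigma_ne_zero hzz
    field_simp; ring
  set c := sigma L (z₀ + w) * Complex.exp (-η * z₀) / sigma L z₀
  have hc : c ≠ 0 := div_ne_zero (mul_ne_zero (sigma_ne_zero (add_notMem hne hw))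
    (Complex.exp_ne_zero _)) (sigma_ne_zero hne)
  refine ⟨η, c, hc, fun z => ?_, hz⟩
  by_cases hzz : z ∈ L.lattice
  · rw [(sigma_eq_zero_iff L).mpr hzz, (sigma_eq_zero_iff L).mpr (add_mem hzz hw), mul_zero]
  · have := (isOpen_compl_lattice L).is_const_of_deriv_eq_zero (isPreconnected_compl_lattice L)
      (fun z hz => (hd z hz).differentiableAt.differentiableWithinAt) (fun z hz => (hd z hz).deriv)
      hzz hne
    change _ = c at this
    rw [← this]
    have h2 := sigma_ne_zero hzz
    have h3 : Complex.exp (-η * z) * Complex.exp (η * z) = 1 := by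
      rw [← Complex.exp_add]; simp
    generalize Complex.exp (-η * z) = A at h3 ⊢
    generalize Complex.exp (η * z) = B at h3 ⊢
    field_simp
    linear_combination (-sigma L (z + w)) * h3

lemma tendsto_div_sigma (L : PeriodPair) : Tendsto (fun x => x / sigma L x) (𝓝[≠] 0) (𝓝 1) := by
  have h : ContinuousAt (fun x => (sigmaProd L x)⁻¹) 0 :=
    (differentiable_sigmaProd L).continuous.continuousAt.inv₀ (by rw [sigmaProd_zero]; simp)
  have h2 := h.tendsto
  rw [sigmaProd_zero, inv_one] at h2
  refine (h2.mono_left nhdsWithin_le_nhds).congr' ?_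
  filter_upwards [self_mem_nhdsWithin] with x hx
  have hx : x ≠ 0 := hx
  rw [sigma_eq, ← div_div, div_self hx, one_div]

lemma differentiableAt_sigma {x : ℂ} : DifferentiableAt ℂ (sigma L) x := differentiable_sigma L x

/-- The three-term identity of the sigma function. -/
theorem sigma_add_mul_sigma_sub {x y : ℂ} (hx : x ∉ L.lattice) (hy : y ∉ L.lattice) :
    sigma L (x + y) * sigma L (x - y) =
      -(sigma L x ^ 2 * sigma L y ^ 2 * (L.weierstrassP x - L.weierstrassP y)) := by
  -- Divided by `σ(x)²`, the two sides differ by an even elliptic function without poles.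
  set k : ℂ → ℂ := fun x => sigma L (x + y) * sigma L (x - y) / sigma L x ^ 2
    + sigma L y ^ 2 * L.weierstrassP x with hk
  obtain ⟨c, hc⟩ := exists_eq_of_periodic_even (L := L) (f := k) (fun z w hw => by
      obtain ⟨η, c, hc0, hc, -⟩ := exists_quasiPeriod hw
      simp only [hk, weierstrassP_add z hw]
      rw [show z + w + y = z + y + w by ring, show z + w - y = z - y + w by ring, hc, hc, hc]
      congr 1
      have e : Complex.exp (η * (z + y)) * Complex.exp (η * (z - y)) = Complex.exp (η * z) ^ 2 := by
        rw [← Complex.exp_add, ← Complex.exp_nat_mul]; congr 1; push_cast; ring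
      have h0 : (c * Complex.exp (η * z)) ^ 2 ≠ 0 :=
        pow_ne_zero 2 (mul_ne_zero hc0 (Complex.exp_ne_zero _))
      rw [← mul_div_mul_left (sigma L (z + y) * sigma L (z - y)) (sigma L z ^ 2) h0]
      congr 1
      · linear_combination c ^ 2 * sigma L (z + y) * sigma L (z - y) * e
      · ring) (fun x hx => by
      have h1 := (hasDerivAt_weierstrassP hx).differentiableAt
      have h2 := differentiable_sigma L
      exact (((h2.comp (differentiable_id.add_const y)).mul
        (h2.comp (differentiable_id.sub_const y)) x).fun_div ((h2 x).pow 2)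
          (pow_ne_zero 2 (sigma_ne_zero hx))).add (h1.const_mul _)) (fun x => by
      simp only [hk, L.weierstrassP_neg, sigma_neg]
      rw [show -x + y = -(x - y) by ring, show -x - y = -(x + y) by ring, sigma_neg, sigma_neg]
      congr 1
      rw [neg_sq]; congr 1; ring) (by
      have h1 := (tendsto_div_sigma L).pow 2
      have h2 : ContinuousAt (fun x => sigma L (x + y) * sigma L (x - y)) 0 := by
        have h2 := (differentiable_sigma L).continuous
        fun_prop
      have h3 := (h2.tendsto.mono_left (nhdsWithin_le_nhds (s := {0}ᶜ))).mul h1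
      have h4 := h3.add ((tendsto_sq_mul_weierstrassP L).const_mul (sigma L y ^ 2))
      have e : sigma L (0 + y) * sigma L (0 - y) * 1 ^ 2 + sigma L y ^ 2 * 1 = 0 := by
        rw [zero_add, zero_sub, sigma_neg]; ring
      rw [e] at h4
      refine h4.congr fun x => ?_
      simp only [hk]; ring)
  have h1 := hc x hx
  have h2 := hc y hy
  simp only [hk, sub_self, (sigma_eq_zero_iff L).mpr (zero_mem L.lattice), mul_zero, zero_div,
    zero_add] at h1 h2
  rw [← h2] at h1
  have := sigma_ne_zero hx
  field_simp at h1
  linear_combination h1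

lemma add_sub_notMem {x y : ℂ} (hx : x ∉ L.lattice) (hy : y ∉ L.lattice)
    (h : L.weierstrassP x ≠ L.weierstrassP y) : x + y ∉ L.lattice ∧ x - y ∉ L.lattice := by
  have h1 := sigma_add_mul_sigma_sub hx hy
  have h2 : sigma L (x + y) * sigma L (x - y) ≠ 0 := by
    rw [h1, neg_ne_zero]
    exact mul_ne_zero (mul_ne_zero (pow_ne_zero 2 (sigma_ne_zero hx))
      (pow_ne_zero 2 (sigma_ne_zero hy))) (sub_ne_zero.mpr h)
  exact ⟨fun h3 => left_ne_zero_of_mul h2 ((sigma_eq_zero_iff L).mpr h3),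
    fun h3 => right_ne_zero_of_mul h2 ((sigma_eq_zero_iff L).mpr h3)⟩

lemma zeta_add_add_zeta_sub {x y : ℂ} (hx : x ∉ L.lattice) (hy : y ∉ L.lattice)
    (h : L.weierstrassP x ≠ L.weierstrassP y) : zeta L (x + y) + zeta L (x - y) - 2 * zeta L x =
      L.derivWeierstrassP x / (L.weierstrassP x - L.weierstrassP y) := by
  obtain ⟨ha, hs⟩ := add_sub_notMem hx hy h
  have h1 := ((hasDerivAt_sigma ha).comp_add_const x y).fun_mul
    ((hasDerivAt_sigma hs).comp_sub_const x y)
  have h2 := (((hasDerivAt_sigma hx).fun_pow 2).mul_const (sigma L y ^ 2)).fun_mul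
    ((hasDerivAt_weierstrassP hx).sub_const (L.weierstrassP y)) |>.fun_neg
  have h3 := h2.unique (h1.congr_of_eventuallyEq (by
    filter_upwards [(isOpen_compl_lattice L).mem_nhds hx] with t ht
    exact (sigma_add_mul_sigma_sub ht hy).symm))
  have h4 := sigma_add_mul_sigma_sub hx hy
  have hsub := sub_ne_zero.mpr h
  have k1 := sigma_ne_zero hx
  have k2 := sigma_ne_zero hy
  simp at h3
  rw [eq_div_iff hsub]
  apply mul_left_cancel₀ (mul_ne_zero (pow_ne_zero 2 k1) (pow_ne_zero 2 k2))
  linear_combination h3 + (zeta L (x + y) + zeta L (x - y)) * h4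

lemma zeta_add_sub_zeta_sub {x y : ℂ} (hx : x ∉ L.lattice) (hy : y ∉ L.lattice)
    (h : L.weierstrassP x ≠ L.weierstrassP y) : zeta L (x + y) - zeta L (x - y) - 2 * zeta L y =
      -L.derivWeierstrassP y / (L.weierstrassP x - L.weierstrassP y) := by
  have h' := zeta_add_add_zeta_sub hy hx h.symm
  have e : zeta L (y - x) = -zeta L (x - y) := by
    have hs := (add_sub_notMem hx hy h).2
    have h1 := (hasDerivAt_sigma (L := L) (x := -(x - y)) (by rwa [neg_mem_iff])).comp
      (x - y) (hasDerivAt_neg (x - y))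
    have h2 := (hasDerivAt_sigma hs).fun_neg
    have h3 := h1.unique (h2.congr_of_eventuallyEq (.of_forall fun t => sigma_neg L t))
    have h4 := sigma_ne_zero hs
    rw [sigma_neg, neg_sub] at h3
    apply mul_left_cancel₀ h4
    linear_combination h3
  rw [e, add_comm y x] at h'
  rw [← neg_sub (L.weierstrassP y), neg_div_neg_eq, ← h']; ring

/-- The addition theorem of the zeta function. -/
theorem zeta_add {x y : ℂ} (hx : x ∉ L.lattice) (hy : y ∉ L.lattice)
    (h : L.weierstrassP x ≠ L.weierstrassP y) : zeta L (x + y) = zeta L x + zeta L y +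
      (L.derivWeierstrassP x - L.derivWeierstrassP y) /
        (2 * (L.weierstrassP x - L.weierstrassP y)) := by
  have h1 := zeta_add_add_zeta_sub hx hy h
  have h2 := zeta_add_sub_zeta_sub hx hy h
  have hsub := sub_ne_zero.mpr h
  field_simp at h1 h2 ⊢
  linear_combination h1 + h2

/-- `℘(x - y) + ℘(x + y)` as a rational function of `℘(x)` and `℘(y)`. -/
theorem weierstrassP_sub_add_weierstrassP_add {x y : ℂ} (hx : x ∈ offHalf L) (hy : y ∉ L.lattice)
    (h : L.weierstrassP x ≠ L.weierstrassP y) :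
    (L.weierstrassP (x - y) + L.weierstrassP (x + y)) * (L.weierstrassP x - L.weierstrassP y) ^ 2
      = 2 * L.weierstrassP x * (L.weierstrassP x - L.weierstrassP y) ^ 2
        - 2 * (derivative (rootPoly L)).eval (L.weierstrassP x)
          * (L.weierstrassP x - L.weierstrassP y) + 4 * (rootPoly L).eval (L.weierstrassP x) := by
  have hx0 := notMem_of_mem_offHalf hx
  obtain ⟨ha, hs⟩ := add_sub_notMem hx0 hy h
  have hsub := sub_ne_zero.mpr h
  have h1 := (((hasDerivAt_zeta L ha).comp_add_const x y).fun_add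
    ((hasDerivAt_zeta L hs).comp_sub_const x y)).fun_sub ((hasDerivAt_zeta L hx0).const_mul 2)
  have h2 := (hasDerivAt_derivWeierstrassP hx).fun_div
    ((hasDerivAt_weierstrassP hx0).sub_const (L.weierstrassP y)) hsub
  have hne : ∀ᶠ t in 𝓝 x, L.weierstrassP t ≠ L.weierstrassP y :=
    (analyticAt_weierstrassP hx0).continuousAt.eventually_ne h
  have h3 := h2.unique (h1.congr_of_eventuallyEq (by
    filter_upwards [(isOpen_compl_lattice L).mem_nhds hx0, hne] with t ht ht2
    exact (zeta_add_add_zeta_sub ht hy ht2).symm))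
  have h4 := derivWeierstrassP_sq_eq hx0
  field_simp at h3
  linear_combination h3 + h4

/-- There is no elliptic function with a single simple pole. -/
theorem eq_zero_of_tendsto_mul {f : ℂ → ℂ} {c : ℂ}
    (hper : ∀ z, ∀ w ∈ L.lattice, f (z + w) = f z)
    (hd : ∀ x, x ∉ L.lattice → DifferentiableAt ℂ f x)
    (h0 : Tendsto (fun y => y * f y) (𝓝[≠] 0) (𝓝 c)) : c = 0 := by
  -- The square of the odd part `h / 2` differs from `c² ℘` by a constant. As `h` vanishes at the
  -- half periods, where `℘` takes different values, `c = 0`.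
  set h : ℂ → ℂ := fun x => f x - f (-x) with hh
  have hneg : Tendsto (fun y : ℂ => -y) (𝓝[≠] 0) (𝓝[≠] 0) := by
    refine tendsto_nhdsWithin_of_tendsto_nhds_of_eventually_within _ ?_ ?_
    · have : ContinuousAt (fun y : ℂ => -y) 0 := by fun_prop
      simpa using this.tendsto.mono_left (nhdsWithin_le_nhds (s := {0}ᶜ))
    · filter_upwards [self_mem_nhdsWithin] with y hy
      simpa using hy
  have hd' : ∀ x, x ∉ L.lattice → DifferentiableAt ℂ h x := fun x hx =>
    (hd x hx).sub (DifferentiableAt.comp (f := fun x => -x) x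
      (hd (-x) (by rwa [neg_mem_iff])) (by fun_prop))
  obtain ⟨K, hK⟩ := exists_eq_of_periodic_even (L := L)
    (f := fun x => h x ^ 2 - 4 * c ^ 2 * L.weierstrassP x) (fun z w hw => by
      have h1 : f (-(z + w)) = f (-z) := by
        rw [← hper (-(z + w)) w hw]; congr 1; ring
      simp only [hh, hper z w hw, h1, weierstrassP_add z hw]) (fun x hx =>
        ((hd' x hx).pow 2).sub ((analyticAt_weierstrassP hx).differentiableAt.const_mul _))
    (fun x => by simp only [hh, neg_neg, L.weierstrassP_neg]; ring) (by
      have h1 := (h0.add (h0.comp hneg)).pow 2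
      have h2 := h1.sub ((tendsto_sq_mul_weierstrassP L).const_mul (4 * c ^ 2))
      have e : (c + c) ^ 2 - 4 * c ^ 2 * 1 = 0 := by ring
      rw [e] at h2
      refine h2.congr fun x => ?_
      simp only [hh, Function.comp]; ring)
  have hz : ∀ i : Fin 3, h (halfPeriod L i.succ) = 0 := fun i => by
    have := hper (-halfPeriod L i.succ) _ (two_mul_halfPeriod_mem L i.succ)
    simp only [hh]
    rw [← this, sub_eq_zero]; congr 1; ring
  have h1 := hK _ (halfPeriod_notMem L 0)
  have h2 := hK _ (halfPeriod_notMem L 1)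
  simp only [hz] at h1 h2
  have h3 : c ^ 2 * (roots L 0 - roots L 1) = 0 := by
    simp only [roots, e]; linear_combination (h2 - h1) / 4
  have := (mul_eq_zero.mp h3).resolve_right (sub_ne_zero.mpr (roots_ne L).1)
  exact pow_eq_zero_iff two_ne_zero |>.mp this

/-- A function `exp (s x) σ(x + β) / σ(x)` is elliptic only if `β` is a period and the function is
constant. -/
theorem mem_lattice_of_periodic {s β : ℂ}
    (hper : ∀ z, ∀ w ∈ L.lattice, Complex.exp (s * (z + w)) * sigma L (z + w + β) / sigma L (z + w)
      = Complex.exp (s * z) * sigma L (z + β) / sigma L z) :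
    β ∈ L.lattice ∧ ∀ z, z ∉ L.lattice → zeta L (z + β) = zeta L z - s := by
  set f : ℂ → ℂ := fun z => Complex.exp (s * z) * sigma L (z + β) / sigma L z with hf
  have hder : ∀ z, z ∉ L.lattice → HasDerivAt (fun z => Complex.exp (s * z))
      (Complex.exp (s * z) * s) z := fun z _ => by
    simpa using ((hasDerivAt_id z).const_mul s).cexp
  have hd : ∀ x, x ∉ L.lattice → DifferentiableAt ℂ f x := fun x hx =>
    ((hder x hx).differentiableAt.mul (DifferentiableAt.comp (f := fun x => x + β) x
      differentiableAt_sigma (by fun_prop))).fun_div differentiableAt_sigma (sigma_ne_zero hx)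
  have hlim : Tendsto (fun y => y * f y) (𝓝[≠] 0) (𝓝 (sigma L β)) := by
    have h1 : ContinuousAt (fun z => Complex.exp (s * z) * sigma L (z + β)) 0 := by
      have h2 := (differentiable_sigma L).continuous
      fun_prop
    have h3 := (h1.tendsto.mono_left (nhdsWithin_le_nhds (s := {0}ᶜ))).mul (tendsto_div_sigma L)
    have e : Complex.exp (s * 0) * sigma L (0 + β) * 1 = sigma L β := by simp
    rw [e] at h3
    refine h3.congr fun x => ?_
    simp only [hf]; ring
  have hs := eq_zero_of_tendsto_mul hper hd hlim
  have hβ := (sigma_eq_zero_iff L).mp hs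
  rw [hs] at hlim
  obtain ⟨c, hc⟩ := exists_eq_of_periodic' hper hd hlim
  refine ⟨hβ, fun z hz => ?_⟩
  have h1 := ((hder z hz).fun_mul
    ((hasDerivAt_sigma (add_notMem hz hβ)).comp_add_const z β)).fun_div
    (hasDerivAt_sigma hz) (sigma_ne_zero hz)
  have h2 := h1.unique ((hasDerivAt_const z c).congr_of_eventuallyEq (by
    filter_upwards [(isOpen_compl_lattice L).mem_nhds hz] with t ht using hc t ht))
  have k1 := sigma_ne_zero hz
  have k2 := sigma_ne_zero (add_notMem hz hβ)
  have k3 := Complex.exp_ne_zero (s * z)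
  rw [div_eq_zero_iff, or_iff_left (pow_ne_zero 2 k1)] at h2
  apply mul_left_cancel₀ (mul_ne_zero (mul_ne_zero k3 k1) k2)
  linear_combination h2

end Addition
end HKAnsatz

namespace HKAnsatz
open Polynomial
namespace Params

/-! ### Specialisation of the universal solution along a line -/

section Order

variable {R : Type*} [CommRing R] [IsDomain R] [WfDvdMonoid R] {p : R}

/-- The common power of a prime in a pair. -/
lemma exists_pair_eq_pow_mul (hp : Prime p) {a b : R} (h : a ≠ 0 ∨ b ≠ 0) :
    ∃ (n : ℕ) (a' b' : R), a = p ^ n * a' ∧ b = p ^ n * b' ∧ (¬ p ∣ a' ∨ ¬ p ∣ b') := by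
  by_cases ha : a = 0
  · obtain ⟨n, b', hb', rfl⟩ := WfDvdMonoid.max_power_factor (h.resolve_left (not_not.mpr ha))
      hp.irreducible
    exact ⟨n, 0, b', by simp [ha], rfl, .inr hb'⟩
  by_cases hb : b = 0
  · obtain ⟨n, a', ha', rfl⟩ := WfDvdMonoid.max_power_factor ha hp.irreducible
    exact ⟨n, a', 0, rfl, by simp [hb], .inl ha'⟩
  obtain ⟨n, a', ha', rfl⟩ := WfDvdMonoid.max_power_factor ha hp.irreducible
  obtain ⟨m, b', hb', rfl⟩ := WfDvdMonoid.max_power_factor hb hp.irreducible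
  rcases le_total n m with hnm | hnm
  · exact ⟨n, a', p ^ (m - n) * b', rfl, by rw [← mul_assoc, ← pow_add, Nat.add_sub_cancel' hnm],
      .inl ha'⟩
  · exact ⟨m, p ^ (n - m) * a', b', by rw [← mul_assoc, ← pow_add, Nat.add_sub_cancel' hnm], rfl,
      .inr hb'⟩

omit [WfDvdMonoid R] in
lemma le_of_pow_mul_eq (hp : Prime p) {a b : ℕ} {u v : R} (hv : ¬ p ∣ v)
    (h : p ^ a * u = p ^ b * v) : a ≤ b := by
  by_contra hab
  rw [not_le] at hab
  have h2 : p ^ b * (p ^ (a - b) * u) = p ^ b * v := by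
    rw [← mul_assoc, ← pow_add, Nat.add_sub_cancel' hab.le, h]
  refine hv ⟨p ^ (a - b - 1) * u, ?_⟩
  rw [← mul_left_cancel₀ (pow_ne_zero b hp.ne_zero) h2, ← mul_assoc, ← pow_succ']
  congr 2; omega

omit [WfDvdMonoid R] in
lemma eq_of_pow_mul_eq (hp : Prime p) {a b : ℕ} {u v : R} (hu : ¬ p ∣ u) (hv : ¬ p ∣ v)
    (h : p ^ a * u = p ^ b * v) : a = b :=
  le_antisymm (le_of_pow_mul_eq hp hv h) (le_of_pow_mul_eq hp hu h.symm)

end Order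

section Spec

lemma prime_C_X : Prime (C X : ℂ[X][X]) := prime_C_iff.mpr prime_X

lemma C_X_dvd_iff {F : ℂ[X][X]} : C X ∣ F ↔ F.map (evalRingHom 0) = 0 := by
  rw [C_dvd_iff_dvd_coeff, Polynomial.ext_iff]
  refine forall_congr' fun n => ?_
  rw [X_dvd_iff, coeff_map, coe_evalRingHom, coeff_zero_eq_eval_zero, coeff_zero]

lemma X_dvd_iff_eval {f : ℂ[X]} : X ∣ f ↔ f.eval 0 = 0 := by
  rw [X_dvd_iff, coeff_zero_eq_eval_zero]

/-- The value of a polynomial in `b` and `μ`; the inner variable is `b`. -/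
noncomputable def evalPair (b μ : ℂ) : ℂ[X][X] →+* ℂ := eval₂RingHom (evalRingHom b) μ

/-- Substitution of `(b + v s², μ + w s²)` for the two variables, `s` being a new variable. The
square makes the pull-back of every polynomial even in `s`. -/
noncomputable def lineHom (b μ v w : ℂ) : ℂ[X][X] →+* ℂ[X] :=
  eval₂RingHom (eval₂RingHom C (C b + C v * X ^ 2)) (C μ + C w * X ^ 2)

lemma evalRingHom_comp_lineHom (b μ v w t : ℂ) :
    (evalRingHom t).comp (lineHom b μ v w) = evalPair (b + v * t ^ 2) (μ + w * t ^ 2) := by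
  refine Polynomial.ringHom_ext' (Polynomial.ringHom_ext (fun a => ?_) ?_) ?_ <;>
    simp [lineHom, evalPair]

lemma eval_lineHom (b μ v w t : ℂ) (F : ℂ[X][X]) :
    (lineHom b μ v w F).eval t = evalPair (b + v * t ^ 2) (μ + w * t ^ 2) F := by
  rw [← evalRingHom_comp_lineHom]; rfl

lemma eval_zero_lineHom (b μ v w : ℂ) (F : ℂ[X][X]) :
    (lineHom b μ v w F).eval 0 = evalPair b μ F := by
  rw [eval_lineHom]; simp

lemma lineHom_comp_neg (b μ v w : ℂ) (F : ℂ[X][X]) :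
    (lineHom b μ v w F).comp (-X) = lineHom b μ v w F := by
  apply Polynomial.funext
  intro t
  rw [eval_comp, eval_lineHom, eval_lineHom]
  simp

lemma exists_evalPair_ne_zero {G : ℂ[X][X]} (hG : G ≠ 0) : ∃ b μ, evalPair b μ G ≠ 0 := by
  by_contra! h
  apply hG
  ext1 n
  apply Polynomial.funext
  intro b
  have : G.map (evalRingHom b) = 0 := by
    apply Polynomial.funext
    intro μ
    rw [eval_map, eval_zero]
    exact h b μ
  simpa using congrArg (fun F => F.coeff n) this

lemma exists_lineHom_ne_zero {G : ℂ[X][X]} (hG : G ≠ 0) (b μ : ℂ) :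
    ∃ v w, lineHom b μ v w G ≠ 0 := by
  obtain ⟨b', μ', h⟩ := exists_evalPair_ne_zero hG
  refine ⟨b' - b, μ' - μ, fun h0 => h ?_⟩
  have := eval_lineHom b μ (b' - b) (μ' - μ) 1 G
  rw [h0] at this
  simpa using this.symm

/-- An even polynomial vanishes at the origin to even order. -/
lemma even_of_comp_neg {Q Q' : ℂ[X]} {m : ℕ} (hQ : Q.comp (-X) = Q) (h : Q = X ^ m * Q')
    (h0 : Q'.eval 0 ≠ 0) : Even m := by
  by_contra hm
  rw [Nat.not_even_iff_odd] at hm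
  have h1 : (X : ℂ[X]) ^ m * -(Q'.comp (-X)) = X ^ m * Q' := by
    rw [← h, ← hQ, h, mul_comp, X_pow_comp, hm.neg_pow]; ring
  have h2 := mul_left_cancel₀ (pow_ne_zero m X_ne_zero) h1
  apply h0
  have h3 := congrArg (eval 0) h2
  simp only [eval_neg, eval_comp, eval_X, neg_zero] at h3
  exact self_eq_neg.mp h3.symm

lemma quad_C_mul {A : Type*} [CommRing A] (d : Params A) (c : A) (F : A[X]) :
    d.quad (C c * F) = C (c ^ 2) * d.quad F := by
  simp only [quad, ← smul_eq_C_mul, map_smul]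
  simp only [smul_eq_C_mul, C_pow]
  ring

lemma symOp_C_mul {A : Type*} [CommRing A] (d : Params A) (c : A) (F : A[X]) :
    d.symOp (C c * F) = C c * d.symOp F := by
  simp only [← smul_eq_C_mul, map_smul]

/-- The norm form of `sqPart` and `cosqPart` is anisotropic, since the sum of their degrees is odd.
-/
lemma sqPart_mul_sq_sub_ne_zero {k : Type*} [Field k] [CharZero k] (d : Params k)
    (o : Option (Fin 3)) {p r : k[X]}
    (h : p ≠ 0 ∨ r ≠ 0) : d.sqPart o * p ^ 2 - 4 * d.cosqPart o * r ^ 2 ≠ 0 := by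
  intro h0
  have h1 : d.sqPart o * p ^ 2 = C 4 * (d.cosqPart o * r ^ 2) := by
    rw [C_ofNat]; linear_combination h0
  have hsq : (d.sqPart o).Monic ∧ (d.cosqPart o).Monic ∧
      Odd ((d.sqPart o).natDegree + (d.cosqPart o).natDegree) := by
    cases o with
    | none =>
      have : (d.chat).Monic := monic_prod_of_monic _ _ fun i _ => monic_X_sub_C _
      refine ⟨monic_one, this, ?_⟩
      have h3 : d.chat.natDegree = 3 := by
        rw [chat, natDegree_prod_of_monic _ _ fun i _ => monic_X_sub_C _]; simp
      simp only [sqPart, cosqPart, Option.elim, natDegree_one, h3]; decide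
    | some i =>
      refine ⟨monic_X_sub_C _, (monic_X_sub_C _).mul (monic_X_sub_C _), ?_⟩
      have h3 : (d.chatAt i).natDegree = 2 := by
        rw [chatAt, (monic_X_sub_C _).natDegree_mul (monic_X_sub_C _)]; simp
      simp only [sqPart, cosqPart, Option.elim, natDegree_X_sub_C, h3]; decide
  obtain ⟨m1, m2, hodd⟩ := hsq
  have hp : p ≠ 0 := by
    rintro rfl
    have hr := h.resolve_left (by simp)
    rw [zero_pow two_ne_zero, mul_zero, eq_comm, mul_eq_zero, or_iff_right (by simp)] at h1
    exact mul_ne_zero m2.ne_zero (pow_ne_zero 2 hr) h1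
  have hr : r ≠ 0 := by
    rintro rfl
    rw [zero_pow two_ne_zero, mul_zero, mul_zero] at h1
    exact mul_ne_zero m1.ne_zero (pow_ne_zero 2 hp) h1
  have h2 := congrArg natDegree h1
  rw [natDegree_C_mul (by norm_num), natDegree_mul m1.ne_zero (pow_ne_zero 2 hp),
    natDegree_mul m2.ne_zero (pow_ne_zero 2 hr), natDegree_pow, natDegree_pow] at h2
  rw [Nat.odd_iff] at hodd
  omega

lemma universal_map (e : Fin 3 → ℂ) (l : Fin 3 → ℕ) (l₀ : ℕ) (b μ : ℂ) :
    (universal e l l₀).map (evalPair b μ) = ⟨e, b, μ, l, l₀⟩ := by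
  simp only [map, universal, generic, evalPair]
  congr 1 <;> simp

lemma wnum_C_mul {A : Type*} [CommRing A] (h g P R : A[X]) (c c' : A) :
    wnum h g (C c * P) (C c' * R) = C (c * c') * wnum h g P R := by
  simp only [wnum, derivative_mul, derivative_C, zero_mul, zero_add, C_mul]; ring

/-- The line data of a solution at a point, as limits of the line data of the universal solution
along a line through the point. The universal solution, its first integral and its line may all
vanish at the point; each is divided by the power of the line parameter that it contains, and the
limit of the solution is identified with the given one by uniqueness. The square root of the first
integral can be extracted along the line since the parameter `s` enters only through `s²`. The last
three clauses say that the limits of the quotients of the universal data are computed by the data at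
the point; they determine the values of reduced fractions. -/
theorem exists_line_data_at (e : Fin 3 → ℂ) (l : Fin 3 → ℕ) (l₀ : ℕ) (o : Option (Fin 3))
    {d : Params ℂ[X][X]} (hd : d = universal e l l₀)
    {U P R : ℂ[X][X][X]} {Q ν₁ ν₀ x₁ x₀ : ℂ[X][X]}
    (hU : d.symOp U = 0) (hUn : U.natDegree ≤ d.degDen + l₀) (hQ : d.quad U = C Q * d.zden)
    (hQ0 : Q ≠ 0) (hν : ν₁ ≠ 0 ∨ ν₀ ≠ 0)
    (h1 : d.sqPart o * P ^ 2 + 4 * d.cosqPart o * C Q * R ^ 2 = U * (C ν₁ * X + C ν₀))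
    (h2 : d.den * (C ν₁ * X + C ν₀) - wnum (d.sqPart o) (d.cosqPart o) P R
        = U * (C x₁ * X + C x₀))
    (h3 : ν₁ = 0 → x₁ = 0)
    (h4 : ν₁ ≠ 0 → ν₁ * ∏ i, (ν₀ + d.e i * ν₁) = Q * (x₀ * ν₁ - x₁ * ν₀) ^ 2)
    {b μ : ℂ} {D : Params ℂ} (hD : D = ⟨e, b, μ, l, l₀⟩) (hreg : D.Regular) {V : ℂ[X]}
    (hV : D.symOp V = 0) (hVn : V.natDegree ≤ D.degDen + l₀) (hV0 : V ≠ 0) {QV q : ℂ}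
    (hQV : D.quad V = C QV * D.zden) (hq : q ^ 2 = -QV) :
    ∃ (p r : ℂ[X]) (n₁ n₀ y₁ y₀ : ℂ), (n₁ ≠ 0 ∨ n₀ ≠ 0) ∧
      D.sqPart o * p ^ 2 - 4 * D.cosqPart o * r ^ 2 = V * (C n₁ * X + C n₀) ∧
      C q * D.den * (C n₁ * X + C n₀) - wnum (D.sqPart o) (D.cosqPart o) p r
        = V * (C y₁ * X + C y₀) ∧
      n₁ * ∏ i, (n₀ + e i * n₁) = -(y₀ * n₁ - y₁ * n₀) ^ 2 ∧
      (∀ N F : ℂ[X][X], N * ν₁ = -ν₀ * F → evalPair b μ N * n₁ = -n₀ * evalPair b μ F) ∧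
      (∀ N F : ℂ[X][X], N * (d.gauge.eval d.b * ν₁) = F * (U.eval d.b * x₁) →
        q * (D.gauge.eval b * n₁) * evalPair b μ N = V.eval b * y₁ * evalPair b μ F) ∧
      (∀ N F : ℂ[X][X], N * (d.gauge.eval d.b * ν₁ ^ 2) =
          F * (U.eval d.b * (x₀ * ν₁ - x₁ * ν₀)) →
        q * (D.gauge.eval b * n₁ ^ 2) * evalPair b μ N
          = V.eval b * (y₀ * n₁ - y₁ * n₀) * evalPair b μ F) := by
  -- a line on which the universal data do not degenerate identically
  obtain ⟨v, w, hvw⟩ : ∃ v w, lineHom b μ v w Q ≠ 0 ∧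
      (lineHom b μ v w ν₁ ≠ 0 ∨ lineHom b μ v w ν₀ ≠ 0) := by
    rcases hν with h | h
    · obtain ⟨v, w, hvw⟩ := exists_lineHom_ne_zero (mul_ne_zero hQ0 h) b μ
      rw [map_mul] at hvw
      exact ⟨v, w, left_ne_zero_of_mul hvw, .inl (right_ne_zero_of_mul hvw)⟩
    · obtain ⟨v, w, hvw⟩ := exists_lineHom_ne_zero (mul_ne_zero hQ0 h) b μ
      rw [map_mul] at hvw
      exact ⟨v, w, left_ne_zero_of_mul hvw, .inr (right_ne_zero_of_mul hvw)⟩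
  set ψ := lineHom b μ v w with hψ
  obtain ⟨hQψ, hνψ⟩ := hvw
  set ev : ℂ[X] →+* ℂ := evalRingHom 0 with hev
  have hevψ : ∀ F, ev (ψ F) = evalPair b μ F := fun F => eval_zero_lineHom b μ v w F
  set dψ := d.map ψ with hdψ
  have hDψ : dψ.map ev = D := by
    rw [hdψ, map_map, hev, evalRingHom_comp_lineHom, hD, hd]
    simpa using universal_map e l l₀ b μ
  have hzden : dψ.zden ≠ 0 := (monic_zden dψ).ne_zero
  have hevX : ev X = 0 := by simp [hev]
  -- the solution: `U` pulls back to `X ^ j * Uh`, and `Q` to an even power `X ^ (2 m)` times `Qh`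
  have hUψ0 : U.map ψ ≠ 0 := by
    intro h
    have := map_quad_eq (φ := ψ) hQ
    rw [h] at this
    have h0 : (d.map ψ).quad 0 = 0 := by simp [quad]
    rw [h0, eq_comm, mul_eq_zero, C_eq_zero] at this
    exact this.elim hQψ hzden
  obtain ⟨j, Uh, hUh0, hUh⟩ := WfDvdMonoid.max_power_factor hUψ0 prime_C_X.irreducible
  rw [← C_pow] at hUh
  have hXpow : ∀ n : ℕ, (X : ℂ[X]) ^ n ≠ 0 := fun n => pow_ne_zero n X_ne_zero
  have hCXpow : ∀ n : ℕ, (C (X ^ n) : ℂ[X][X]) ≠ 0 := fun n => C_ne_zero.mpr (hXpow n)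
  have hUhs : dψ.symOp Uh = 0 := by
    have := map_solution (φ := ψ) hU
    rw [hUh, symOp_C_mul, mul_eq_zero] at this
    exact this.resolve_left (hCXpow j)
  obtain ⟨Qu, hQu⟩ := exists_quad_eq hUhs
  obtain ⟨m', Qh, hQh0, hQh⟩ := WfDvdMonoid.max_power_factor hQψ prime_X.irreducible
  obtain ⟨m, hm⟩ := even_of_comp_neg (lineHom_comp_neg b μ v w Q) hQh
    (by rwa [Ne, ← X_dvd_iff_eval])
  have hm2 : m' = m * 2 := by omega
  rw [hm2, pow_mul] at hQh
  have hQuh : (X ^ j) ^ 2 * Qu = (X ^ m) ^ 2 * Qh := by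
    rw [← hQh]
    apply C_injective
    apply mul_right_cancel₀ hzden
    rw [← map_quad_eq (φ := ψ) hQ, hUh, quad_C_mul]
    change _ = C ((X ^ j) ^ 2) * dψ.quad Uh
    rw [hQu, C_mul, mul_assoc]
  have hjm : j ≤ m := by
    rw [← pow_mul, ← pow_mul] at hQuh
    have := le_of_pow_mul_eq prime_X hQh0 hQuh
    omega
  have hQuh' : Qu = (X ^ (m - j)) ^ 2 * Qh := by
    apply mul_left_cancel₀ (pow_ne_zero 2 (hXpow j))
    rw [hQuh, ← mul_assoc, ← mul_pow, ← pow_add, Nat.add_sub_cancel' hjm]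
  set U0 := Uh.map ev with hU0
  have hU0ne : U0 ≠ 0 := fun h => hUh0 (C_X_dvd_iff.mpr h)
  have hU0s : D.symOp U0 = 0 := by rw [← hDψ]; exact map_solution hUhs
  have hU0n : U0.natDegree ≤ D.degDen + l₀ := by
    refine natDegree_map_le.trans ?_
    have : (U.map ψ).natDegree = Uh.natDegree := by rw [hUh, natDegree_C_mul (hXpow j)]
    rw [← this]
    refine natDegree_map_le.trans (hUn.trans ?_)
    rw [← hDψ]; rfl
  have hl₀ : D.l₀ = l₀ := by rw [hD]
  obtain ⟨c, hc⟩ := hreg.proportional hV hU0s (by rwa [hl₀]) (by rwa [hl₀]) hU0ne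
  have hc0 : c ≠ 0 := by rintro rfl; exact hV0 (by rw [hc]; simp)
  have hQVc : QV = c ^ 2 * ev Qu := by
    apply C_injective
    apply mul_right_cancel₀ (monic_zden D).ne_zero
    have : D.quad U0 = C (ev Qu) * D.zden := by rw [← hDψ]; exact map_quad_eq hQu
    rw [← hQV, hc, quad_C_mul, this, C_mul, mul_assoc]
  -- A square root `q₀` of the nonzero limit of `-Qh`. If `j < m`, the first integral of the limit
  -- vanishes, so `q = 0` and the sign of `q₀` is arbitrary.
  obtain ⟨q₀, hq₀, hqc⟩ : ∃ q₀ : ℂ, q₀ ^ 2 = -ev Qh ∧ q = c * (q₀ * ev (X ^ (m - j))) := by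
    rcases Nat.eq_or_lt_of_le hjm with hjm' | hjm'
    · have : m - j = 0 := by omega
      rw [this] at hQuh' ⊢
      refine ⟨q / c, ?_, by simp; field_simp⟩
      rw [div_pow, hq, hQVc, hQuh']
      simp; field_simp
    · obtain ⟨z, hz⟩ := IsAlgClosed.exists_pow_nat_eq (-ev Qh) two_pos
      have h0 : ev (X ^ (m - j)) = 0 := by rw [map_pow, hevX, zero_pow (by omega)]
      refine ⟨z, hz, ?_⟩
      rw [h0, mul_zero, mul_zero, ← pow_eq_zero_iff two_ne_zero, hq, hQVc, hQuh', map_mul,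
        map_pow, h0]
      simp
  have hq₀0 : q₀ ≠ 0 := by
    rintro rfl
    rw [zero_pow two_ne_zero, eq_comm, neg_eq_zero] at hq₀
    exact hQh0 (X_dvd_iff_eval.mpr hq₀)
  -- the line: its coefficients pull back to `X ^ i` times `n1`, `n0`, which do not both vanish at
  -- `0`
  obtain ⟨i, n1, n0, hn1, hn0, hn⟩ := exists_pair_eq_pow_mul prime_X hνψ
  have hlin0 : ¬ C X ∣ (C n1 * X + C n0 : ℂ[X][X]) := by
    rw [C_dvd_iff_dvd_coeff]
    intro h
    have c1 := h 1
    have c0 := h 0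
    simp at c1 c0
    exact hn.elim (fun h => h c1) (fun h => h c0)
  have hlin : (C (ψ ν₁) * X + C (ψ ν₀) : ℂ[X][X]) = C (X ^ i) * (C n1 * X + C n0) := by
    rw [hn1, hn0]; simp only [C_mul]; ring
  have H1 : dψ.sqPart o * (P.map ψ) ^ 2 + 4 * dψ.cosqPart o * C Qh * (C (X ^ m) * R.map ψ) ^ 2
      = C (X ^ (j + i)) * (Uh * (C n1 * X + C n0)) := by
    have := congrArg (Polynomial.map ψ) h1
    simp only [Polynomial.map_add, Polynomial.map_mul, Polynomial.map_pow, map_C, map_X,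
      ← map_sqPart, ← map_cosqPart, Polynomial.map_ofNat, hlin, hUh, hQh] at this
    simp only [C_mul, C_pow, pow_add] at this ⊢
    linear_combination this
  have hPR : P.map ψ ≠ 0 ∨ C (X ^ m) * R.map ψ ≠ 0 := by
    by_contra! h
    rw [h.1, h.2] at H1
    simp only [ne_eq, OfNat.ofNat_ne_zero, not_false_eq_true, zero_pow, mul_zero, add_zero] at H1
    refine mul_ne_zero (hCXpow (j + i)) (mul_ne_zero ?_ ?_) H1.symm
    · rintro rfl; exact hUh0 (dvd_zero _)
    · intro h0; exact hlin0 (h0 ▸ dvd_zero _)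
  -- the function: `P` and `X ^ m * R` pull back to `X ^ k` times `Ph`, `rh`
  obtain ⟨k, Ph, rh, hPh, hrh, hPr⟩ := exists_pair_eq_pow_mul prime_C_X hPR
  rw [← C_pow] at hPh hrh
  set p0 := Ph.map ev with hp0
  set r0 := C q₀ * rh.map ev with hr0
  have hpr : p0 ≠ 0 ∨ r0 ≠ 0 := hPr.imp (fun h h0 => h (C_X_dvd_iff.mpr h0))
    (fun h h0 => h (C_X_dvd_iff.mpr ((mul_eq_zero.mp h0).resolve_left (C_ne_zero.mpr hq₀0))))
  have hN0 := sqPart_mul_sq_sub_ne_zero D o hpr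
  have hNmap : (dψ.sqPart o * Ph ^ 2 + 4 * dψ.cosqPart o * C Qh * rh ^ 2).map ev =
      D.sqPart o * p0 ^ 2 - 4 * D.cosqPart o * r0 ^ 2 := by
    have hCq : (C (ev Qh) : ℂ[X]) = -C q₀ ^ 2 := by rw [← C_pow, hq₀]; simp
    simp only [Polynomial.map_add, Polynomial.map_mul, Polynomial.map_pow, map_C,
      ← map_sqPart, ← map_cosqPart, Polynomial.map_ofNat, hDψ, hCq, hp0, hr0]
    ring
  -- The limit of the norm is nonzero, so the powers of `X` on both sides of `H1` agree.
  have hk : k * 2 = j + i := by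
    refine eq_of_pow_mul_eq prime_C_X
      (u := dψ.sqPart o * Ph ^ 2 + 4 * dψ.cosqPart o * C Qh * rh ^ 2)
      (v := Uh * (C n1 * X + C n0)) ?_ ?_ ?_
    · rw [C_X_dvd_iff]; rw [← hev, hNmap]; exact hN0
    · intro h; exact (prime_C_X.dvd_or_dvd h).elim hUh0 hlin0
    · rw [← C_pow, ← C_pow, ← H1, hPh, hrh, pow_mul]
      simp only [C_pow]; ring
  have H1' : dψ.sqPart o * Ph ^ 2 + 4 * dψ.cosqPart o * C Qh * rh ^ 2 =
      Uh * (C n1 * X + C n0) := by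
    apply mul_left_cancel₀ (hCXpow (j + i))
    rw [← H1, hPh, hrh, ← hk, pow_mul]
    simp only [C_pow]; ring
  have H2 : C (X ^ i) * (C (X ^ (m - j)) * dψ.den * (C n1 * X + C n0)
      - wnum (dψ.sqPart o) (dψ.cosqPart o) Ph rh)
        = Uh * (C (X ^ m * ψ x₁) * X + C (X ^ m * ψ x₀)) := by
    have := congrArg (Polynomial.map ψ) h2
    simp only [Polynomial.map_add, Polynomial.map_mul, Polynomial.map_sub, map_C, map_X,
      ← map_sqPart, ← map_cosqPart, hlin, hUh, ← map_wnum, ← map_den] at this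
    have hw := wnum_C_mul (dψ.sqPart o) (dψ.cosqPart o) (P.map ψ) (R.map ψ) 1 (X ^ m)
    rw [hrh, C_1, one_mul, one_mul, hPh, wnum_C_mul, ← hPh] at hw
    have hj : (X : ℂ[X]) ^ m = X ^ j * X ^ (m - j) := by rw [← pow_add, Nat.add_sub_cancel' hjm]
    have hk' : (X : ℂ[X]) ^ k * X ^ k = X ^ j * X ^ i := by
      rw [← pow_add, ← pow_add]; congr 1; omega
    rw [hk'] at hw
    apply mul_left_cancel₀ (hCXpow j)
    rw [hj] at hw ⊢
    simp only [C_mul] at hw this ⊢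
    linear_combination C (X ^ j) * C (X ^ (m - j)) * this - hw
  have hdvd : C X ^ i ∣ (C (X ^ m * ψ x₁) * X + C (X ^ m * ψ x₀) : ℂ[X][X]) :=
    prime_C_X.pow_dvd_of_dvd_mul_left i hUh0 ⟨_, by rw [← H2, C_pow]⟩
  obtain ⟨⟨y1, hy1⟩, ⟨y0, hy0⟩⟩ : X ^ i ∣ X ^ m * ψ x₁ ∧ X ^ i ∣ X ^ m * ψ x₀ := by
    rw [← C_pow, C_dvd_iff_dvd_coeff] at hdvd
    have c1 := hdvd 1
    have c0 := hdvd 0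
    simp only [coeff_add, coeff_C_mul, coeff_X_one, mul_one, coeff_X_zero, mul_zero, zero_add,
      coeff_C_zero, coeff_C_succ, add_zero, coeff_C_of_ne_zero one_ne_zero] at c1 c0
    exact ⟨c1, c0⟩
  have H2' : C (X ^ (m - j)) * dψ.den * (C n1 * X + C n0)
      - wnum (dψ.sqPart o) (dψ.cosqPart o) Ph rh = Uh * (C y1 * X + C y0) := by
    apply mul_left_cancel₀ (hCXpow i)
    rw [H2, hy1, hy0]; simp only [C_mul]; ring
  -- the relation between the coefficients
  have hcross : X ^ m * (ψ x₀ * ψ ν₁ - ψ x₁ * ψ ν₀) = X ^ i * X ^ i * (y0 * n1 - y1 * n0) := by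
    rw [hn1, hn0]
    linear_combination X ^ i * n1 * hy0 - X ^ i * n0 * hy1
  have hrel : ν₁ * ∏ i, (ν₀ + d.e i * ν₁) = Q * (x₀ * ν₁ - x₁ * ν₀) ^ 2 := by
    by_cases h : ν₁ = 0
    · rw [h, h3 h]; ring
    · exact h4 h
  have hde : ∀ t, ψ (d.e t) = C (e t) := fun t => by
    rw [hd, hψ]; simp [universal, generic, lineHom]
  have H4 : n1 * ∏ t, (n0 + C (e t) * n1) = Qh * (y0 * n1 - y1 * n0) ^ 2 := by
    have := congrArg ψ hrel
    simp only [map_mul, map_prod, map_add, map_pow, map_sub, hde, hQh] at this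
    apply mul_left_cancel₀ (pow_ne_zero 4 (hXpow i))
    rw [Fin.prod_univ_three] at this ⊢
    have e2 : (X ^ m) ^ 2 * Qh * (ψ x₀ * ψ ν₁ - ψ x₁ * ψ ν₀) ^ 2 =
        Qh * (X ^ m * (ψ x₀ * ψ ν₁ - ψ x₁ * ψ ν₀)) ^ 2 := by ring
    rw [e2, hcross, hn1, hn0] at this
    linear_combination this
  -- the values at `b` that occur in the transfer of quotients
  have hbψ : ψ d.b = dψ.b := rfl
  have hevb : ev dψ.b = b := by
    have : ev dψ.b = (dψ.map ev).b := rfl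
    rw [this, hDψ, hD]
  have hg : evalPair b μ (d.gauge.eval d.b) = D.gauge.eval b := by
    rw [← hevψ, ← eval_map_apply, ← map_gauge, ← hdψ, hbψ, ← eval_map_apply, ← map_gauge, hDψ, hevb]
  have hVb : V.eval b = c * ev (Uh.eval dψ.b) := by
    rw [hc, ← eval_map_apply, hevb, eval_mul, eval_C]
  have hUb : ψ (U.eval d.b) = X ^ j * Uh.eval dψ.b := by
    rw [← eval_map_apply, hbψ, hUh, eval_mul, eval_C]
  have hj : (X : ℂ[X]) ^ m = X ^ j * X ^ (m - j) := by rw [← pow_add, Nat.add_sub_cancel' hjm]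
  have he1 : ∀ t : ℂ, C t = C c * C (t / c) := fun t => by
    rw [← C_mul, mul_div_cancel₀ _ hc0]
  refine ⟨p0, r0, ev n1 / c, ev n0 / c, q₀ * ev y1 / c, q₀ * ev y0 / c, ?_, ?_, ?_, ?_, ?_,
    ?_, ?_⟩
  · refine hn.imp (fun h h0 => h ?_) (fun h h0 => h ?_) <;>
    · rw [X_dvd_iff_eval]; exact (div_eq_zero_iff.mp h0).resolve_right hc0
  · have := congrArg (Polynomial.map ev) H1'
    rw [hNmap] at this
    rw [this, hc]
    simp only [Polynomial.map_add, Polynomial.map_mul, map_C, map_X]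
    rw [he1 (ev n1), he1 (ev n0)]
    ring
  · have := congrArg (Polynomial.map ev) H2'
    simp only [Polynomial.map_add, Polynomial.map_sub, Polynomial.map_mul, map_C, map_X,
      ← map_sqPart, ← map_cosqPart, ← map_wnum, ← map_den, hDψ] at this
    rw [he1 (ev n1), he1 (ev n0)] at this
    have hw := wnum_C_mul (D.sqPart o) (D.cosqPart o) p0 (rh.map ev) 1 q₀
    rw [C_1, one_mul, one_mul] at hw
    have hy : ∀ t : ℂ, C q₀ * C t = C c * C (q₀ * t / c) := fun t => by
      rw [← C_mul, ← he1]
    rw [hr0, hw, hc, hqc]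
    simp only [C_mul] at this ⊢
    linear_combination C q₀ * this + U0 * X * hy (ev y1) + U0 * hy (ev y0)
  · have := congrArg ev H4
    simp only [map_mul, map_prod, map_add, map_pow, map_sub] at this
    have hC : ∀ t, ev (C (e t)) = e t := fun t => by simp [hev]
    simp only [hC, Fin.prod_univ_three] at this ⊢
    have hQ2 : ev Qh = -q₀ ^ 2 := by rw [hq₀, neg_neg]
    rw [hQ2] at this
    field_simp
    linear_combination this
  · intro N F h
    have := congrArg ψ h
    simp only [map_mul, map_neg] at this
    rw [hn1, hn0] at this
    have h5 : ψ N * n1 = -n0 * ψ F := by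
      apply mul_left_cancel₀ (hXpow i); linear_combination this
    have h6 := congrArg ev h5
    simp only [map_mul, map_neg, hevψ] at h6
    field_simp
    linear_combination h6
  · intro N F h
    have := congrArg ψ h
    simp only [map_mul] at this
    rw [hUb, hn1] at this
    have h5 : X ^ (m - j) * (ψ N * ψ (d.gauge.eval d.b) * n1) = ψ F * Uh.eval dψ.b * y1 := by
      apply mul_left_cancel₀ (mul_ne_zero (hXpow i) (hXpow j))
      have h6 : X ^ m * ψ x₁ = X ^ i * y1 := hy1
      rw [hj] at h6
      linear_combination X ^ j * X ^ (m - j) * this + X ^ j * ψ F * Uh.eval dψ.b * h6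
    have h6 := congrArg ev h5
    simp only [map_mul, hevψ, hg] at h6
    rw [hqc, hVb]
    field_simp
    linear_combination h6
  · intro N F h
    have := congrArg ψ h
    simp only [map_mul, map_pow, map_sub] at this
    rw [hUb] at this
    have h5 : X ^ (m - j) * (ψ N * ψ (d.gauge.eval d.b) * n1 ^ 2) =
        ψ F * Uh.eval dψ.b * (y0 * n1 - y1 * n0) := by
      apply mul_left_cancel₀ (mul_ne_zero (mul_ne_zero (hXpow i) (hXpow i)) (hXpow j))
      have h6 := hcross
      rw [hj] at h6
      linear_combination X ^ j * X ^ (m - j) * this + X ^ j * ψ F * Uh.eval dψ.b * h6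
        - X ^ j * X ^ (m - j) * ψ N * ψ (d.gauge.eval d.b) * (ψ ν₁ + X ^ i * n1) * hn1
    have h6 := congrArg ev h5
    simp only [map_mul, map_pow, map_sub, hevψ, hg] at h6
    rw [hqc, hVb]
    calc _ = q₀ / c * (ev (X ^ (m - j)) * (evalPair b μ N * D.gauge.eval b * ev n1 ^ 2)) := by
          field_simp
      _ = q₀ / c * (evalPair b μ F * ev (Uh.eval dψ.b) * (ev y0 * ev n1 - ev y1 * ev n0)) := by
          rw [← h6, map_pow ev X]
      _ = _ := by field_simp

end Spec
end Params
end HKAnsatz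

namespace HKAnsatz
open Filter Topology Polynomial

/-! ### From the elliptic equation to its algebraic form -/

section Data
variable (L : PeriodPair) (l : Fin 4 → ℕ)

/-- The parameters belonging to the elliptic equation. -/
noncomputable def dataAt (b μ : ℂ) : Params ℂ := ⟨roots L, b, μ, fun i => l i.succ, l 0⟩

variable {L l}

lemma regular_dataAt {δ : ℂ} (hδ : 2 * δ ∉ L.lattice) (μ : ℂ) :
    (dataAt L l (L.weierstrassP δ) μ).Regular where
  inj _ _ h := roots_injective L h
  ne i := weierstrassP_ne_roots hδ i
  sum := sum_roots L

lemma isOpen_isOrdinary (δ : ℂ) : IsOpen {x | IsOrdinary L δ x} := by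
  rw [isOpen_iff_mem_nhds]
  intro x hx
  filter_upwards [(isOpen_offHalf L).mem_nhds hx.1, (analyticAt_weierstrassP
    (notMem_of_mem_offHalf hx.1)).continuousAt.eventually_ne hx.2] with y h1 h2 using ⟨h1, h2⟩

lemma eval_chat_ne_zero {b μ x : ℂ} (hx : x ∈ offHalf L) :
    (dataAt L l b μ).chat.eval (L.weierstrassP x) ≠ 0 := by
  rw [Params.chat, eval_prod, Finset.prod_ne_zero_iff]
  intro i _
  simpa [sub_eq_zero, dataAt] using weierstrassP_ne_roots hx i

lemma eval_gauge_ne_zero {b μ x : ℂ} (hx : x ∈ offHalf L) :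
    (dataAt L l b μ).gauge.eval (L.weierstrassP x) ≠ 0 := by
  rw [Params.gauge, eval_prod, Finset.prod_ne_zero_iff]
  intro i _
  rw [eval_pow]
  refine pow_ne_zero _ ?_
  simpa [sub_eq_zero, dataAt] using weierstrassP_ne_roots hx i

lemma eval_base_ne_zero {δ μ x : ℂ} (hx : IsOrdinary L δ x) :
    (dataAt L l (L.weierstrassP δ) μ).base.eval (L.weierstrassP x) ≠ 0 := by
  rw [Params.base, eval_mul]
  exact mul_ne_zero (by simpa [sub_eq_zero, dataAt] using hx.2) (eval_chat_ne_zero hx.1)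

lemma eval_den_ne_zero {δ μ x : ℂ} (hx : IsOrdinary L δ x) :
    (dataAt L l (L.weierstrassP δ) μ).den.eval (L.weierstrassP x) ≠ 0 := by
  rw [Params.den, eval_mul]
  exact mul_ne_zero (by simpa [sub_eq_zero, dataAt] using hx.2) (eval_gauge_ne_zero hx.1)

/-- A polynomial vanishing at the values of `℘` at all ordinary points is zero. -/
lemma eq_zero_of_eval_weierstrassP {δ : ℂ} {F : ℂ[X]}
    (h : ∀ x, IsOrdinary L δ x → F.eval (L.weierstrassP x) = 0) : F = 0 := by
  refine eq_zero_of_infinite_isRoot F (Set.Infinite.mono (s := ((Finset.univ.image (roots L)) ∪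
    {L.weierstrassP δ} : Finset ℂ)ᶜ) ?_ (Finset.finite_toSet _).infinite_compl)
  intro z hz
  obtain ⟨x, hx, rfl⟩ := exists_weierstrassP_eq L z
  simp only [Finset.coe_union, Finset.coe_image, Finset.coe_univ, Set.image_univ,
    Finset.coe_singleton, Set.union_singleton, Set.mem_compl_iff, Set.mem_insert_iff,
    Set.mem_range, not_or, not_exists] at hz
  exact h x ⟨mem_offHalf_of_ne hx fun i hi => hz.2 i hi.symm, hz.1⟩

lemma gTwo_eq : gTwo L = -4 * (roots L 0 * roots L 1 + roots L 1 * roots L 2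
    + roots L 2 * roots L 0) := rfl

lemma cubic_eq (b : ℂ) : cubic L b =
    4 * ((b - roots L 0) * (b - roots L 1) * (b - roots L 2)) := by
  have h := (roots_vieta L).1
  have h2 : roots L 2 = -roots L 0 - roots L 1 := by linear_combination h
  have hg : gThree L = 4 * (roots L 0 * roots L 1 * roots L 2) := by
    simp [gThree, roots]; ring
  rw [cubic, gTwo_eq, hg, h2]; ring

lemma sTilde_eq {δ : ℂ} (hδ : 2 * δ ∉ L.lattice) (μ : ℂ) :
    sTilde L l (L.weierstrassP δ) μ = (dataAt L l (L.weierstrassP δ) μ).sTl := by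
  have h0 := sub_ne_zero.mpr (weierstrassP_ne_roots (x := δ) hδ 0)
  have h1 := sub_ne_zero.mpr (weierstrassP_ne_roots (x := δ) hδ 1)
  have h2 := sub_ne_zero.mpr (weierstrassP_ne_roots (x := δ) hδ 2)
  have e1 : e L 1 = roots L 0 := rfl
  have e2 : e L 2 = roots L 1 := rfl
  have e3 : e L 3 = roots L 2 := rfl
  rw [sTilde, cubic_eq, Params.sTl, Fin.prod_univ_three, Fin.sum_univ_three, e1, e2, e3]
  simp only [dataAt, show (0 : Fin 3) + 1 = 1 from rfl, show (0 : Fin 3) + 2 = 2 from rfl,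
    show (1 : Fin 3) + 1 = 2 from rfl, show (1 : Fin 3) + 2 = 0 from rfl,
    show (2 : Fin 3) + 1 = 0 from rfl, show (2 : Fin 3) + 2 = 1 from rfl,
    show (0 : Fin 3).succ = 1 from rfl, show (1 : Fin 3).succ = 2 from rfl,
    show (2 : Fin 3).succ = 3 from rfl]
  field_simp
  ring

lemma apparency_eq {δ : ℂ} (hδ : 2 * δ ∉ L.lattice) {μ p : ℂ}
    (hp : Apparency L l (L.weierstrassP δ) μ p) :
    p = (dataAt L l (L.weierstrassP δ) μ).pApp := by
  have h0 := sub_ne_zero.mpr (weierstrassP_ne_roots (x := δ) hδ 0)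
  have h1 := sub_ne_zero.mpr (weierstrassP_ne_roots (x := δ) hδ 1)
  have h2 := sub_ne_zero.mpr (weierstrassP_ne_roots (x := δ) hδ 2)
  have e1 : e L 1 = roots L 0 := rfl
  have e2 : e L 2 = roots L 1 := rfl
  have e3 : e L 3 = roots L 2 := rfl
  rw [hp, cubic_eq, Params.pApp, Fin.prod_univ_three, Fin.sum_univ_three, Fin.sum_univ_three,
    e1, e2, e3]
  simp only [dataAt, show (0 : Fin 3) + 1 = 1 from rfl, show (0 : Fin 3) + 2 = 2 from rfl,
    show (1 : Fin 3) + 1 = 2 from rfl, show (1 : Fin 3) + 2 = 0 from rfl,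
    show (2 : Fin 3) + 1 = 0 from rfl, show (2 : Fin 3) + 2 = 1 from rfl,
    show (0 : Fin 3).succ = 1 from rfl, show (1 : Fin 3).succ = 2 from rfl,
    show (2 : Fin 3).succ = 3 from rfl]
  field_simp
  ring

lemma ETilde_eq {δ : ℂ} (hδ : 2 * δ ∉ L.lattice) {μ p : ℂ}
    (hp : Apparency L l (L.weierstrassP δ) μ p) :
    ETilde L l (L.weierstrassP δ) p = (dataAt L l (L.weierstrassP δ) μ).eTl := by
  have e1 : e L 1 = roots L 0 := rfl
  have e2 : e L 2 = roots L 1 := rfl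
  have e3 : e L 3 = roots L 2 := rfl
  rw [ETilde, Params.eTl, ← apparency_eq hδ hp, Fin.sum_univ_three, Fin.sum_univ_three, e1, e2, e3]
  simp only [dataAt, show (0 : Fin 3) + 1 = 1 from rfl, show (0 : Fin 3) + 2 = 2 from rfl,
    show (1 : Fin 3) + 1 = 2 from rfl, show (1 : Fin 3) + 2 = 0 from rfl,
    show (2 : Fin 3) + 1 = 0 from rfl, show (2 : Fin 3) + 2 = 1 from rfl,
    show (0 : Fin 3).succ = 1 from rfl, show (1 : Fin 3).succ = 2 from rfl,
    show (2 : Fin 3).succ = 3 from rfl]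
  ring

lemma eval_rootPoly (z : ℂ) : (rootPoly L).eval z =
    (z - roots L 0) * (z - roots L 1) * (z - roots L 2) := by
  rw [rootPoly, eval_prod, Fin.prod_univ_three]; simp

lemma eval_derivative_rootPoly (z : ℂ) : (derivative (rootPoly L)).eval z =
    (z - roots L 1) * (z - roots L 2) + (z - roots L 0) * (z - roots L 2)
      + (z - roots L 0) * (z - roots L 1) := by
  rw [rootPoly, Fin.prod_univ_three]
  simp [derivative_mul]; ring

/-- The potential is the rational function `pot / base²` of `℘`. -/
lemma potential_sub_energy {δ : ℂ} (hδ : 2 * δ ∉ L.lattice) {μ p : ℂ}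
    (hp : Apparency L l (L.weierstrassP δ) μ p) {x : ℂ} (hx : IsOrdinary L δ x) :
    potential L l δ μ x - energy L l (L.weierstrassP δ) p =
      (dataAt L l (L.weierstrassP δ) μ).pot.eval (L.weierstrassP x) /
        (dataAt L l (L.weierstrassP δ) μ).base.eval (L.weierstrassP x) ^ 2 := by
  have hx0 := notMem_of_mem_offHalf hx.1
  have hδ0 : δ ∉ L.lattice := notMem_of_mem_offHalf (x := δ) hδ
  have z0 := sub_ne_zero.mpr (weierstrassP_ne_roots hx.1 0)
  have z1 := sub_ne_zero.mpr (weierstrassP_ne_roots hx.1 1)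
  have z2 := sub_ne_zero.mpr (weierstrassP_ne_roots hx.1 2)
  have zb := sub_ne_zero.mpr hx.2
  have k0 := weierstrassP_add_half 0 hx0 (add_half_notMem hx.1 _)
  have k1 := weierstrassP_add_half 1 hx0 (add_half_notMem hx.1 _)
  have k2 := weierstrassP_add_half 2 hx0 (add_half_notMem hx.1 _)
  have kδ := weierstrassP_sub_add_weierstrassP_add hx.1 hδ0 hx.2
  rw [eval_rootPoly, eval_derivative_rootPoly] at kδ
  have k0' := eq_div_of_mul_eq z0 k0
  have k1' := eq_div_of_mul_eq z1 k1
  have k2' := eq_div_of_mul_eq z2 k2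
  have kδ' := eq_div_of_mul_eq (pow_ne_zero 2 zb) kδ
  rw [sub_eq_iff_eq_add] at k0' k1' k2'
  have h00 : L.weierstrassP (x + halfPeriod L 0) = L.weierstrassP x := by simp [halfPeriod]
  rw [potential, energy, ETilde_eq hδ hp, sOne, sTilde_eq hδ, Fin.sum_univ_four, h00, kδ',
    show (1 : Fin 4) = (0 : Fin 3).succ from rfl, show (2 : Fin 4) = (1 : Fin 3).succ from rfl,
    show (3 : Fin 4) = (2 : Fin 3).succ from rfl, k0', k1', k2', gTwo_eq]
  simp only [Params.pot, Params.base, Params.chat, Params.wConst, Params.wRes, Params.resH,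
    Fin.prod_univ_three, Fin.sum_univ_three, eval_add, eval_mul, eval_pow, eval_sub, eval_X, eval_C,
    show (0 : Fin 3) + 1 = 1 from rfl, show (0 : Fin 3) + 2 = 2 from rfl,
    show (1 : Fin 3) + 1 = 2 from rfl, show (1 : Fin 3) + 2 = 0 from rfl,
    show (2 : Fin 3) + 1 = 0 from rfl, show (2 : Fin 3) + 2 = 1 from rfl]
  generalize (dataAt L l (L.weierstrassP δ) μ).sTl = S
  generalize (dataAt L l (L.weierstrassP δ) μ).eTl = T
  simp only [dataAt]
  have h := (roots_vieta L).1
  generalize L.weierstrassP x = z at *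
  generalize L.weierstrassP δ = b at *
  generalize roots L 0 = a0 at *
  generalize roots L 1 = a1 at *
  generalize roots L 2 = a2 at *
  generalize (l 0 : ℂ) = m0
  generalize (l (Fin.succ 0) : ℂ) = m1
  generalize (l (Fin.succ 1) : ℂ) = m2
  generalize (l (Fin.succ 2) : ℂ) = m3
  have h2 : a2 = -a0 - a1 := by linear_combination h
  -- a rational identity in `z`, `b`, the `e_i` and the exponents
  clear k0 k1 k2 kδ k0' k1' k2' kδ' h00
  have hb0 : (z - b) ^ 2 ≠ 0 := pow_ne_zero 2 zb
  subst h2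
  field_simp
  ring

end Data
end HKAnsatz

namespace HKAnsatz
open Filter Topology Polynomial
variable {L : PeriodPair} {l : Fin 4 → ℕ}

/-! ### The polynomial belonging to `Ξ` -/

/-- The function `f` equals `U(℘) / den(℘)` at the ordinary points. The degree of `U` is bounded
according to the pole of order at most `2 l₀` of `Ξ` at the periods, and the value of `U` at
`b = ℘(δ)` expresses that `c` is the coefficient of `1 / (℘ - b)` in `f`. -/
def IsRational (L : PeriodPair) (l : Fin 4 → ℕ) (δ μ c : ℂ) (f : ℂ → ℂ) (U : ℂ[X]) : Prop :=
  U.natDegree ≤ (dataAt L l (L.weierstrassP δ) μ).degDen + l 0 ∧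
  U.eval (L.weierstrassP δ) =
    c * (dataAt L l (L.weierstrassP δ) μ).gauge.eval (L.weierstrassP δ) ∧
  ∀ x, IsOrdinary L δ x →
    f x * (dataAt L l (L.weierstrassP δ) μ).den.eval (L.weierstrassP x) =
      U.eval (L.weierstrassP x)

namespace IsRational
variable {δ μ c c' : ℂ} {f g : ℂ → ℂ} {U V : ℂ[X]}

lemma add (hf : IsRational L l δ μ c f U) (hg : IsRational L l δ μ c' g V) :
    IsRational L l δ μ (c + c') (fun x => f x + g x) (U + V) :=
  ⟨natDegree_add_le_of_degree_le hf.1 hg.1, by rw [eval_add, hf.2.1, hg.2.1, add_mul],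
    fun x hx => by rw [eval_add, ← hf.2.2 x hx, ← hg.2.2 x hx, add_mul]⟩

lemma const_mul (a : ℂ) (hf : IsRational L l δ μ c f U) :
    IsRational L l δ μ (a * c) (fun x => a * f x) (C a * U) :=
  ⟨(natDegree_C_mul_le _ _).trans hf.1, by rw [eval_mul, eval_C, hf.2.1, mul_assoc],
    fun x hx => by rw [eval_mul, eval_C, ← hf.2.2 x hx, mul_assoc]⟩

lemma sum {ι : Type*} (s : Finset ι) {f : ι → ℂ → ℂ}
    (h : ∀ i ∈ s, ∃ U, IsRational L l δ μ 0 (f i) U) :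
    ∃ U, IsRational L l δ μ 0 (fun x => ∑ i ∈ s, f i x) U := by
  classical
  induction s using Finset.induction_on with
  | empty => exact ⟨0, by simp, by simp, by simp⟩
  | insert i s hi ih =>
    obtain ⟨V, hV⟩ := ih fun j hj => h j (Finset.mem_insert_of_mem hj)
    obtain ⟨U, hU⟩ := h i (Finset.mem_insert_self _ _)
    refine ⟨U + V, ?_⟩
    simp only [Finset.sum_insert hi]
    simpa using hU.add hV

end IsRational

lemma exists_isRational_pow_zero (δ μ : ℂ) {m : ℕ} (hm : m ≤ l 0) :
    ∃ U, IsRational L l δ μ 0 (fun x => L.weierstrassP x ^ m) U := by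
  refine ⟨X ^ m * (dataAt L l (L.weierstrassP δ) μ).den, ?_, ?_, fun x _ => by simp⟩
  · refine natDegree_mul_le.trans ?_
    rw [natDegree_X_pow, Params.natDegree_den, add_comm]
    gcongr
  · simp [Params.den, dataAt]

lemma exists_isRational_pow_succ (i : Fin 3) (δ μ : ℂ) {m : ℕ} (hm : m ≤ l i.succ) :
    ∃ U, IsRational L l δ μ 0 (fun x => L.weierstrassP (x + halfPeriod L i.succ) ^ m) U := by
  set D := dataAt L l (L.weierstrassP δ) μ with hD
  refine ⟨(X - C D.b) * ((X - C (D.e i)) ^ (D.l i - m) * (C (D.e i) * (X - C (D.e i))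
    + C (D.resH i)) ^ m * (X - C (D.e (i + 1))) ^ D.l (i + 1)
      * (X - C (D.e (i + 2))) ^ D.l (i + 2)), ?_, ?_, fun x hx => ?_⟩
  · have hm' : m ≤ D.l i := hm
    have hsum : D.degDen = D.l i + D.l (i + 1) + D.l (i + 2) + 1 := by
      rw [← Params.sum_cyc D.l i, Fin.sum_univ_three]; rfl
    have h1 : (C (D.e i) * (X - C (D.e i)) + C (D.resH i)).natDegree ≤ 1 := by compute_degree
    have h2 : ((C (D.e i) * (X - C (D.e i)) + C (D.resH i)) ^ m).natDegree ≤ m * 1 :=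
      natDegree_pow_le_of_le m h1
    refine (natDegree_mul_le_of_le (natDegree_X_sub_C_le _) (natDegree_mul_le_of_le
      (natDegree_mul_le_of_le (natDegree_mul_le_of_le (natDegree_pow_le_of_le _
        (natDegree_X_sub_C_le _)) h2) (natDegree_pow_le_of_le _ (natDegree_X_sub_C_le _)))
        (natDegree_pow_le_of_le _ (natDegree_X_sub_C_le _)))).trans ?_
    rw [hsum]; omega
  · simp [hD, dataAt]
  · have hk := weierstrassP_add_half i (notMem_of_mem_offHalf hx.1) (add_half_notMem hx.1 _)
    have hm' : D.l i = (D.l i - m) + m := (Nat.sub_add_cancel hm).symm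
    rw [Params.den, Params.gauge, Params.prod_cyc _ i]
    conv_lhs => rw [hm']
    have hk' : L.weierstrassP (x + halfPeriod L i.succ) * (L.weierstrassP x - D.e i) =
        D.e i * (L.weierstrassP x - D.e i) + D.resH i := by
      rw [Params.resH]
      simp only [hD, dataAt]
      linear_combination hk
    simp only [eval_mul, eval_pow, eval_sub, eval_add, eval_X, eval_C, ← hk', mul_pow, pow_add]
    ring

lemma exists_isRational_Xi (δ μ c₀ d₀ : ℂ) (β : Fin 4 → ℕ → ℂ) :
    ∃ U, IsRational L l δ μ d₀ (Xi L l δ c₀ d₀ β) U := by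
  set D := dataAt L l (L.weierstrassP δ) μ with hD
  have h0 : IsRational L l δ μ 0 (fun _ => c₀) (C c₀ * D.den) := by
    refine ⟨(natDegree_C_mul_le _ _).trans ?_, ?_, fun x _ => by simp [hD]⟩
    · rw [Params.natDegree_den]; exact Nat.le_add_right _ _
    · simp [Params.den, hD, dataAt]
  have h1 : IsRational L l δ μ d₀ (fun x => d₀ / (L.weierstrassP x - L.weierstrassP δ))
      (C d₀ * D.gauge) := by
    refine ⟨(natDegree_C_mul_le _ _).trans ?_, by simp [hD], fun x hx => ?_⟩
    · have h := D.natDegree_den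
      rw [Params.den, (monic_X_sub_C _).natDegree_mul'] at h
      · rw [← hD]; omega
      · exact (monic_prod_of_monic _ _ fun _ _ => (monic_X_sub_C _).pow _).ne_zero
    · have := sub_ne_zero.mpr hx.2
      rw [← hD, Params.den]
      simp only [eval_mul, eval_sub, eval_X, eval_C]
      simp only [hD, dataAt]
      field_simp
  obtain ⟨V, hV⟩ := IsRational.sum (L := L) (l := l) (δ := δ) (μ := μ) Finset.univ
    (f := fun i x => ∑ j ∈ Finset.range (l i),
        β i j * L.weierstrassP (x + halfPeriod L i) ^ (l i - j)) (fun i _ => by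
      refine IsRational.sum _ fun j _ => ?_
      obtain ⟨W, hW⟩ : ∃ U, IsRational L l δ μ 0
          (fun x => L.weierstrassP (x + halfPeriod L i) ^ (l i - j)) U := by
        induction i using Fin.cases with
        | zero => simpa [halfPeriod] using exists_isRational_pow_zero δ μ (Nat.sub_le _ _)
        | succ i => exact exists_isRational_pow_succ i δ μ (Nat.sub_le _ _)
      exact ⟨_, by simpa using hW.const_mul (β i j)⟩)
  have h := (h0.add h1).add hV
  rw [zero_add, add_zero] at h
  exact ⟨_, h⟩

/-! ### Differentiation of rational functions of `℘` -/

lemma deriv_eq_of_isOrdinary {δ : ℂ} {f g g' : ℂ → ℂ} (h : ∀ x, IsOrdinary L δ x → f x = g x)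
    (hg : ∀ x, IsOrdinary L δ x → HasDerivAt g (g' x) x) {x : ℂ} (hx : IsOrdinary L δ x) :
    HasDerivAt f (g' x) x :=
  (hg x hx).congr_of_eventuallyEq (by
    filter_upwards [(isOpen_isOrdinary (L := L) δ).mem_nhds hx] with y hy using h y hy)

/-- The operators `theta j` are differentiation with respect to `℘`, with the denominators
cleared. -/
lemma hasDerivAt_div_den {δ μ : ℂ} (F : ℂ[X]) (j : ℕ) {x : ℂ} (hx : IsOrdinary L δ x) :
    HasDerivAt (fun x => F.eval (L.weierstrassP x) /
        ((dataAt L l (L.weierstrassP δ) μ).den.eval (L.weierstrassP x) *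
          (dataAt L l (L.weierstrassP δ) μ).base.eval (L.weierstrassP x) ^ j))
      (((dataAt L l (L.weierstrassP δ) μ).theta j F).eval (L.weierstrassP x) /
        ((dataAt L l (L.weierstrassP δ) μ).den.eval (L.weierstrassP x) *
          (dataAt L l (L.weierstrassP δ) μ).base.eval (L.weierstrassP x) ^ (j + 1)) *
        L.derivWeierstrassP x) x := by
  have hM := eval_den_ne_zero (l := l) (μ := μ) hx
  have hB := eval_base_ne_zero (l := l) (μ := μ) hx
  set D := dataAt L l (L.weierstrassP δ) μ
  have hP := hasDerivAt_weierstrassP (notMem_of_mem_offHalf hx.1)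
  refine HasDerivAt.comp x (h₂ := fun z => F.eval z / (D.den.eval z * D.base.eval z ^ j)) ?_ hP
  generalize L.weierstrassP x = z at *
  have hd := congrArg (eval z) D.base_mul_derivative_den
  rw [eval_mul, eval_mul] at hd
  refine ((F.hasDerivAt z).fun_div ((D.den.hasDerivAt z).fun_mul
    ((D.base.hasDerivAt z).fun_pow j)) (mul_ne_zero hM (pow_ne_zero _ hB))).congr_deriv ?_
  rw [D.theta_apply]
  simp only [eval_sub, eval_mul, eval_add, eval_natCast]
  generalize eval z D.den = M at *
  generalize eval z D.base = B at *
  cases j with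
  | zero =>
    field_simp
    simp only [Nat.cast_zero]
    linear_combination -eval z F * hd
  | succ j =>
    rw [Nat.add_sub_cancel]
    field_simp
    push_cast
    linear_combination -eval z F * B ^ (2 * j + 2) * hd

/-- The derivative of the potential as a rational function of `℘`, times `℘'`. -/
lemma hasDerivAt_potential {δ : ℂ} (hδ : 2 * δ ∉ L.lattice) {μ p : ℂ}
    (hp : Apparency L l (L.weierstrassP δ) μ p) {x : ℂ} (hx : IsOrdinary L δ x) :
    HasDerivAt (potential L l δ μ)
      (((dataAt L l (L.weierstrassP δ) μ).base * derivative (dataAt L l (L.weierstrassP δ) μ).pot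
        - 2 * derivative (dataAt L l (L.weierstrassP δ) μ).base *
          (dataAt L l (L.weierstrassP δ) μ).pot).eval (L.weierstrassP x) /
        (dataAt L l (L.weierstrassP δ) μ).base.eval (L.weierstrassP x) ^ 3 *
        L.derivWeierstrassP x) x := by
  refine deriv_eq_of_isOrdinary (L := L) (δ := δ) (g := fun x => energy L l (L.weierstrassP δ) p +
    (dataAt L l (L.weierstrassP δ) μ).pot.eval (L.weierstrassP x) /
        (dataAt L l (L.weierstrassP δ) μ).base.eval (L.weierstrassP x) ^ 2)
    (fun x hx => by rw [← potential_sub_energy hδ hp hx]; ring)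
    (g' := fun x => ((dataAt L l (L.weierstrassP δ) μ).base *
      derivative (dataAt L l (L.weierstrassP δ) μ).pot
        - 2 * derivative (dataAt L l (L.weierstrassP δ) μ).base *
          (dataAt L l (L.weierstrassP δ) μ).pot).eval (L.weierstrassP x) /
        (dataAt L l (L.weierstrassP δ) μ).base.eval (L.weierstrassP x) ^ 3 *
        L.derivWeierstrassP x) (fun x hx => ?_) hx
  have hB := eval_base_ne_zero (l := l) (μ := μ) hx
  set D := dataAt L l (L.weierstrassP δ) μ
  have hP := hasDerivAt_weierstrassP (notMem_of_mem_offHalf hx.1)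
  refine HasDerivAt.const_add _ (HasDerivAt.comp x
    (h₂ := fun z => D.pot.eval z / D.base.eval z ^ 2) ?_ hP)
  generalize L.weierstrassP x = z at *
  refine ((D.pot.hasDerivAt z).fun_div ((D.base.hasDerivAt z).fun_pow 2)
    (pow_ne_zero _ hB)).congr_deriv ?_
  simp only [eval_sub, eval_mul, eval_add, eval_ofNat]
  field_simp
  push_cast
  ring

section Derivatives
variable {δ μ c : ℂ} {Ξ : ℂ → ℂ} {U : ℂ[X]}

lemma IsRational.eq_div (hU : IsRational L l δ μ c Ξ U) {x : ℂ} (hx : IsOrdinary L δ x) :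
    Ξ x = U.eval (L.weierstrassP x) /
      ((dataAt L l (L.weierstrassP δ) μ).den.eval (L.weierstrassP x) *
        (dataAt L l (L.weierstrassP δ) μ).base.eval (L.weierstrassP x) ^ 0) := by
  rw [pow_zero, mul_one, ← hU.2.2 x hx, mul_div_cancel_right₀ _ (eval_den_ne_zero hx)]

/-- `F / (den base^j)` at `℘ x`. -/
noncomputable def quotAt (D : Params ℂ) (F : ℂ[X]) (j : ℕ) (z : ℂ) : ℂ :=
  F.eval z / (D.den.eval z * D.base.eval z ^ j)

/-- The first three derivatives of a rational function of `℘`. -/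
lemma IsRational.derivatives (hU : IsRational L l δ μ c Ξ U) {x : ℂ} (hx : IsOrdinary L δ x) :
    let D := dataAt L l (L.weierstrassP δ) μ
    let z := L.weierstrassP x
    let G₁ := quotAt D (D.theta 0 U) 1 z
    let G₂ := quotAt D (D.theta 1 (D.theta 0 U)) 2 z
    let G₃ := quotAt D (D.theta 2 (D.theta 1 (D.theta 0 U))) 3 z
    HasDerivAt Ξ (G₁ * L.derivWeierstrassP x) x ∧
    iteratedDeriv 2 Ξ x = 4 * D.chat.eval z * G₂ + 2 * (derivative D.chat).eval z * G₁ ∧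
    iteratedDeriv 3 Ξ x = (4 * D.chat.eval z * G₃ + 6 * (derivative D.chat).eval z * G₂
      + 2 * (derivative (derivative D.chat)).eval z * G₁) * L.derivWeierstrassP x := by
  intro D z G₁ G₂ G₃
  have hchat : D.chat = rootPoly L := rfl
  have k0 : ∀ x, IsOrdinary L δ x → HasDerivAt Ξ
      (quotAt D (D.theta 0 U) 1 (L.weierstrassP x) * L.derivWeierstrassP x) x :=
    fun x hx => deriv_eq_of_isOrdinary (fun x hx => hU.eq_div hx)
      (fun x hx => hasDerivAt_div_den U 0 hx) hx
  have k1 : ∀ x, IsOrdinary L δ x → HasDerivAt (deriv Ξ)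
      (4 * D.chat.eval (L.weierstrassP x) * quotAt D (D.theta 1 (D.theta 0 U)) 2 (L.weierstrassP x)
        + 2 * (derivative D.chat).eval (L.weierstrassP x) *
          quotAt D (D.theta 0 U) 1 (L.weierstrassP x)) x := by
    intro x hx
    refine deriv_eq_of_isOrdinary (fun x hx => (k0 x hx).deriv) (g' := fun x =>
      (4 * D.chat.eval (L.weierstrassP x) * quotAt D (D.theta 1 (D.theta 0 U)) 2 (L.weierstrassP x)
        + 2 * (derivative D.chat).eval (L.weierstrassP x) *
          quotAt D (D.theta 0 U) 1 (L.weierstrassP x))) (fun x hx => ?_) hx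
    have hy := derivWeierstrassP_sq_eq (notMem_of_mem_offHalf hx.1)
    rw [← hchat] at hy
    refine ((hasDerivAt_div_den (l := l) (μ := μ) (D.theta 0 U) 1 hx).fun_mul
      (hasDerivAt_derivWeierstrassP hx.1)).congr_deriv ?_
    simp only [quotAt, D, hchat, Nat.reduceAdd] at hy ⊢
    linear_combination (eval (L.weierstrassP x) (D.theta 1 (D.theta 0 U)) /
      (D.den.eval (L.weierstrassP x) * D.base.eval (L.weierstrassP x) ^ 2)) * hy
  have k2 : ∀ x, IsOrdinary L δ x → HasDerivAt (deriv (deriv Ξ))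
      ((4 * D.chat.eval (L.weierstrassP x) *
          quotAt D (D.theta 2 (D.theta 1 (D.theta 0 U))) 3 (L.weierstrassP x)
        + 6 * (derivative D.chat).eval (L.weierstrassP x) *
          quotAt D (D.theta 1 (D.theta 0 U)) 2 (L.weierstrassP x)
        + 2 * (derivative (derivative D.chat)).eval (L.weierstrassP x) *
          quotAt D (D.theta 0 U) 1 (L.weierstrassP x)) * L.derivWeierstrassP x) x := by
    intro x hx
    refine deriv_eq_of_isOrdinary (fun x hx => (k1 x hx).deriv) (g' := fun x =>
      ((4 * D.chat.eval (L.weierstrassP x) *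
          quotAt D (D.theta 2 (D.theta 1 (D.theta 0 U))) 3 (L.weierstrassP x)
        + 6 * (derivative D.chat).eval (L.weierstrassP x) *
          quotAt D (D.theta 1 (D.theta 0 U)) 2 (L.weierstrassP x)
        + 2 * (derivative (derivative D.chat)).eval (L.weierstrassP x) *
          quotAt D (D.theta 0 U) 1 (L.weierstrassP x)) * L.derivWeierstrassP x))
        (fun x hx => ?_) hx
    have hP := hasDerivAt_weierstrassP (notMem_of_mem_offHalf hx.1)
    have hc := (D.chat.hasDerivAt (L.weierstrassP x)).comp x hP
    have hc' := ((derivative D.chat).hasDerivAt (L.weierstrassP x)).comp x hP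
    refine (((hc.const_mul 4).fun_mul (hasDerivAt_div_den (l := l) (μ := μ)
      (D.theta 1 (D.theta 0 U)) 2 hx)).fun_add ((hc'.const_mul 2).fun_mul
      (hasDerivAt_div_den (l := l) (μ := μ) (D.theta 0 U) 1 hx))).congr_deriv ?_
    simp only [quotAt, D, Function.comp_apply, Nat.reduceAdd]
    ring
  refine ⟨k0 x hx, ?_, ?_⟩
  · rw [iteratedDeriv_succ, iteratedDeriv_one]
    exact (k1 x hx).deriv
  · rw [iteratedDeriv_succ, iteratedDeriv_succ, iteratedDeriv_one]
    exact (k2 x hx).deriv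

/-- The polynomial of a product solution is annihilated by `symOp`. -/
lemma IsRational.symOp_eq_zero (hδ : 2 * δ ∉ L.lattice) {p : ℂ}
    (hp : Apparency L l (L.weierstrassP δ) μ p) (hU : IsRational L l δ μ c Ξ U)
    (hΞ : IsProductSolution L l δ μ p Ξ) : (dataAt L l (L.weierstrassP δ) μ).symOp U = 0 := by
  refine eq_zero_of_eval_weierstrassP (L := L) (δ := δ) fun x hx => ?_
  obtain ⟨h1, -, h3⟩ := hU.derivatives hx
  have hM := eval_den_ne_zero (l := l) (μ := μ) hx
  have hB := eval_base_ne_zero (l := l) (μ := μ) hx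
  have h := hΞ.2 x hx
  rw [h3, h1.deriv, potential_sub_energy hδ hp hx, (hasDerivAt_potential hδ hp hx).deriv,
    hU.eq_div hx] at h
  have hy := derivWeierstrassP_ne_zero hx.1
  set D := dataAt L l (L.weierstrassP δ) μ
  have h' : (D.symOp U).eval (L.weierstrassP x) * L.derivWeierstrassP x = 0 := by
    rw [D.symOp_apply]
    simp only [quotAt] at h
    field_simp at h
    simp only [eval_sub, eval_add, eval_mul, eval_pow, eval_ofNat] at h ⊢
    linear_combination h
  exact (mul_eq_zero.mp h').resolve_right hy

/-- The value of `Q` at any ordinary point is the constant in the first integral of `U`. -/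
lemma IsRational.quad_eq (hδ : 2 * δ ∉ L.lattice) {p : ℂ}
    (hp : Apparency L l (L.weierstrassP δ) μ p) (hU : IsRational L l δ μ c Ξ U)
    (hΞ : IsProductSolution L l δ μ p Ξ) {x : ℂ} (hx : IsOrdinary L δ x) :
    (dataAt L l (L.weierstrassP δ) μ).quad U =
      C (QAt L l δ μ p Ξ x) * (dataAt L l (L.weierstrassP δ) μ).zden := by
  obtain ⟨Q, hQ⟩ := Params.exists_quad_eq (hU.symOp_eq_zero hδ hp hΞ)
  obtain ⟨h1, h2, -⟩ := hU.derivatives hx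
  have hM := eval_den_ne_zero (l := l) (μ := μ) hx
  have hB := eval_base_ne_zero (l := l) (μ := μ) hx
  have hy : L.derivWeierstrassP x ^ 2 = 4 * (dataAt L l (L.weierstrassP δ) μ).chat.eval
    (L.weierstrassP x) := derivWeierstrassP_sq_eq (notMem_of_mem_offHalf hx.1)
  suffices QAt L l δ μ p Ξ x = Q by rw [this, hQ]
  have hpot : energy L l (L.weierstrassP δ) p - potential L l δ μ x = -_ :=
    (neg_sub _ _).symm.trans (congrArg Neg.neg (potential_sub_energy hδ hp hx))
  rw [QAt, h1.deriv, h2, hU.eq_div hx, hpot]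
  set D := dataAt L l (L.weierstrassP δ) μ
  have h := congrArg (eval (L.weierstrassP x)) hQ
  rw [Params.quad, Params.zden] at h
  simp only [eval_sub, eval_add, eval_mul, eval_pow, eval_ofNat, eval_neg, eval_C] at h
  simp only [quotAt, mul_pow, hy]
  generalize L.weierstrassP x = z at *
  rw [← mul_left_inj' (mul_ne_zero (pow_ne_zero 2 hM) (pow_ne_zero 2 hB)), ← h]
  field_simp
  ring

end Derivatives
end HKAnsatz

namespace HKAnsatz
open Filter Topology Polynomial
variable {L : PeriodPair} {l : Fin 4 → ℕ}

/-! ### Properties of `Λ_g` -/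

/-- The multiplier of `Φ_i` does not depend on `i`. -/
lemma Phi_add {α w η c : ℂ} (hc : c ≠ 0)
    (hη : ∀ z, sigma L (z + w) = c * Complex.exp (η * z) * sigma L z) (i : Fin 4) (x : ℂ) :
    Phi L i α (x + w) = Complex.exp (w * zeta L α - η * α) * Phi L i α x := by
  have h1 : x + w + halfPeriod L i - α = x + halfPeriod L i - α + w := by ring
  have h2 : x + w + halfPeriod L i = x + halfPeriod L i + w := by ring
  have e1 : Complex.exp (η * (x + halfPeriod L i - α)) =
      Complex.exp (η * (x + halfPeriod L i)) * Complex.exp (-(η * α)) := by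
    rw [← Complex.exp_add]; ring_nf
  have e2 : Complex.exp (zeta L α * (x + w)) =
      Complex.exp (zeta L α * x) * Complex.exp (w * zeta L α) := by
    rw [← Complex.exp_add]; ring_nf
  rw [Phi, Phi, h1, h2, hη, hη, e1, e2, sub_eq_add_neg (w * _), Complex.exp_add]
  by_cases hs : sigma L (x + halfPeriod L i) = 0
  · simp [hs]
  · field_simp

/-- A function of Hermite–Krichever form has multipliers determined by `κ` and `α`. -/
lemma IsHermiteKrichever.quasiperiodic {α κ : ℂ} {Λ : ℂ → ℂ} (h : IsHermiteKrichever L l α κ Λ)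
    {w η c : ℂ} (hw : w ∈ L.lattice) (hc : c ≠ 0)
    (hη : ∀ z, sigma L (z + w) = c * Complex.exp (η * z) * sigma L z) {x : ℂ} (hx : x ∈ offHalf L) :
    Λ (x + w) = Complex.exp (w * (κ + zeta L α) - η * α) * Λ x := by
  obtain ⟨-, β, hβ⟩ := h
  have hxw : 2 * (x + w) ∉ L.lattice := by
    rw [mul_add]; exact add_notMem hx (by rw [two_mul]; exact add_mem hw hw)
  have hPhi : ∀ i j, iteratedDeriv j (Phi L i α) (x + w) =
      Complex.exp (w * zeta L α - η * α) * iteratedDeriv j (Phi L i α) x := fun i j => by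
    rw [← iteratedDeriv_const_mul_field,
      ← congrFun (iteratedDeriv_comp_add_const j (Phi L i α) w) x]
    congr 1
    exact funext fun y => Phi_add hc hη i y
  rw [hβ _ hxw, hβ x hx, show w * (κ + zeta L α) - η * α = κ * w + (w * zeta L α - η * α) by ring,
    Complex.exp_add, mul_add κ, Complex.exp_add]
  simp only [hPhi, mul_left_comm _ (Complex.exp (w * zeta L α - η * α)), ← Finset.mul_sum]
  ring

lemma IsHermiteKrichever.analyticOnNhd {α κ : ℂ} {Λ : ℂ → ℂ} (h : IsHermiteKrichever L l α κ Λ) :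
    AnalyticOnNhd ℂ Λ (offHalf L) := by
  obtain ⟨-, β, hβ⟩ := h
  intro x hx
  have hs : ∀ z, AnalyticAt ℂ (sigma L) z := (differentiable_sigma L).analyticAt
  have hPhi : ∀ i, AnalyticAt ℂ (Phi L i α) x := fun i => by
    have h1 : AnalyticAt ℂ (fun x => sigma L (x + halfPeriod L i - α)) x :=
      (hs _).fun_comp (f := fun x => x + halfPeriod L i - α) (by fun_prop)
    have h2 : AnalyticAt ℂ (fun x => sigma L (x + halfPeriod L i)) x :=
      (hs _).fun_comp (f := fun x => x + halfPeriod L i) (by fun_prop)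
    have h3 : AnalyticAt ℂ (fun x => Complex.exp (zeta L α * x)) x := by fun_prop
    exact (h1.fun_div h2 (sigma_ne_zero (add_half_notMem hx i))).fun_mul h3
  have h1 : AnalyticAt ℂ (fun x => Complex.exp (κ * x) * ∑ i : Fin 4,
      ∑ j ∈ Finset.range (lTilde l i), β i j * iteratedDeriv j (Phi L i α) x) x := by
    refine AnalyticAt.fun_mul (by fun_prop) (Finset.analyticAt_fun_sum _ fun i _ =>
      Finset.analyticAt_fun_sum _ fun j _ => AnalyticAt.fun_mul analyticAt_const ?_)
    rw [iteratedDeriv_eq_iterate]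
    exact (hPhi i).iterated_deriv j
  exact h1.congr (by filter_upwards [(isOpen_offHalf L).mem_nhds hx] with y hy using (hβ y hy).symm)

/-- The logarithmic derivative of `Λ_g` is a rational function of `℘` and `℘'`. -/
lemma IsLambdaG.hasDerivAt {δ μ c q : ℂ} {Ξ Λ : ℂ → ℂ} {U : ℂ[X]}
    (hU : IsRational L l δ μ c Ξ U) (hΛ : IsLambdaG L δ Ξ q Λ) {x : ℂ} (hx : IsOrdinary L δ x)
    (hUx : U.eval (L.weierstrassP x) ≠ 0) :
    let D := dataAt L l (L.weierstrassP δ) μ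
    let z := L.weierstrassP x
    Λ x ≠ 0 ∧ HasDerivAt Λ (Λ x * (L.derivWeierstrassP x / 2 *
      ((derivative U).eval z / U.eval z - (derivative D.gauge).eval z / D.gauge.eval z)
      + q * D.den.eval z / U.eval z)) x := by
  intro D z
  have hG : ∀ x, IsOrdinary L δ x → D.gauge.eval (L.weierstrassP x) ≠ 0 :=
    fun x hx => eval_gauge_ne_zero (l := l) (b := L.weierstrassP δ) (μ := μ) hx.1
  have hM : D.den.eval z ≠ 0 := eval_den_ne_zero (l := l) (μ := μ) hx
  have hΞ : ∀ x, IsOrdinary L δ x → Ξ x * (L.weierstrassP x - L.weierstrassP δ) =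
      U.eval (L.weierstrassP x) / D.gauge.eval (L.weierstrassP x) := fun x hx => by
    rw [eq_div_iff (hG x hx), ← hU.2.2 x hx, Params.den]
    simp [D, dataAt]; ring
  have hΞx : Ξ x ≠ 0 := fun h => by have := hU.2.2 x hx; simp [h] at this; exact hUx this.symm
  -- locally `Λ = s exp h` with `s² = U / gauge` at `℘` and `h' = q / Ξ`
  obtain ⟨s, h, hs, hh, hev⟩ := hΛ x hx hΞx
  obtain ⟨e1, e2, e3⟩ := hev.self_of_nhds
  have hs0 : s x ≠ 0 := fun h0 => by
    rw [h0, hΞ x hx] at e1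
    exact div_ne_zero hUx (hG x hx) (by simpa using e1.symm)
  refine ⟨by rw [e3]; exact mul_ne_zero hs0 (Complex.exp_ne_zero _), ?_⟩
  have hP := hasDerivAt_weierstrassP (notMem_of_mem_offHalf hx.1)
  have k1 := (hs.differentiableAt.hasDerivAt.fun_pow 2).congr_of_eventuallyEq
    (f₁ := fun x => U.eval (L.weierstrassP x) / D.gauge.eval (L.weierstrassP x)) (by
      filter_upwards [hev, (isOpen_isOrdinary (L := L) δ).mem_nhds hx] with y hy hy'
      rw [hy.1, hΞ y hy'])
  have k2 := ((U.hasDerivAt z).comp x hP).fun_div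
    (HasDerivAt.comp (h₂ := fun z => D.gauge.eval z) x (D.gauge.hasDerivAt z) hP) (hG x hx)
  have k3 := k1.unique k2
  have k4 := (hs.differentiableAt.hasDerivAt.fun_mul hh.differentiableAt.hasDerivAt.cexp)
  refine (k4.congr_of_eventuallyEq (hev.mono fun y hy => hy.2.2)).congr_deriv ?_
  have hq : q / Ξ x = q * D.den.eval z / U.eval z := by
    rw [hU.eq_div hx, pow_zero, mul_one, div_div_eq_mul_div]
  rw [e2, hq, e3]
  have e1' : s x ^ 2 = U.eval z / D.gauge.eval z := by rw [e1, hΞ x hx]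
  simp only [Function.comp_apply] at k3
  change _ = (eval z (derivative U) * L.derivWeierstrassP x * eval z D.gauge -
    eval z U * (eval z (derivative D.gauge) * L.derivWeierstrassP x)) / eval z D.gauge ^ 2 at k3
  have hGx : eval z D.gauge ≠ 0 := hG x hx
  have hUx' : eval z U ≠ 0 := hUx
  have k5 : deriv s x = s x * (L.derivWeierstrassP x / 2 *
      (eval z (derivative U) / eval z U - eval z (derivative D.gauge) / eval z D.gauge)) := by
    rw [← mul_right_inj' (mul_ne_zero two_ne_zero hs0)]
    have : 2 * s x * deriv s x = ((2 : ℕ) : ℂ) * s x ^ (2 - 1) * deriv s x := by norm_num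
    rw [this, k3, show 2 * s x * (s x * (L.derivWeierstrassP x / 2 *
      (eval z (derivative U) / eval z U - eval z (derivative D.gauge) / eval z D.gauge))) =
      s x ^ 2 * (L.derivWeierstrassP x * (eval z (derivative U) / eval z U
        - eval z (derivative D.gauge) / eval z D.gauge)) by ring, e1']
    field_simp
  rw [k5]
  ring

/-! ### The square root of the gauge factor -/

/-- For one of the factorisations `chat = sqPart * cosqPart`, the product `gauge * sqPart` is a
square, or a square times `chat`, depending on the parities of the exponents. -/
lemma exists_sq_gauge {A : Type*} [CommRing A] (d : Params A) :
    ∃ (o : Option (Fin 3)) (S : A[X]),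
      d.sqPart o * d.gauge = S ^ 2 ∨ d.sqPart o * d.gauge = S ^ 2 * d.chat := by
  rw [Params.gauge, Params.chat, Fin.prod_univ_three, Fin.prod_univ_three]
  obtain ⟨a, ha⟩ := Nat.even_or_odd' (d.l 0)
  obtain ⟨b, hb⟩ := Nat.even_or_odd' (d.l 1)
  obtain ⟨c, hc⟩ := Nat.even_or_odd' (d.l 2)
  set f := fun i => (X : A[X]) - C (d.e i)
  change ∃ (o : Option (Fin 3)) (S : A[X]),
      d.sqPart o * (f 0 ^ d.l 0 * f 1 ^ d.l 1 * f 2 ^ d.l 2) = S ^ 2 ∨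
      d.sqPart o * (f 0 ^ d.l 0 * f 1 ^ d.l 1 * f 2 ^ d.l 2) = S ^ 2 * (f 0 * f 1 * f 2)
  have hn : d.sqPart none = 1 := rfl
  have hs : ∀ i, d.sqPart (some i) = f i := fun _ => rfl
  rcases ha with ha | ha <;> rcases hb with hb | hb <;> rcases hc with hc | hc <;>
    rw [ha, hb, hc]
  · exact ⟨none, f 0 ^ a * f 1 ^ b * f 2 ^ c, .inl (by rw [hn]; ring)⟩
  · exact ⟨some 2, f 0 ^ a * f 1 ^ b * f 2 ^ (c + 1), .inl (by rw [hs]; ring)⟩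
  · exact ⟨some 1, f 0 ^ a * f 1 ^ (b + 1) * f 2 ^ c, .inl (by rw [hs]; ring)⟩
  · exact ⟨some 0, f 0 ^ a * f 1 ^ b * f 2 ^ c, .inr (by rw [hs]; ring)⟩
  · exact ⟨some 0, f 0 ^ (a + 1) * f 1 ^ b * f 2 ^ c, .inl (by rw [hs]; ring)⟩
  · exact ⟨some 1, f 0 ^ a * f 1 ^ b * f 2 ^ c, .inr (by rw [hs]; ring)⟩
  · exact ⟨some 2, f 0 ^ a * f 1 ^ b * f 2 ^ c, .inr (by rw [hs]; ring)⟩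
  · exact ⟨none, f 0 ^ a * f 1 ^ b * f 2 ^ c, .inr (by rw [hn]; ring)⟩

/-- An elliptic square root of `sqPart * gauge`. In the second case the root of `chat` is `℘' / 2`.
-/
lemma exists_sqrt_gauge (D : Params ℂ) (hD : D.chat = rootPoly L) {o : Option (Fin 3)} {S : ℂ[X]}
    (hS : D.sqPart o * D.gauge = S ^ 2 ∨ D.sqPart o * D.gauge = S ^ 2 * D.chat) :
    ∃ ρ : ℂ → ℂ, AnalyticOnNhd ℂ ρ (offHalf L) ∧ (∀ x, ∀ w ∈ L.lattice, ρ (x + w) = ρ x) ∧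
      ∀ x ∈ offHalf L, ρ x ^ 2 = (D.sqPart o * D.gauge).eval (L.weierstrassP x) := by
  have hP : AnalyticOnNhd ℂ (fun x => S.eval (L.weierstrassP x)) (offHalf L) := fun x hx => by
    have := (analyticAt_weierstrassP (notMem_of_mem_offHalf hx)).aeval_polynomial S
    simpa [aeval_def, eval₂_eq_eval_map] using this
  rcases hS with hS | hS
  · exact ⟨fun x => S.eval (L.weierstrassP x), hP,
      fun x w hw => by simp only [weierstrassP_add x hw], fun x _ => by rw [hS, eval_pow]⟩
  · refine ⟨fun x => S.eval (L.weierstrassP x) * (L.derivWeierstrassP x / 2), fun x hx =>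
      (hP x hx).fun_mul ((analyticAt_derivWeierstrassP (notMem_of_mem_offHalf hx)).div_const),
      fun x w hw => by simp only [weierstrassP_add x hw, derivWeierstrassP_add x hw],
      fun x hx => ?_⟩
    have := derivWeierstrassP_sq_eq (notMem_of_mem_offHalf hx)
    rw [hS, eval_mul, eval_pow, hD]
    linear_combination eval (L.weierstrassP x) S ^ 2 / 4 * this

end HKAnsatz

namespace HKAnsatz
open Filter Topology Polynomial
variable {L : PeriodPair} {l : Fin 4 → ℕ}

/-! ### Comparison of `Λ_g` with an elliptic function -/

/-- Two functions that satisfy the same first order linear equation on an open set, and are analytic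
off the half lattice, are proportional there. -/
lemma exists_eq_const_mul {u W t : ℂ → ℂ} {G : Set ℂ} (hG : IsOpen G) (hGL : G ⊆ offHalf L)
    {x₀ : ℂ} (hx₀ : x₀ ∈ G) (hu : AnalyticOnNhd ℂ u (offHalf L))
    (hW : AnalyticOnNhd ℂ W (offHalf L)) (hu' : ∀ x ∈ G, HasDerivAt u (u x * t x) x)
    (hW' : ∀ x ∈ G, HasDerivAt W (W x * t x) x) (hW0 : ∀ x ∈ G, W x ≠ 0) :
    ∀ x ∈ offHalf L, W x₀ * u x = u x₀ * W x := by
  have hquot : ∀ x ∈ G, HasDerivAt (fun x => u x / W x) 0 x := fun x hx =>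
    ((hu' x hx).fun_div (hW' x hx) (hW0 x hx)).congr_deriv (by ring)
  obtain ⟨ε, hε, hball⟩ := Metric.isOpen_iff.mp hG x₀ hx₀
  have hev : (fun x => W x₀ * u x) =ᶠ[𝓝 x₀] fun x => u x₀ * W x := by
    filter_upwards [Metric.ball_mem_nhds x₀ hε] with x hx
    have h := Metric.isOpen_ball.is_const_of_deriv_eq_zero (convex_ball x₀ ε).isPreconnected
      (fun y hy => (hquot y (hball hy)).differentiableAt.differentiableWithinAt)
      (fun y hy => (hquot y (hball hy)).deriv) hx (Metric.mem_ball_self hε)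
    have h1 := hW0 x (hball hx)
    have h2 := hW0 x₀ hx₀
    field_simp at h
    linear_combination h
  exact fun x hx => (analyticOnNhd_const.mul hu).eqOn_of_preconnected_of_eventuallyEq
    (analyticOnNhd_const.mul hW) (isPreconnected_offHalf L) (hGL hx₀) hev hx

/-- The logarithmic derivative of the elliptic function `sqPart(℘) p(℘) + ℘' r(℘)`: its part odd in
`x` comes from the norm of the function, and its even part is given by `wnum`. -/
lemma hasDerivAt_factor {D : Params ℂ} (hD : D.chat = rootPoly L) (o : Option (Fin 3))
    {p r N : ℂ[X]} (hN : D.sqPart o * p ^ 2 - 4 * D.cosqPart o * r ^ 2 = N) {x : ℂ}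
    (hx : x ∈ offHalf L) (hN0 : N.eval (L.weierstrassP x) ≠ 0)
    (hs0 : (D.sqPart o).eval (L.weierstrassP x) ≠ 0) :
    let z := L.weierstrassP x
    let y := L.derivWeierstrassP x
    HasDerivAt (fun x => (D.sqPart o * p).eval (L.weierstrassP x) +
        L.derivWeierstrassP x * r.eval (L.weierstrassP x))
      (((D.sqPart o * p).eval z + y * r.eval z) * (y / 2 *
        ((derivative (D.sqPart o)).eval z / (D.sqPart o).eval z +
          (derivative N).eval z / N.eval z)
        + (Params.wnum (D.sqPart o) (D.cosqPart o) p r).eval z / N.eval z)) x := by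
  intro z y
  have hy := derivWeierstrassP_sq_eq (notMem_of_mem_offHalf hx)
  have hP := hasDerivAt_weierstrassP (notMem_of_mem_offHalf hx)
  have h1 := ((D.sqPart o * p).hasDerivAt z).comp x hP
  have h2 := (hasDerivAt_derivWeierstrassP hx).fun_mul ((r.hasDerivAt z).comp x hP)
  refine (h1.fun_add h2).congr_deriv ?_
  have hN' : N.eval z = (D.sqPart o).eval z * p.eval z ^ 2
      - 4 * (D.cosqPart o).eval z * r.eval z ^ 2 := by rw [← hN]; simp
  have hdN : (derivative N).eval z = (derivative (D.sqPart o)).eval z * p.eval z ^ 2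
      + 2 * (D.sqPart o).eval z * p.eval z * (derivative p).eval z
      - 4 * (derivative (D.cosqPart o)).eval z * r.eval z ^ 2
      - 8 * (D.cosqPart o).eval z * r.eval z * (derivative r).eval z := by
    rw [← hN]; simp [pow_two]; ring
  rw [← hD, ← D.sqPart_mul o] at *
  simp only [Params.wnum, derivative_mul, eval_mul, eval_add, eval_sub, eval_ofNat,
    Function.comp_apply] at hy ⊢
  change y ^ 2 = 4 * (eval z _ * eval z _) at hy
  change _ + (2 * (eval z _ * eval z _ + eval z _ * eval z _) * eval z r + y * (_ * y)) = _
  change N.eval z ≠ 0 at hN0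
  change eval z (D.sqPart o) ≠ 0 at hs0
  change _ * y + _ = _
  generalize eval z (derivative N) = N' at *
  generalize eval z N = Nz at *
  clear_value y z
  generalize eval z (derivative (D.sqPart o)) = h' at *
  generalize eval z (D.sqPart o) = h at *
  generalize eval z (derivative (D.cosqPart o)) = k' at *
  generalize eval z (D.cosqPart o) = k at *
  generalize eval z (derivative p) = p' at *
  generalize eval z p = p at *
  generalize eval z (derivative r) = r' at *
  generalize eval z r = r at *
  subst hdN
  field_simp
  subst hN'
  linear_combination (2 * h * (h * p ^ 2 - 4 * k * r ^ 2) * r' - r * (h' * (h * p ^ 2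
    - 4 * k * r ^ 2) + h * (h' * p ^ 2 + 2 * h * p * p' - 4 * k' * r ^ 2 - 8 * k * r * r'))) * hy

/-- The situation of the comparison: `Λ_g` times a function `E` with prescribed logarithmic
derivative and multipliers is proportional to an elliptic function. This fixes the multipliers. -/
lemma multiplier_eq_one {δ μ c q α κ : ℂ} {Ξ Λ : ℂ → ℂ} {U : ℂ[X]}
    (hU : IsRational L l δ μ c Ξ U) (hU0 : U ≠ 0) (hΛ : IsLambdaG L δ Ξ q Λ)
    (hHK : IsHermiteKrichever L l α κ Λ) {o : Option (Fin 3)} {S : ℂ[X]}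
    {D : Params ℂ} (hD : D = dataAt L l (L.weierstrassP δ) μ)
    (hS : D.sqPart o * D.gauge = S ^ 2 ∨ D.sqPart o * D.gauge = S ^ 2 * D.chat)
    {p r : ℂ[X]} {n₁ n₀ y₁ y₀ : ℂ} (hn : n₁ ≠ 0 ∨ n₀ ≠ 0)
    (h1 : D.sqPart o * p ^ 2 - 4 * D.cosqPart o * r ^ 2 = U * (C n₁ * X + C n₀))
    (h2 : C q * D.den * (C n₁ * X + C n₀) - Params.wnum (D.sqPart o) (D.cosqPart o) p r
      = U * (C y₁ * X + C y₀))
    {E : ℂ → ℂ} (hE : AnalyticOnNhd ℂ E (offHalf L))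
    (hE' : ∀ x ∈ offHalf L, n₁ * L.weierstrassP x + n₀ ≠ 0 → E x ≠ 0 ∧ HasDerivAt E
      (E x * ((n₁ * L.derivWeierstrassP x / 2 - (y₁ * L.weierstrassP x + y₀)) /
        (n₁ * L.weierstrassP x + n₀))) x)
    {w η m k : ℂ} (hw : w ∈ L.lattice) (hk : k ≠ 0)
    (hη : ∀ z, sigma L (z + w) = k * Complex.exp (η * z) * sigma L z)
    (hm : ∀ x ∈ offHalf L, E (x + w) = Complex.exp m * E x) :
    Complex.exp (w * (κ + zeta L α) - η * α + m) = 1 := by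
  have hchat : D.chat = rootPoly L := by rw [hD]; rfl
  obtain ⟨ρ, hρ, hρp, hρ2⟩ := exists_sqrt_gauge (L := L) D hchat hS
  have hlin : (C n₁ * X + C n₀ : ℂ[X]) ≠ 0 := fun h => by
    rcases hn with hn | hn
    · exact hn (by simpa using congrArg (coeff · 1) h)
    · exact hn (by simpa using congrArg (coeff · 0) h)
  set G : Set ℂ := {x | IsOrdinary L δ x ∧ (U * (C n₁ * X + C n₀)).eval (L.weierstrassP x) ≠ 0}
    with hGdef
  have hPan : ∀ F : ℂ[X], AnalyticOnNhd ℂ (fun x => F.eval (L.weierstrassP x)) (offHalf L) :=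
    fun F x hx => by
      have := (analyticAt_weierstrassP (notMem_of_mem_offHalf hx)).aeval_polynomial F
      simpa [aeval_def, eval₂_eq_eval_map] using this
  have hG : IsOpen G := by
    rw [isOpen_iff_mem_nhds]
    intro x hx
    filter_upwards [(isOpen_isOrdinary (L := L) δ).mem_nhds hx.1,
      (hPan (U * (C n₁ * X + C n₀)) x hx.1.1).continuousAt.eventually_ne hx.2] with y h1 h2
      using ⟨h1, h2⟩
  obtain ⟨x₀, hx₀⟩ : ∃ x₀, x₀ ∈ G := by
    by_contra! h
    refine mul_ne_zero hU0 hlin (eq_zero_of_eval_weierstrassP (L := L) (δ := δ) fun x hx => ?_)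
    by_contra h3
    exact h x ⟨hx, h3⟩
  have hs0 : ∀ x ∈ offHalf L, (D.sqPart o).eval (L.weierstrassP x) ≠ 0 := fun x hx h => by
    have := eval_chat_ne_zero (l := l) (b := L.weierstrassP δ) (μ := μ) hx
    rw [← hD, ← D.sqPart_mul o, eval_mul, h, zero_mul] at this
    exact this rfl
  have hg0 : ∀ x ∈ offHalf L, D.gauge.eval (L.weierstrassP x) ≠ 0 := fun x hx => by
    rw [hD]; exact eval_gauge_ne_zero hx
  have hρ0 : ∀ x ∈ offHalf L, ρ x ≠ 0 := fun x hx h => by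
    have := hρ2 x hx
    rw [h, eval_mul] at this
    exact mul_ne_zero (hs0 x hx) (hg0 x hx) (by simpa using this.symm)
  -- the logarithmic derivative of the square root
  have hρ' : ∀ x ∈ offHalf L, HasDerivAt ρ (ρ x * (L.derivWeierstrassP x / 2 *
      ((derivative (D.sqPart o)).eval (L.weierstrassP x) / (D.sqPart o).eval (L.weierstrassP x) +
        (derivative D.gauge).eval (L.weierstrassP x) / D.gauge.eval (L.weierstrassP x)))) x := by
    intro x hx
    have hd := (hρ x hx).differentiableAt.hasDerivAt
    refine hd.congr_deriv ?_
    have k1 := (hd.fun_pow 2).congr_of_eventuallyEq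
      (f₁ := fun x => (D.sqPart o * D.gauge).eval (L.weierstrassP x)) (by
        filter_upwards [(isOpen_offHalf L).mem_nhds hx] with y hy using (hρ2 y hy).symm)
    have k2 := k1.unique (((D.sqPart o * D.gauge).hasDerivAt _).comp x
      (hasDerivAt_weierstrassP (notMem_of_mem_offHalf hx)))
    have k3 := hρ2 x hx
    have e1 := hs0 x hx
    have e2 := hg0 x hx
    rw [← mul_right_inj' (mul_ne_zero two_ne_zero (hρ0 x hx))]
    simp only [derivative_mul, eval_add, eval_mul] at k2 k3
    norm_num at k2
    rw [k2, show ∀ a b : ℂ, 2 * a * (a * b) = a ^ 2 * (2 * b) by intros; ring, k3]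
    field_simp
  -- the elliptic function, to be compared with `Λ * E * ρ`
  have hu : AnalyticOnNhd ℂ (fun x => (D.sqPart o * p).eval (L.weierstrassP x) +
      L.derivWeierstrassP x * r.eval (L.weierstrassP x)) (offHalf L) := fun x hx =>
    (hPan _ x hx).fun_add ((analyticAt_derivWeierstrassP (notMem_of_mem_offHalf hx)).fun_mul
      (hPan r x hx))
  have hW : AnalyticOnNhd ℂ (fun x => Λ x * E x * ρ x) (offHalf L) := fun x hx =>
    ((hHK.analyticOnNhd x hx).fun_mul (hE x hx)).fun_mul (hρ x hx)
  have hΛ' := fun x (hx : x ∈ G) => IsLambdaG.hasDerivAt hU hΛ hx.1 (by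
    have := hx.2; rw [eval_mul] at this; exact left_ne_zero_of_mul this)
  rw [← hD] at hΛ'
  have hGn : ∀ x ∈ G, n₁ * L.weierstrassP x + n₀ ≠ 0 := fun x hx => by
    have := hx.2; rw [eval_mul] at this; simpa using right_ne_zero_of_mul this
  have hGU : ∀ x ∈ G, U.eval (L.weierstrassP x) ≠ 0 := fun x hx => by
    have := hx.2; rw [eval_mul] at this; simpa using left_ne_zero_of_mul this
  have hprop := exists_eq_const_mul hG (fun x hx => hx.1.1) hx₀ hu hW
    (fun x hx => hasDerivAt_factor hchat o h1 hx.1.1 hx.2 (hs0 x hx.1.1))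
    (fun x hx => (((hΛ' x hx).2.fun_mul (hE' x hx.1.1 (hGn x hx)).2).fun_mul
      (hρ' x hx.1.1)).congr_deriv (by
        have k1 := congrArg (eval (L.weierstrassP x)) h2
        simp only [eval_sub, eval_mul, eval_add, eval_X, eval_C] at k1
        have k2 : (Params.wnum (D.sqPart o) (D.cosqPart o) p r).eval (L.weierstrassP x) =
          q * D.den.eval (L.weierstrassP x) * (n₁ * L.weierstrassP x + n₀) -
            U.eval (L.weierstrassP x) * (y₁ * L.weierstrassP x + y₀) := by
          linear_combination -k1
        have e1 := hGn x hx
        have e2 := hGU x hx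
        have e3 := hs0 x hx.1.1
        have e4 := hg0 x hx.1.1
        rw [k2]
        simp only [derivative_mul, derivative_add, derivative_X, derivative_C, eval_add, eval_mul,
          eval_X, eval_C, eval_one, eval_zero]
        field_simp
        ring))
    (fun x hx => mul_ne_zero (mul_ne_zero (hΛ' x hx).1 (hE' x hx.1.1 (hGn x hx)).1)
      (hρ0 x hx.1.1))
  have hW0 : Λ x₀ * E x₀ * ρ x₀ ≠ 0 := mul_ne_zero (mul_ne_zero (hΛ' x₀ hx₀).1
    (hE' x₀ hx₀.1.1 (hGn x₀ hx₀)).1) (hρ0 x₀ hx₀.1.1)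
  have hx₀w : x₀ + w ∈ offHalf L := by
    change 2 * (x₀ + w) ∉ L.lattice
    rw [mul_add]; exact add_notMem hx₀.1.1 (by rw [two_mul]; exact add_mem hw hw)
  -- the elliptic function does not vanish at `x₀`, since its norm does not
  have hu0 : (D.sqPart o * p).eval (L.weierstrassP x₀) +
      L.derivWeierstrassP x₀ * r.eval (L.weierstrassP x₀) ≠ 0 := fun h => by
    have k := congrArg (eval (L.weierstrassP x₀)) h1
    have hy := derivWeierstrassP_sq_eq (notMem_of_mem_offHalf hx₀.1.1)
    rw [← hchat, ← D.sqPart_mul o] at hy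
    refine mul_ne_zero (hs0 x₀ hx₀.1.1) hx₀.2 ?_
    rw [← k]
    simp only [eval_sub, eval_mul, eval_pow, eval_ofNat] at h hy ⊢
    linear_combination (eval (L.weierstrassP x₀) (D.sqPart o) * eval (L.weierstrassP x₀) p -
      L.derivWeierstrassP x₀ * eval (L.weierstrassP x₀) r) * h +
      eval (L.weierstrassP x₀) r ^ 2 * hy
  -- Proportionality at `x₀` and at `x₀ + w` forces the multiplier of `Λ * E` to be trivial.
  have key := hprop _ hx₀w
  simp only [weierstrassP_add x₀ hw, derivWeierstrassP_add x₀ hw, hρp x₀ w hw, hm x₀ hx₀.1.1,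
    hHK.quasiperiodic hw hk hη hx₀.1.1] at key
  rw [Complex.exp_add]
  refine mul_left_cancel₀ (mul_ne_zero hu0 hW0) ?_
  linear_combination -key

end HKAnsatz

namespace HKAnsatz
open Filter Topology Polynomial
variable {L : PeriodPair} {l : Fin 4 → ℕ}

/-! ### Determination of `α` and `κ` -/

/-- The multiplier of `exp(s x) σ(x + γ) / σ(x)`. -/
lemma sigma_quotient_add {w η k γ : ℂ} (hk : k ≠ 0)
    (hη : ∀ z, sigma L (z + w) = k * Complex.exp (η * z) * sigma L z) (s x : ℂ) :
    Complex.exp (s * (x + w)) * sigma L (x + w + γ) / sigma L (x + w) =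
      Complex.exp (s * w + η * γ) * (Complex.exp (s * x) * sigma L (x + γ) / sigma L x) := by
  rw [show x + w + γ = x + γ + w by ring, hη, hη, mul_add, mul_add, Complex.exp_add,
    Complex.exp_add, Complex.exp_add]
  by_cases hs : sigma L x = 0
  · simp [hs]
  · field_simp

/-- If the multipliers `exp(s w + η(w) γ)` are trivial, then `γ` is a period. -/
lemma mem_lattice_of_multiplier {s γ : ℂ}
    (h : ∀ w ∈ L.lattice, ∀ η k : ℂ, k ≠ 0 →
      (∀ z, sigma L (z + w) = k * Complex.exp (η * z) * sigma L z) →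
      Complex.exp (s * w + η * γ) = 1) :
    γ ∈ L.lattice ∧ ∀ z, z ∉ L.lattice → zeta L (z + γ) = zeta L z - s := by
  refine mem_lattice_of_periodic fun z w hw => ?_
  obtain ⟨η, k, hk, hη, -⟩ := exists_quasiPeriod hw
  rw [sigma_quotient_add hk hη, h w hw η k hk hη, one_mul]

/-- The Hermite–Krichever parameters are determined by the line data. The function `E` of
`multiplier_eq_one` is `exp(t x) σ(x + γ) / σ(x)`, where `γ` is the point of the elliptic curve over
the root of the linear factor; by the addition theorem of `ζ` its logarithmic derivative is the
prescribed one. Comparison of multipliers gives `α = γ` modulo periods, and `κ`. -/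
theorem parameters_of_line_data {δ μ c q α κ : ℂ} {Ξ Λ : ℂ → ℂ} {U : ℂ[X]}
    (hU : IsRational L l δ μ c Ξ U) (hU0 : U ≠ 0) (hΛ : IsLambdaG L δ Ξ q Λ)
    (hHK : IsHermiteKrichever L l α κ Λ) {o : Option (Fin 3)} {S : ℂ[X]}
    {D : Params ℂ} (hD : D = dataAt L l (L.weierstrassP δ) μ)
    (hS : D.sqPart o * D.gauge = S ^ 2 ∨ D.sqPart o * D.gauge = S ^ 2 * D.chat)
    {p r : ℂ[X]} {n₁ n₀ y₁ y₀ : ℂ} (hn : n₁ ≠ 0 ∨ n₀ ≠ 0)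
    (h1 : D.sqPart o * p ^ 2 - 4 * D.cosqPart o * r ^ 2 = U * (C n₁ * X + C n₀))
    (h2 : C q * D.den * (C n₁ * X + C n₀) - Params.wnum (D.sqPart o) (D.cosqPart o) p r
      = U * (C y₁ * X + C y₀))
    (h3 : n₁ * ∏ i, (n₀ + roots L i * n₁) = -(y₀ * n₁ - y₁ * n₀) ^ 2) :
    n₁ ≠ 0 ∧ n₁ * L.weierstrassP α = -n₀ ∧
      n₁ ^ 2 * L.derivWeierstrassP α = 2 * (y₀ * n₁ - y₁ * n₀) ∧ n₁ * κ = y₁ := by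
  by_cases hn₁ : n₁ = 0
  · -- Here `E` is an exponential, and the point `α` would be a period.
    exfalso
    subst hn₁
    have hn₀ : n₀ ≠ 0 := hn.resolve_left (by simp)
    have hy₁ : y₁ = 0 := by simpa [hn₀] using h3
    subst hy₁
    have hE : ∀ x, HasDerivAt (fun x => Complex.exp (-(y₀ / n₀) * x))
        (Complex.exp (-(y₀ / n₀) * x) * -(y₀ / n₀)) x := fun x => by
      simpa using ((hasDerivAt_id x).const_mul (-(y₀ / n₀))).cexp
    have h := mem_lattice_of_multiplier (L := L) (s := κ + zeta L α - y₀ / n₀) (γ := -α)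
      fun w hw η k hk hη => by
        have := multiplier_eq_one hU hU0 hΛ hHK hD hS hn h1 h2
          (E := fun x => Complex.exp (-(y₀ / n₀) * x)) (fun x _ => by fun_prop)
          (fun x _ _ => ⟨Complex.exp_ne_zero _, (hE x).congr_deriv (by simp [neg_div])⟩)
          (m := -(y₀ / n₀) * w) hw hk hη
          (fun x _ => by rw [← Complex.exp_add]; ring_nf)
        rw [← this]; ring_nf
    exact hHK.1 (by simpa using h.1)
  refine ⟨hn₁, ?_⟩
  set a := -n₀ / n₁ with ha
  set a' := 2 * (y₁ * a + y₀) / n₁ with ha'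
  have hn₀ : n₀ = -(n₁ * a) := by rw [ha]; field_simp
  have hy₀ : 2 * y₀ = n₁ * a' - 2 * y₁ * a := by rw [ha']; field_simp; ring
  -- the point of the elliptic curve determined by the line data
  obtain ⟨γ, hγ, hγa, hγa'⟩ : ∃ γ, γ ∉ L.lattice ∧ L.weierstrassP γ = a ∧
      L.derivWeierstrassP γ = a' := by
    obtain ⟨x, hx, hxa⟩ := exists_weierstrassP_eq L a
    have hsq : L.derivWeierstrassP x ^ 2 = a' ^ 2 := by
      rw [derivWeierstrassP_sq_eq hx, hxa, eval_rootPoly]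
      rw [hn₀, Fin.prod_univ_three] at h3
      have : n₁ ^ 4 * (4 * ((a - roots L 0) * (a - roots L 1) * (a - roots L 2))) =
          n₁ ^ 4 * a' ^ 2 := by
        linear_combination (-4) * h3 + (2 * y₀ + n₁ * a' + 2 * y₁ * a) * n₁ ^ 2 * hy₀
      exact mul_left_cancel₀ (pow_ne_zero 4 hn₁) this
    rcases sq_eq_sq_iff_eq_or_eq_neg.mp hsq with h | h
    · exact ⟨x, hx, hxa, h⟩
    · exact ⟨-x, by rwa [neg_mem_iff], by rw [L.weierstrassP_neg, hxa],
        by rw [L.derivWeierstrassP_neg, h, neg_neg]⟩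
  set t := -(zeta L γ + y₁ / n₁) with ht
  have hexp : ∀ x, HasDerivAt (fun x => Complex.exp (t * x)) (Complex.exp (t * x) * t) x :=
    fun x => by simpa using ((hasDerivAt_id x).const_mul t).cexp
  have hs : ∀ z, AnalyticAt ℂ (sigma L) z := (differentiable_sigma L).analyticAt
  have h := mem_lattice_of_multiplier (L := L) (s := κ + zeta L α + t) (γ := γ - α)
    fun w hw η k hk hη => by
      have := multiplier_eq_one hU hU0 hΛ hHK hD hS hn h1 h2
        (E := fun x => Complex.exp (t * x) * sigma L (x + γ) / sigma L x)
        (fun x hx => by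
          have k1 : AnalyticAt ℂ (fun x => sigma L (x + γ)) x :=
            (hs _).fun_comp (f := fun x => x + γ) (by fun_prop)
          have k2 : AnalyticAt ℂ (fun x => Complex.exp (t * x)) x := by fun_prop
          exact (k2.fun_mul k1).fun_div (hs x) (sigma_ne_zero (notMem_of_mem_offHalf hx)))
        (fun x hx hxn => by
          have hx0 := notMem_of_mem_offHalf hx
          have hne : L.weierstrassP x ≠ L.weierstrassP γ := fun h => hxn (by
            rw [h, hγa, hn₀]; ring)
          have hxγ := (add_sub_notMem hx0 hγ hne).1
          refine ⟨div_ne_zero (mul_ne_zero (Complex.exp_ne_zero _) (sigma_ne_zero hxγ))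
            (sigma_ne_zero hx0), ?_⟩
          refine (((hexp x).fun_mul ((hasDerivAt_sigma hxγ).comp_add_const x γ)).fun_div
            (hasDerivAt_sigma hx0) (sigma_ne_zero hx0)).congr_deriv ?_
          have hz := sigma_ne_zero hx0
          have hne' := sub_ne_zero.mpr hne
          rw [hγa] at hne'
          rw [zeta_add hx0 hγ hne, hγa, hγa', ht, hn₀,
            show n₁ * L.weierstrassP x + -(n₁ * a) = n₁ * (L.weierstrassP x - a) by ring,
            show y₀ = (n₁ * a' - 2 * y₁ * a) / 2 by rw [← hy₀]; ring]
          field_simp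
          ring)
        (m := t * w + η * γ) hw hk hη (fun x _ => sigma_quotient_add hk hη t x)
      rw [← this]; ring_nf
  have e1 : L.weierstrassP α = a := by
    rw [← hγa, ← weierstrassP_add α h.1]; ring_nf
  have e2 : L.derivWeierstrassP α = a' := by
    rw [← hγa', ← derivWeierstrassP_add α h.1]; ring_nf
  have e3 : κ = y₁ / n₁ := by
    have := h.2 α hHK.1
    rw [show α + (γ - α) = γ by ring] at this
    rw [ht] at this
    linear_combination this
  refine ⟨by rw [e1, hn₀]; ring, ?_, by rw [e3]; field_simp⟩
  rw [e2, hn₀]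
  linear_combination -n₁ * hy₀

/-! ### Fractions in two variables -/

/-- The isomorphism of the two descriptions of polynomials in `b` and `μ`. -/
noncomputable def toIterated : MvPolynomial (Fin 2) ℂ →+* ℂ[X][X] :=
  MvPolynomial.eval₂Hom (C.comp C) ![C X, X]

lemma evalPair_toIterated (b μ : ℂ) (P : MvPolynomial (Fin 2) ℂ) :
    Params.evalPair b μ (toIterated P) = evalAt P b μ := by
  have : (Params.evalPair b μ).comp toIterated = MvPolynomial.eval ![b, μ] := by
    refine MvPolynomial.ringHom_ext (fun a => ?_) fun i => ?_
    · simp [toIterated, Params.evalPair]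
    · fin_cases i <;> simp [toIterated, Params.evalPair]
  exact congrArg (fun f => f P) this

lemma toIterated_surjective : Function.Surjective toIterated := by
  rw [← RingHom.range_eq_top, eq_top_iff]
  rintro F -
  have hX : (X : ℂ[X][X]) ∈ toIterated.range := ⟨MvPolynomial.X 1, by simp [toIterated]⟩
  have hY : (C X : ℂ[X][X]) ∈ toIterated.range := ⟨MvPolynomial.X 0, by simp [toIterated]⟩
  have hC : ∀ a : ℂ, (C (C a) : ℂ[X][X]) ∈ toIterated.range :=
    fun a => ⟨MvPolynomial.C a, by simp [toIterated]⟩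
  have hCC : ∀ f : ℂ[X], (C f : ℂ[X][X]) ∈ toIterated.range := fun f => by
    induction f using Polynomial.induction_on' with
    | add f g hf hg => rw [C_add]; exact add_mem hf hg
    | monomial n a =>
      rw [← C_mul_X_pow_eq_monomial, C_mul, C_pow]
      exact mul_mem (hC a) (pow_mem hY n)
  induction F using Polynomial.induction_on' with
  | add f g hf hg => exact add_mem hf hg
  | monomial n a =>
    rw [← C_mul_X_pow_eq_monomial]
    exact mul_mem (hCC a) (pow_mem hX n)

/-- Every fraction has a representation in lowest terms. -/
lemma exists_isReducedFraction (n d : ℂ[X][X]) (hd : d ≠ 0) :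
    ∃ N D : MvPolynomial (Fin 2) ℂ, IsReducedFraction N D ∧
      toIterated N * d = n * toIterated D := by
  obtain ⟨n', rfl⟩ := toIterated_surjective n
  obtain ⟨d', rfl⟩ := toIterated_surjective d
  have hd' : d' ≠ 0 := fun h => hd (by rw [h, map_zero])
  obtain ⟨N, D, c, hrel, hN, hD⟩ :=
    UniqueFactorizationMonoid.exists_reduced_factors' n' d' hd'
  refine ⟨N, D, ⟨fun h => hd' (by rw [← hD, h, mul_zero]), hrel⟩, ?_⟩
  rw [← hN, ← hD, map_mul, map_mul]; ring

end HKAnsatz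

open HKAnsatz Polynomial in
theorem mainTheorem5 (L : PeriodPair) (l : Fin 4 → ℕ) :
    ∃ N₁ D₁ N₂ D₂ N₃ D₃ : MvPolynomial (Fin 2) ℂ,
      HKAnsatz.IsReducedFraction N₁ D₁ ∧ HKAnsatz.IsReducedFraction N₂ D₂ ∧
      HKAnsatz.IsReducedFraction N₃ D₃ ∧
      ∀ δ₁ b₁ μ₁ p : ℂ, 2 * δ₁ ∉ L.lattice → b₁ = L.weierstrassP δ₁ →
        HKAnsatz.Apparency L l b₁ μ₁ p →
      ∀ (c₀ d₀ : ℂ) (β : Fin 4 → ℕ → ℂ) (Ξ : ℂ → ℂ),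
        Ξ = HKAnsatz.Xi L l δ₁ c₀ d₀ β →
        HKAnsatz.IsProductSolution L l δ₁ μ₁ p Ξ →
      ∀ x₀ Q q : ℂ, HKAnsatz.IsOrdinary L δ₁ x₀ → Q = HKAnsatz.QAt L l δ₁ μ₁ p Ξ x₀ →
        q ^ 2 = -Q →
      ∀ (Λ : ℂ → ℂ) (α κ : ℂ), HKAnsatz.IsLambdaG L δ₁ Ξ q Λ →
        HKAnsatz.IsHermiteKrichever L l α κ Λ →
        HKAnsatz.evalAt D₁ b₁ μ₁ * L.weierstrassP α = HKAnsatz.evalAt N₁ b₁ μ₁ ∧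
        HKAnsatz.evalAt D₂ b₁ μ₁ * (d₀ * L.derivWeierstrassP α)
          = q * HKAnsatz.evalAt N₂ b₁ μ₁ ∧
        HKAnsatz.evalAt D₃ b₁ μ₁ * (d₀ * κ) = q * HKAnsatz.evalAt N₃ b₁ μ₁ := by
  set d := Params.universal (roots L) (fun i => l i.succ) (l 0) with hd
  obtain ⟨o, S, hS⟩ := exists_sq_gauge d
  obtain ⟨U, P, R, Q, ν₁, ν₀, x₁, x₀, hU, hUn, hQ, hQ0, hUb, hν, h1, h2, h3, h4⟩ :=
    Params.universal_line_data (roots_injective L) (sum_roots L) (fun i => l i.succ) (l 0) o hd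
  -- At every admissible point, each representation of the quotients of the universal line data by a
  -- fraction gives a relation for the parameters.
  have key : ∀ δ₁ μ₁ p : ℂ, 2 * δ₁ ∉ L.lattice → Apparency L l (L.weierstrassP δ₁) μ₁ p →
      ∀ (c₀ d₀ : ℂ) (β : Fin 4 → ℕ → ℂ) (Ξ : ℂ → ℂ), Ξ = Xi L l δ₁ c₀ d₀ β →
        IsProductSolution L l δ₁ μ₁ p Ξ →
      ∀ x₀' Q' q : ℂ, IsOrdinary L δ₁ x₀' → Q' = QAt L l δ₁ μ₁ p Ξ x₀' → q ^ 2 = -Q' →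
      ∀ (Λ : ℂ → ℂ) (α κ : ℂ), IsLambdaG L δ₁ Ξ q Λ → IsHermiteKrichever L l α κ Λ →
      (∀ N F : ℂ[X][X], N * ν₁ = -ν₀ * F →
        Params.evalPair (L.weierstrassP δ₁) μ₁ F * L.weierstrassP α =
          Params.evalPair (L.weierstrassP δ₁) μ₁ N) ∧
      (∀ N F : ℂ[X][X], N * (d.gauge.eval d.b * ν₁ ^ 2) =
          F * (2 * (U.eval d.b * (x₀ * ν₁ - x₁ * ν₀))) →
        Params.evalPair (L.weierstrassP δ₁) μ₁ F * (d₀ * L.derivWeierstrassP α) =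
          q * Params.evalPair (L.weierstrassP δ₁) μ₁ N) ∧
      (∀ N F : ℂ[X][X], N * (d.gauge.eval d.b * ν₁) = F * (U.eval d.b * x₁) →
        Params.evalPair (L.weierstrassP δ₁) μ₁ F * (d₀ * κ) =
          q * Params.evalPair (L.weierstrassP δ₁) μ₁ N) := by
    intro δ μ p hδ hp c₀ d₀ β Ξ hΞ hprod z₀ Q' q hz₀ hQ' hq Λ α κ hΛ hHK
    obtain ⟨V, hV⟩ := exists_isRational_Xi (L := L) (l := l) δ μ c₀ d₀ β
    rw [← hΞ] at hV
    have hV0 : V ≠ 0 := by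
      rintro rfl
      obtain ⟨x, hx, hx0⟩ := hprod.1
      rw [hV.eq_div hx, eval_zero, zero_div] at hx0
      exact hx0 rfl
    have hQV := hV.quad_eq hδ hp hprod hz₀
    rw [← hQ'] at hQV
    set D := dataAt L l (L.weierstrassP δ) μ with hD
    have hmap : d.map (Params.evalPair (L.weierstrassP δ) μ) = D := Params.universal_map _ _ _ _ _
    have hSD : D.sqPart o * D.gauge = (S.map (Params.evalPair (L.weierstrassP δ) μ)) ^ 2 ∨
        D.sqPart o * D.gauge =
          (S.map (Params.evalPair (L.weierstrassP δ) μ)) ^ 2 * D.chat := by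
      rw [← hmap, Params.map_sqPart, Params.map_gauge, Params.map_chat]
      refine hS.imp (fun h => ?_) fun h => ?_
      · rw [← Polynomial.map_mul, h, Polynomial.map_pow]
      · rw [← Polynomial.map_mul, h, Polynomial.map_mul, Polynomial.map_pow]
    obtain ⟨p', r, n₁, n₀, y₁, y₀, hn, k1, k2, k3, t1, t2, t3⟩ :=
      Params.exists_line_data_at (roots L) (fun i => l i.succ) (l 0) o hd hU hUn hQ hQ0 hν h1 h2
        h3 h4 (D := D) rfl (regular_dataAt hδ μ) (hV.symOp_eq_zero hδ hp hprod) hV.1 hV0 hQV hq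
    obtain ⟨hn₁, r1, r2, r3⟩ := parameters_of_line_data hV hV0 hΛ hHK hD hSD hn k1 k2 k3
    have hg : D.gauge.eval (L.weierstrassP δ) ≠ 0 :=
      eval_gauge_ne_zero (l := l) (b := L.weierstrassP δ) (μ := μ) hδ
    have hVb := hV.2.1
    rw [← hD] at hVb
    refine ⟨fun N F h => ?_, fun N F h => ?_, fun N F h => ?_⟩
    · refine mul_left_cancel₀ hn₁ ?_
      linear_combination Params.evalPair (L.weierstrassP δ) μ F * r1 - t1 N F h
    · have := t3 N (2 * F) (by rw [h]; ring)
      rw [hVb, map_mul, map_ofNat] at this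
      refine mul_left_cancel₀ (mul_ne_zero hg (pow_ne_zero 2 hn₁)) ?_
      linear_combination -this + d₀ * eval (L.weierstrassP δ) D.gauge *
        Params.evalPair (L.weierstrassP δ) μ F * r2
    · have := t2 N F h
      rw [hVb] at this
      refine mul_left_cancel₀ (mul_ne_zero hg hn₁) ?_
      linear_combination -this + d₀ * eval (L.weierstrassP δ) D.gauge *
        Params.evalPair (L.weierstrassP δ) μ F * r3
  have hg : d.gauge.eval d.b ≠ 0 := by
    rw [Params.gauge, eval_prod, Finset.prod_ne_zero_iff]
    intro i _
    rw [eval_pow, eval_sub, eval_X, eval_C]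
    refine pow_ne_zero _ (sub_ne_zero.mpr fun h => X_sub_C_ne_zero (roots L i) ?_)
    exact sub_eq_zero.mpr (C_injective h)
  by_cases hν₁ : ν₁ = 0
  · -- then no point is admissible
    have hred : IsReducedFraction 0 1 := ⟨one_ne_zero, isRelPrime_one_right⟩
    refine ⟨0, 1, 0, 1, 0, 1, hred, hred, hred, ?_⟩
    rintro δ b μ p hδ rfl hp c₀ d₀ β Ξ hΞ hprod z₀ Q' q hz₀ hQ' hq Λ α κ hΛ hHK
    have := (key δ μ p hδ hp c₀ d₀ β Ξ hΞ hprod z₀ Q' q hz₀ hQ' hq Λ α κ hΛ hHK).1 1 0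
      (by rw [hν₁]; ring)
    simp at this
  obtain ⟨N₁, D₁, hr₁, e₁⟩ := exists_isReducedFraction (-ν₀) ν₁ hν₁
  obtain ⟨N₂, D₂, hr₂, e₂⟩ := exists_isReducedFraction
    (2 * (U.eval d.b * (x₀ * ν₁ - x₁ * ν₀))) (d.gauge.eval d.b * ν₁ ^ 2)
    (mul_ne_zero hg (pow_ne_zero 2 hν₁))
  obtain ⟨N₃, D₃, hr₃, e₃⟩ := exists_isReducedFraction (U.eval d.b * x₁)
    (d.gauge.eval d.b * ν₁) (mul_ne_zero hg hν₁)
  refine ⟨N₁, D₁, N₂, D₂, N₃, D₃, hr₁, hr₂, hr₃, ?_⟩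
  rintro δ b μ p hδ rfl hp c₀ d₀ β Ξ hΞ hprod z₀ Q' q hz₀ hQ' hq Λ α κ hΛ hHK
  obtain ⟨k1, k2, k3⟩ := key δ μ p hδ hp c₀ d₀ β Ξ hΞ hprod z₀ Q' q hz₀ hQ' hq Λ α κ hΛ hHK
  simp only [← evalPair_toIterated]
  exact ⟨k1 _ _ e₁, k2 _ _ (by rw [e₂]; ring), k3 _ _ (by rw [e₃]; ring)⟩
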